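/- Let $\Bbbk$ be a field of characteristic $0$ and let $\mathfrak g$ be a $\mathbb Z$-graded $L_\infty$-algebra over $\Bbbk$ (cohomological grading, graded antisymmetric brackets $\ell_n$ of degree $2-n$, $\ell_1=d$), which is complete: $\mathfrak g\cong\varprojlim_c \mathfrak g/F_c\mathfrak g$ via the canonical map, where $F_c\mathfrak g$ is spanned by all iterated bracketings of at least $c$ elements. For $n\ge 0$ let $\Omega_n=\Bbbk[t_0,\dots,t_n,dt_0,\dots,dt_n]/(\sum t_i=1,\sum dt_i=0)$ be the algebra of polynomial differential forms on the $n$-simplex, and let $C_n\subseteq\Omega_n$ be the subcomplex spanned by the basic forms $$\omega_I=m!\sum_{j=0}^m(-1)^j t_{i_j}\,dt_{i_0}\cdots\widehat{dt_{i_j}}\cdots dt_{i_m},\qquad I=\{i_0<\dots<i_m\}\subseteq\{0,\dots,n\},\ I\neq\emptyset .$$ Let $i_n:C_n\to\Omega_n$ be the inclusion, $p_n(\omega)=\sum_I\big(\int_{\Delta^I}\omega\big)\,\omega_I$, and let $$h_n=\sum_{m<n}\ \sum_{i_0<\dots<i_m}(-1)^m\,\omega_{i_0\cdots i_m}\,h^{i_m}\circ\cdots\circ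 h^{i_0}$$ be Dupont's homotopy, where $h^i$ is the pullback along $(u,t)\mapsto ut+(1-u)e_i$ followed by integration over $u\in[0,1]$ (with $du$ moved to the left); thus $1-i_np_n=dh_n+h_nd$. Write $h_n$ also for the map induced by $1\otimes h_n$ on $\varprojlim_c(\mathfrak g/F_c\mathfrak g)\otimes\Omega_n$. Let $\mathrm{MC}_n(\mathfrak g)=\varprojlim_c\mathrm{MC}\big((\mathfrak g/F_c\mathfrak g)\otimes\Omega_n\big)$, where $\mathrm{MC}$ denotes the set of elements $x$ of degree $1$ with $dx+\sum_{r\ge2}\frac1{r!}\ell_r(x,\dots,x)=0$, and let $$\gamma_n(\mathfrak g)=\{\alpha\in\mathrm{MC}_n(\mathfrak g)\mid h_n\alpha=0\}$$ be the set of $n$-simplices of Getzler's Kan complex. Equip $\mathfrak g\otimes C_n$ with the $L_\infty$-structure transferred from $\mathfrak g\otimes\Omega_n$ along $(1\otimes i_n,1\otimes p_n,1\otimes h_n)$ by the tree formulae of the Homotopy Transfer Theorem, let $(1\otimes i_n)_\infty:\mathfrak g\otimes C_n\rightsquigarrow\mathfrak g\otimes\Omega_n$ be the $\infty$-morphism extending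 $1\otimes i_n$ given by the corresponding tree formulae, and let $$I_n(y)=\sum_{m\ge1}\frac1{m!}\,\big((1\otimes i_n)_\infty\big)_m(y,\dots,y)$$ for $y\in\mathrm{MC}(\mathfrak g\otimes C_n)$, where the Maurer–Cartan equation in $\mathfrak g\otimes C_n$ and the series $I_n(y)$ are understood with respect to the filtration induced by $F_\bullet\mathfrak g$. Then, for every $n\ge0$, $$I_n\big(\mathrm{MC}(\mathfrak g\otimes C_n)\big)\subseteq\gamma_n(\mathfrak g).$$ That is, for every $y\in\mathrm{MC}(\mathfrak g\otimes C_n)$ the element $I_n(y)$ is a Maurer–Cartan element, i.e. lies in $\mathrm{MC}_n(\mathfrak g)$, and $h_n I_n(y)=0$. -/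

import Mathlib

open scoped TensorProduct BigOperators

noncomputable section

/-! ## Polynomial differential forms -/

section Forms

variable (k : Type*) [Field k]

/-- Polynomial differential forms in the variables `x_i`, `i : σ`: the free graded commutative
algebra `k[x_i] ⊗ Λ(dx_i)`. -/
abbrev PolyForms (σ : Type*) : Type _ := MvPolynomial σ k ⊗[k] ExteriorAlgebra k (σ → k)

namespace PolyForms

variable {σ τ : Type*}

/-- The forms of degree `p`. -/
def gr (σ : Type*) (p : ℕ) : Submodule k (PolyForms k σ) :=
  LinearMap.range (TensorProduct.map (LinearMap.id : MvPolynomial σ k →ₗ[k] MvPolynomial σ k)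
    (⋀[k]^p (σ → k)).subtype)

/-- The parity involution, which is `(-1)^p` on forms of degree `p`. -/
def parity (σ : Type*) : PolyForms k σ →ₗ[k] PolyForms k σ :=
  TensorProduct.map LinearMap.id
    (CliffordAlgebra.involute (Q := (0 : QuadraticForm k (σ → k)))).toLinearMap

/-- The sum of the components of even degree. -/
def evenPart (σ : Type*) : PolyForms k σ →ₗ[k] PolyForms k σ :=
  (2 : k)⁻¹ • (LinearMap.id + parity k σ)

/-- The sum of the components of odd degree. -/
def oddPart (σ : Type*) : PolyForms k σ →ₗ[k] PolyForms k σ :=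
  (2 : k)⁻¹ • (LinearMap.id - parity k σ)

/-- A polynomial, as a form of degree `0`. -/
def ofPoly (f : MvPolynomial σ k) : PolyForms k σ := f ⊗ₜ[k] 1

variable [Fintype σ] [DecidableEq σ] [Fintype τ]

/-- The de Rham differential `d(f η) = ∑ i, ∂f/∂x_i dx_i ∧ η`, for `η` a product of `dx_j`'s. -/
def d (σ : Type*) [Fintype σ] [DecidableEq σ] : PolyForms k σ →ₗ[k] PolyForms k σ :=
  ∑ i : σ, TensorProduct.map (MvPolynomial.pderiv (R := k) i).toLinearMap
    (LinearMap.mulLeft k (ExteriorAlgebra.ι k (Pi.single i (1 : k) : σ → k)))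

/-- The `1`-form `∑ i, a_i dx_i`. -/
def oneForm (a : σ → MvPolynomial σ k) : PolyForms k σ :=
  ∑ i : σ, a i ⊗ₜ[k] ExteriorAlgebra.ι k (Pi.single i (1 : k) : σ → k)

theorem oneForm_mul_self (a : σ → MvPolynomial σ k) : oneForm k a * oneForm k a = 0 := by
  classical
  have key : ∀ s : Finset σ,
      (∑ i ∈ s, a i ⊗ₜ[k] ExteriorAlgebra.ι k (Pi.single i (1 : k) : σ → k)) *
      (∑ i ∈ s, a i ⊗ₜ[k] ExteriorAlgebra.ι k (Pi.single i (1 : k) : σ → k)) =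
        (0 : PolyForms k σ) := by
    intro s
    induction s using Finset.induction_on with
    | empty => simp
    | insert i s hi ih =>
      rw [Finset.sum_insert hi, add_mul, mul_add, mul_add, ih,
        Algebra.TensorProduct.tmul_mul_tmul, ExteriorAlgebra.ι_sq_zero, TensorProduct.tmul_zero,
        zero_add, add_zero, Finset.mul_sum, Finset.sum_mul, ← Finset.sum_add_distrib]
      refine Finset.sum_eq_zero fun j _ => ?_
      rw [Algebra.TensorProduct.tmul_mul_tmul, Algebra.TensorProduct.tmul_mul_tmul,
        mul_comm (a j) (a i), ← TensorProduct.tmul_add, ExteriorAlgebra.ι_add_mul_swap,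
        TensorProduct.tmul_zero]
  exact key Finset.univ

/-- The linear map which sends `dy_j` to `d(f_j)`. -/
def pullbackOne (f : τ → MvPolynomial σ k) : (τ → k) →ₗ[k] PolyForms k σ :=
  ∑ j : τ, (LinearMap.proj j : (τ → k) →ₗ[k] k).smulRight
    (oneForm k fun i => MvPolynomial.pderiv i (f j))

theorem pullbackOne_mul_self (f : τ → MvPolynomial σ k) (v : τ → k) :
    pullbackOne k f v * pullbackOne k f v = 0 := by
  have h : pullbackOne k f v = oneForm k fun i => ∑ j, v j • MvPolynomial.pderiv i (f j) := by
    simp only [pullbackOne, oneForm, LinearMap.sum_apply, LinearMap.smulRight_apply,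
      LinearMap.proj_apply, Finset.smul_sum, TensorProduct.sum_tmul, TensorProduct.smul_tmul']
    exact Finset.sum_comm
  rw [h, oneForm_mul_self]

/-- The pullback of forms along a polynomial map: the algebra homomorphism with `y_j ↦ f_j` and
`dy_j ↦ d(f_j)`. -/
def pullback (f : τ → MvPolynomial σ k) : PolyForms k τ →ₐ[k] PolyForms k σ :=
  Algebra.TensorProduct.lift
    ((Algebra.TensorProduct.includeLeft (R := k) (S := k) (A := MvPolynomial σ k)
      (B := ExteriorAlgebra k (σ → k))).comp (MvPolynomial.aeval f))
    (ExteriorAlgebra.lift k ⟨pullbackOne k f, pullbackOne_mul_self k f⟩)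
    (fun p q => by
      have h : ∀ (r : MvPolynomial σ k) (z : PolyForms k σ), Commute (r ⊗ₜ[k] 1) z := by
        intro r z
        induction z using TensorProduct.induction_on with
        | zero => exact Commute.zero_right _
        | tmul a b => simp [Commute, SemiconjBy, mul_comm]
        | add a b ha hb => exact ha.add_right hb
      exact h _ _)

/-- Integration over the fibre `[0,1]`, whose coordinate `u` is the variable `none`: it sends
`u^a f(x) du ∧ η` to `(a+1)⁻¹ f(x) η` and `u^a f(x) η` to `0`, for `η` a product of `dx_j`'s. -/
def fibreIntegral (σ : Type*) : PolyForms k (Option σ) →ₗ[k] PolyForms k σ :=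
  TensorProduct.map
    ((MvPolynomial.basisMonomials (Option σ) k).constr k fun a =>
      MvPolynomial.monomial a.some (((a none : ℕ) + 1 : k)⁻¹))
    ((ExteriorAlgebra.map (LinearMap.funLeft k k (Option.some : σ → Option σ))).toLinearMap ∘ₗ
      CliffordAlgebra.contractLeft (Q := (0 : QuadraticForm k (Option σ → k)))
        (LinearMap.proj none))

end PolyForms

end Forms

/-! ## Forms on the simplex and Dupont's contraction -/

section Dupont

variable (k : Type*) [Field k]

/-- The Sullivan algebra `Ω_n = k[t_0,…,t_n,dt_0,…,dt_n]/(∑ t_i = 1, ∑ dt_i = 0)`, where `t_0` and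
`dt_0` have been eliminated: the variable with index `j : Fin n` is `t_{j+1}`. -/
abbrev Sullivan (n : ℕ) : Type _ := PolyForms k (Fin n)

namespace Sullivan

/-- The barycentric coordinates `t_0 = 1 - ∑ t_j, t_1, …, t_n`. -/
def t (n : ℕ) : Fin (n + 1) → MvPolynomial (Fin n) k :=
  Fin.cons (1 - ∑ j : Fin n, MvPolynomial.X j) fun j => MvPolynomial.X j

/-- The forms `dt_0, …, dt_n`. -/
def dt (n : ℕ) (i : Fin (n + 1)) : Sullivan k n :=
  PolyForms.d k (Fin n) (PolyForms.ofPoly k (t k n i))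

/-- The simplicial structure: the pullback along the affine map `Δ^m → Δ^n` given on vertices
by `v`, so that `t_j ↦ ∑_{v l = j} t_l`. -/
def restrict {m n : ℕ} (v : Fin (m + 1) → Fin (n + 1)) : Sullivan k n →ₐ[k] Sullivan k m :=
  PolyForms.pullback k fun j : Fin n => ∑ l : Fin (m + 1), if v l = j.succ then t k m l else 0

/-- Formal integration over `Δ^n`:
`∫ t_1^{a_1} ⋯ t_n^{a_n} dt_1 ⋯ dt_n = a_1! ⋯ a_n! / (a_1 + ⋯ + a_n + n)!`,
and forms of degree `≠ n` have integral `0`. -/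
def integral (n : ℕ) : Sullivan k n →ₗ[k] k :=
  LinearMap.mul' k k ∘ₗ TensorProduct.map
    ((MvPolynomial.basisMonomials (Fin n) k).constr k fun a =>
      (∏ i, ((a i).factorial : k)) / (((∑ i, a i) + n).factorial : k))
    (ExteriorAlgebra.liftAlternating (R := k) (M := Fin n → k) (N := k)
      (Pi.single n (Matrix.detRowAlternating (R := k) (n := Fin n))))

/-- The basic form `ω_I = m! ∑_j (-1)^j t_{i_j} dt_{i_0} ⋯ (omit dt_{i_j}) ⋯ dt_{i_m}` for
`I = {i_0 < ⋯ < i_m}`, given by its increasing enumeration. -/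
def basicForm {m n : ℕ} (I : Fin (m + 1) ↪o Fin (n + 1)) : Sullivan k n :=
  (m.factorial : k) • ∑ j : Fin (m + 1), ((-1 : k) ^ (j : ℕ)) •
    (PolyForms.ofPoly k (t k n (I j)) *
      (List.ofFn fun l : Fin m => dt k n (I (j.succAbove l))).prod)

/-- The subcomplex `C_n` of `Ω_n` spanned by the basic forms. -/
def cellular (n : ℕ) : Submodule k (Sullivan k n) :=
  Submodule.span k {ω | ∃ (m : ℕ) (I : Fin (m + 1) ↪o Fin (n + 1)), ω = basicForm k I}

/-- The inclusion `i_n : C_n → Ω_n`. -/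
def incl (n : ℕ) : cellular k n →ₗ[k] Sullivan k n := (cellular k n).subtype

/-- The projection `p_n : Ω_n → C_n`, `p_n(ω) = ∑_I (∫_{Δ^I} ω) ω_I`. -/
def proj (n : ℕ) : Sullivan k n →ₗ[k] cellular k n :=
  ∑ m ∈ Finset.range (n + 1), ∑ I : Fin (m + 1) ↪o Fin (n + 1),
    (integral k m ∘ₗ (restrict k I).toLinearMap).smulRight
      (⟨basicForm k I, Submodule.subset_span ⟨m, I, rfl⟩⟩ : cellular k n)

/-- The homotopy `h^i = ∫_{u ∈ [0,1]} ∘ φ_i^*` attached to the `i`-th vertex, where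
`φ_i : [0,1] × Δ^n → Δ^n`, `φ_i(u,t) = u t + (1 - u) e_i`. -/
def vertexHomotopy (n : ℕ) (i : Fin (n + 1)) : Sullivan k n →ₗ[k] Sullivan k n :=
  PolyForms.fibreIntegral k (Fin n) ∘ₗ
    (PolyForms.pullback k fun j : Fin n =>
      (MvPolynomial.X none * MvPolynomial.X (some j) +
        if j.succ = i then 1 - MvPolynomial.X none else 0 :
          MvPolynomial (Option (Fin n)) k)).toLinearMap

/-- Dupont's homotopy `h_n = ∑_{i_0 < ⋯ < i_m, m < n} (-1)^m ω_{i_0 ⋯ i_m} h^{i_m} ∘ ⋯ ∘ h^{i_0}`.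
The signs are those for which `1 - i_n p_n = d h_n + h_n d`. -/
def homotopy (n : ℕ) : Sullivan k n →ₗ[k] Sullivan k n :=
  ∑ m ∈ Finset.range n, ∑ I : Fin (m + 1) ↪o Fin (n + 1), ((-1 : k) ^ m) •
    (LinearMap.mulLeft k (basicForm k I) ∘ₗ
      (List.ofFn I).foldl (fun T i => vertexHomotopy k n i ∘ₗ T) LinearMap.id)

end Sullivan

end Dupont

/-! ## Homotopy transfer for `L_∞`-algebras -/

namespace Transfer

/-- The block `f⁻¹(j)` of an ordered partition `f` of `S`. -/
def block {ι : Type*} {S : Finset ι} {r : ℕ} (f : S → Fin r) (j : Fin r) : Finset ι :=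
  (Finset.univ.filter fun s => f s = j).map (Function.Embedding.subtype _)

theorem block_ssubset {ι : Type*} {S : Finset ι} {r : ℕ} (f : S → Fin (r + 2))
    (hf : Function.Surjective f) (j : Fin (r + 2)) : block f j ⊂ S := by
  obtain ⟨j', hj'⟩ := exists_ne j
  obtain ⟨s, hs⟩ := hf j'
  rw [Finset.ssubset_iff_of_subset]
  · refine ⟨s, s.2, fun h => hj' ?_⟩
    simp only [block, Finset.mem_map, Finset.mem_filter, Finset.mem_univ, true_and,
      Function.Embedding.subtype_apply] at h
    obtain ⟨a, ha, has⟩ := h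
    rw [← hs, ← ha, Subtype.ext has]
  · intro x hx
    simp only [block, Finset.mem_map, Function.Embedding.subtype_apply] at hx
    obtain ⟨a, -, rfl⟩ := hx
    exact a.2

/-- The Koszul sign, for the shifted degrees `d - 1`, of the reordering of the elements of `S` into
the blocks `f⁻¹(0), f⁻¹(1), …`, each of them in increasing order. -/
def koszulSign {ι : Type*} [LinearOrder ι] {S : Finset ι} {r : ℕ} (d : ι → ℤ) (f : S → Fin r) : ℤ :=
  ∏ a : S, ∏ b : S, if a < b ∧ f b < f a then (((d a - 1) * (d b - 1)).negOnePow : ℤ) else 1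

/-- The sign `(-1)^{∑_j (r - j) (e_j - 1)}` that turns the antisymmetric bracket `ℓ_r`, on elements
of degrees `e_1, …, e_r`, into the symmetric bracket of degree `1` on the desuspension. -/
def shiftSign {r : ℕ} (e : Fin r → ℤ) : ℤ :=
  ((∑ j : Fin r, ((r : ℤ) - 1 - j) * (e j - 1)).negOnePow : ℤ)

/-- The degree of an operation of shifted degree `0` evaluated on inputs of degrees `d s`,
`s ∈ T`. -/
def outDeg {ι : Type*} (d : ι → ℤ) (T : Finset ι) : ℤ := 1 + ∑ s ∈ T, (d s - 1)

variable {k V W ι : Type*} [Field k] [AddCommGroup V] [Module k V] [AddCommGroup W] [Module k W]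
  [LinearOrder ι]

open Classical in
/-- `∑_{r ≥ 2} ∑_{S = B_1 ⊔ ⋯ ⊔ B_r} ± ℓ_r(Φ(B_1), …, Φ(B_r))`, the sum being over the partitions of
`S` into `r` non-empty blocks; it is written as `1/r!` times the sum over ordered partitions. -/
def vertexSum (ℓ : ∀ r : ℕ, MultilinearMap k (fun _ : Fin r => V) V) (d : ι → ℤ) (S : Finset ι)
    (Φ : ∀ T : Finset ι, T ⊂ S → V) : V :=
  ∑ r ∈ Finset.range (S.card - 1), (((r + 2).factorial : k)⁻¹) •
    ∑ f : {f : S → Fin (r + 2) // Function.Surjective f},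
      (koszulSign d f.1 * shiftSign fun j => outDeg d (block f.1 j)) •
        ℓ (r + 2) fun j => Φ (block f.1 j) (block_ssubset f.1 f.2 j)

/-- The sum over all rooted trees whose leaves are labelled by `S`, with `i` at the leaves, the
brackets at the vertices, and the homotopy `-h` at the inner edges and at the root. These are the
components of the `∞`-morphism `i_∞` extending `i`, evaluated at `y s` of degree `d s`, `s ∈ S`.
Here `1 - i p = dh + hd`, which accounts for the sign of `h`. -/
def inclTrees (ℓ : ∀ r : ℕ, MultilinearMap k (fun _ : Fin r => V) V) (i : W →ₗ[k] V) (h : V →ₗ[k] V)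
    (d : ι → ℤ) (y : ι → W) (S : Finset ι) : V :=
  Finset.strongInduction (p := fun _ => V)
    (fun S Φ => if S.card = 1 then i (∑ s ∈ S, y s) else -h (vertexSum ℓ d S Φ)) S

/-- The component `i_m` of the `∞`-morphism `i_∞`, on elements `y_j` of degree `d_j`, in its
symmetric form (on the desuspensions). -/
def inclComponent (ℓ : ∀ r : ℕ, MultilinearMap k (fun _ : Fin r => V) V) (i : W →ₗ[k] V)
    (h : V →ₗ[k] V) (m : ℕ) (d : Fin m → ℤ) (y : Fin m → W) : V :=
  inclTrees ℓ i h d y Finset.univ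

/-- The transferred bracket `ℓ_m` on `W`, on elements `y_j` of degree `d_j`, in its symmetric form
(on the desuspension). For `m = 1` it is the differential of `W`; for `m ≥ 2` it is the sum over
rooted trees with `i` at the leaves, the brackets at the vertices, `-h` at the inner edges and `p`
at the root. -/
def bracket (dV : V →ₗ[k] V) (ℓ : ∀ r : ℕ, MultilinearMap k (fun _ : Fin r => V) V)
    (i : W →ₗ[k] V) (p : V →ₗ[k] W) (h : V →ₗ[k] V) (m : ℕ) (d : Fin m → ℤ) (y : Fin m → W) : W :=
  if m = 1 then p (dV (i (∑ j, y j)))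
  else p (vertexSum ℓ d Finset.univ fun T _ => inclTrees ℓ i h d y T)

end Transfer

/-! ## `L_∞`-algebras -/

/-- An `L_∞`-algebra structure on `g` (cohomological grading): a `ℤ`-grading and graded
antisymmetric brackets `ℓ_n` of degree `2 - n` for `n ≥ 1`, where `ℓ_1` is the differential, subject
to the generalised Jacobi rules
`∑_S (-1)^|S| ε(S) ℓ_{n-|S|+1}(ℓ_{|S|}(x_S), x_{Sᶜ}) = 0`,
where `ε(S)` is the sign of the unshuffle times its Koszul sign. In these sign conventions the
Maurer-Cartan equation reads `∑_n ℓ_n(x,…,x) / n! = 0`. -/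
structure LInftyAlgebra (k g : Type*) [Field k] [AddCommGroup g] [Module k g] where
  deg : ℤ → Submodule k g
  isInternal : DirectSum.IsInternal deg
  bracket : ∀ n : ℕ, MultilinearMap k (fun _ : Fin n => g) g
  bracket_zero : bracket 0 = 0
  bracket_mem : ∀ (n : ℕ) (d : Fin n → ℤ) (x : Fin n → g), (∀ i, x i ∈ deg (d i)) →
    bracket n x ∈ deg (∑ i, d i + 2 - n)
  bracket_swap : ∀ (n : ℕ) (d : Fin n → ℤ) (x : Fin n → g), (∀ i, x i ∈ deg (d i)) →
    ∀ i j : Fin n, (j : ℕ) = i + 1 →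
      bracket n (x ∘ Equiv.swap i j) = -(((d i * d j).negOnePow : ℤ) • bracket n x)
  jacobi : ∀ (n : ℕ) (d : Fin n → ℤ) (x : Fin n → g), (∀ i, x i ∈ deg (d i)) →
    ∑ S : Finset (Fin n) with S.Nonempty,
      ((-1 : ℤ) ^ S.card *
        ∏ a ∈ S, ∏ b ∈ Sᶜ with b < a, ((1 + d a * d b).negOnePow : ℤ)) •
      bracket (Sᶜ.card + 1)
        (Fin.cons (bracket S.card fun a => x (S.orderEmbOfFin rfl a))
          fun b => x (Sᶜ.orderEmbOfFin rfl b)) = 0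

namespace LInftyAlgebra

section Basic

variable {k g : Type*} [Field k] [AddCommGroup g] [Module k g] (L : LInftyAlgebra k g)

/-- The grading, as an isomorphism `⨁ i, g^i ≃ g`. -/
def gradingEquiv : (DirectSum ℤ fun i => L.deg i) ≃ₗ[k] g :=
  LinearEquiv.ofBijective (DirectSum.coeLinearMap L.deg)
    (show Function.Bijective (DirectSum.coeLinearMap L.deg) from L.isInternal)

/-- The parity involution, which is `(-1)^i` on elements of degree `i`. -/
def parity : g →ₗ[k] g :=
  DirectSum.toModule k ℤ g (fun i => (i.negOnePow : ℤ) • (L.deg i).subtype) ∘ₗ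
    L.gradingEquiv.symm.toLinearMap

theorem parity_apply {i : ℤ} {x : g} (hx : x ∈ L.deg i) :
    L.parity x = (i.negOnePow : ℤ) • x := by
  have h : L.gradingEquiv.symm x = DirectSum.lof k ℤ (fun i => L.deg i) i ⟨x, hx⟩ := by
    rw [LinearEquiv.symm_apply_eq]
    exact (DirectSum.coeLinearMap_lof L.deg i ⟨x, hx⟩).symm
  simp [parity, h]

/-- `x` is an iterated bracketing of `m` homogeneous elements. -/
inductive IsBracketing : ℕ → g → Prop
  | leaf (i : ℤ) (x : g) (hx : x ∈ L.deg i) : IsBracketing 1 x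
  | node (j : ℕ) (m : Fin j → ℕ) (w : Fin j → g) (hj : 1 ≤ j)
      (hw : ∀ a, IsBracketing (m a) (w a)) : IsBracketing (∑ a, m a) (L.bracket j w)

/-- The canonical filtration: `F_c g` is spanned by the bracketings of at least `c` elements. -/
def F (c : ℕ) : Submodule k g :=
  Submodule.span k {x | ∃ m, c ≤ m ∧ L.IsBracketing m x}

theorem F_antitone {b c : ℕ} (h : b ≤ c) : L.F c ≤ L.F b :=
  Submodule.span_mono (by rintro x ⟨m, hm, hx⟩; exact ⟨m, h.trans hm, hx⟩)

theorem IsBracketing.homogeneous {m : ℕ} {x : g} (h : L.IsBracketing m x) :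
    ∃ i, x ∈ L.deg i := by
  induction h with
  | leaf i x hx => exact ⟨i, hx⟩
  | node j m w hj hw ih =>
    choose d hd using ih
    exact ⟨_, L.bracket_mem j d w hd⟩

theorem parity_mem_F {c : ℕ} {x : g} (hx : x ∈ L.F c) : L.parity x ∈ L.F c := by
  induction hx using Submodule.span_induction with
  | mem x h =>
    obtain ⟨m, hm, hw⟩ := h
    obtain ⟨i, hi⟩ := IsBracketing.homogeneous L hw
    have hx : x ∈ L.F c := Submodule.subset_span ⟨m, hm, hw⟩
    rw [L.parity_apply hi]
    exact zsmul_mem hx _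
  | zero => simp
  | add x y _ _ hx hy => rw [map_add]; exact add_mem hx hy
  | smul a x _ hx => rw [map_smul]; exact Submodule.smul_mem _ _ hx

/-- `g` is complete: the canonical map `g → lim_c g / F_c g` of graded vector spaces is an
isomorphism (injective, and surjective in every degree). -/
def IsComplete : Prop :=
  (∀ x : g, (∀ c, x ∈ L.F c) → x = 0) ∧
  ∀ (i : ℤ) (s : ℕ → g), (∀ c, s c ∈ L.deg i) → (∀ c, s (c + 1) - s c ∈ L.F c) →
    ∃ x ∈ L.deg i, ∀ c, x - s c ∈ L.F c

end Basic

/-! ### The tensor product with the Sullivan algebra -/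

section Tensor

variable {k g : Type*} [Field k] [AddCommGroup g] [Module k g]
  (L : LInftyAlgebra k g) (n : ℕ)

/-- Left multiplication by a form on the second factor of `g ⊗ Ω_n`. -/
def leftMul : Sullivan k n →ₗ[k] (g ⊗[k] Sullivan k n →ₗ[k] g ⊗[k] Sullivan k n) :=
  LinearMap.lTensorHom g ∘ₗ LinearMap.mul k (Sullivan k n)

/-- Composition of all arguments of a multilinear map with the parity involution. -/
def twist (r : ℕ) : MultilinearMap k (fun _ : Fin r => g) g →ₗ[k]
    MultilinearMap k (fun _ : Fin r => g) g :=
  MultilinearMap.compLinearMapₗ fun _ => L.parity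

/-- `(N, a) ↦ a · E(N)` for `a` of even degree, `(N, a) ↦ a · E(twist N)` for `a` of odd degree. -/
def extendStep (r : ℕ) (E : MultilinearMap k (fun _ : Fin r => g) g →ₗ[k]
      MultilinearMap k (fun _ : Fin r => g ⊗[k] Sullivan k n) (g ⊗[k] Sullivan k n)) :
    MultilinearMap k (fun _ : Fin r => g) g →ₗ[k] Sullivan k n →ₗ[k]
      MultilinearMap k (fun _ : Fin r => g ⊗[k] Sullivan k n) (g ⊗[k] Sullivan k n) :=
  LinearMap.mk₂ k
    (fun N a =>
      (leftMul n (PolyForms.evenPart k (Fin n) a)).compMultilinearMap (E N) +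
      (leftMul n (PolyForms.oddPart k (Fin n) a)).compMultilinearMap (E (L.twist r N)))
    (fun M N a => by
      ext z
      simp only [map_add, add_apply, LinearMap.compMultilinearMap_apply]
      abel)
    (fun c N a => by
      ext z
      simp only [map_smul, add_apply, smul_apply,
        LinearMap.compMultilinearMap_apply, smul_add])
    (fun N a b => by
      ext z
      simp only [map_add, add_apply, LinearMap.add_apply, LinearMap.compMultilinearMap_apply]
      abel)
    (fun c N a => by
      ext z
      simp only [map_smul, LinearMap.smul_apply, add_apply, smul_apply,
        LinearMap.compMultilinearMap_apply, smul_add])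

/-- The extension of a multilinear map `M` on `g` to `g ⊗ Ω_n` with Koszul signs:
`(x_1 ⊗ a_1, …, x_r ⊗ a_r) ↦ ∏_{i<j} (-1)^{|a_i||x_j|} M(x_1,…,x_r) ⊗ a_1 ⋯ a_r`.
The recursion moves `a_1` past `x_2, …, x_r`. -/
def extend : ∀ r : ℕ, MultilinearMap k (fun _ : Fin r => g) g →ₗ[k]
    MultilinearMap k (fun _ : Fin r => g ⊗[k] Sullivan k n) (g ⊗[k] Sullivan k n)
  | 0 =>
    { toFun := fun M => MultilinearMap.constOfIsEmpty k _ (M Fin.elim0 ⊗ₜ[k] 1)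
      map_add' := fun M N => by ext; simp [TensorProduct.add_tmul]
      map_smul' := fun c M => by ext; simp [TensorProduct.smul_tmul'] }
  | r + 1 =>
    (multilinearCurryLeftEquiv k (fun _ : Fin (r + 1) => g ⊗[k] Sullivan k n)
        (g ⊗[k] Sullivan k n)).symm.toLinearMap ∘ₗ
      (TensorProduct.lift.equiv (RingHom.id k) g (Sullivan k n)
        (MultilinearMap k (fun _ : Fin r => g ⊗[k] Sullivan k n)
          (g ⊗[k] Sullivan k n))).toLinearMap ∘ₗ
      LinearMap.compRight k (L.extendStep n r (extend r)) ∘ₗ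
      (multilinearCurryLeftEquiv k (fun _ : Fin (r + 1) => g) g).toLinearMap

/-- The value of `extend` on a family whose first entry is a pure tensor with form of parity
`e`. -/
theorem extend_succ_tmul (r : ℕ) (M : MultilinearMap k (fun _ : Fin (r + 1) => g) g)
    (x : g) (a : Sullivan k n) (z : Fin r → g ⊗[k] Sullivan k n) :
    L.extend n (r + 1) M (Fin.cons (x ⊗ₜ a) z) =
      leftMul n (PolyForms.evenPart k (Fin n) a) (L.extend n r (M.curryLeft x) z) +
      leftMul n (PolyForms.oddPart k (Fin n) a)
        (L.extend n r (L.twist r (M.curryLeft x)) z) := by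
  simp only [extend]
  rfl

/-- The brackets `ℓ_r`, `r ≥ 2`, of the `L_∞`-algebra `g ⊗ Ω_n`. -/
def formBracket (r : ℕ) :
    MultilinearMap k (fun _ : Fin r => g ⊗[k] Sullivan k n) (g ⊗[k] Sullivan k n) :=
  L.extend n r (L.bracket r)

/-- The differential of `g ⊗ Ω_n`: `d(x ⊗ a) = dx ⊗ a + (-1)^|x| x ⊗ da`. -/
def formD : g ⊗[k] Sullivan k n →ₗ[k] g ⊗[k] Sullivan k n :=
  TensorProduct.map
      ((MultilinearMap.ofSubsingleton k g g (0 : Fin 1)).symm (L.bracket 1)) LinearMap.id +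
    TensorProduct.map L.parity (PolyForms.d k (Fin n))

end Tensor

/-! ### Maurer-Cartan elements -/

section MaurerCartan

variable {k g : Type*} [Field k] [AddCommGroup g] [Module k g]
  (L : LInftyAlgebra k g) (n : ℕ)

/-- `1 ⊗ i_n : g ⊗ C_n → g ⊗ Ω_n`. -/
def tensorIncl : g ⊗[k] Sullivan.cellular k n →ₗ[k] g ⊗[k] Sullivan k n :=
  LinearMap.lTensor g (Sullivan.incl k n)

/-- `1 ⊗ p_n : g ⊗ Ω_n → g ⊗ C_n`. -/
def tensorProj : g ⊗[k] Sullivan k n →ₗ[k] g ⊗[k] Sullivan.cellular k n :=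
  LinearMap.lTensor g (Sullivan.proj k n)

/-- `1 ⊗ h_n : x ⊗ a ↦ (-1)^|x| x ⊗ h_n(a)` on `g ⊗ Ω_n`. -/
def tensorHomotopy : g ⊗[k] Sullivan k n →ₗ[k] g ⊗[k] Sullivan k n :=
  TensorProduct.map L.parity (Sullivan.homotopy k n)

/-- The degree `1` part of `g ⊗ Ω_n`. -/
def formDegOne : Submodule k (g ⊗[k] Sullivan k n) :=
  Submodule.span k {z | ∃ (i : ℤ) (p : ℕ) (x : g) (a : Sullivan k n),
    i + p = 1 ∧ x ∈ L.deg i ∧ a ∈ PolyForms.gr k (Fin n) p ∧ z = x ⊗ₜ a}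

/-- The degree `1` part of `g ⊗ C_n`. -/
def cellDegOne : Submodule k (g ⊗[k] Sullivan.cellular k n) :=
  Submodule.span k {z | ∃ (i : ℤ) (p : ℕ) (x : g) (a : Sullivan.cellular k n),
    i + p = 1 ∧ x ∈ L.deg i ∧ (a : Sullivan k n) ∈ PolyForms.gr k (Fin n) p ∧ z = x ⊗ₜ a}

/-- The filtration `F_c(g ⊗ Ω_n) = F_c g ⊗ Ω_n`. -/
def formF (c : ℕ) : Submodule k (g ⊗[k] Sullivan k n) :=
  LinearMap.range (LinearMap.rTensor (Sullivan k n) (L.F c).subtype)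

/-- The filtration `F_c(g ⊗ C_n) = F_c g ⊗ C_n`. -/
def cellF (c : ℕ) : Submodule k (g ⊗[k] Sullivan.cellular k n) :=
  LinearMap.range (LinearMap.rTensor (Sullivan.cellular k n) (L.F c).subtype)

/-- `(g ⊗ Ω_n)^(c) = (g ⊗ Ω_n) / F_c(g ⊗ Ω_n) = (g / F_c g) ⊗ Ω_n`. -/
abbrev FormQuot (c : ℕ) : Type _ := (g ⊗[k] Sullivan k n) ⧸ L.formF n c

theorem formF_antitone {b c : ℕ} (h : b ≤ c) : L.formF n c ≤ L.formF n b := by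
  rintro _ ⟨z, rfl⟩
  refine ⟨LinearMap.rTensor _ (Submodule.inclusion (L.F_antitone h)) z, ?_⟩
  rw [← LinearMap.comp_apply, ← LinearMap.rTensor_comp]
  rfl

theorem tensorHomotopy_mem_formF (c : ℕ) :
    L.formF n c ≤ (L.formF n c).comap (L.tensorHomotopy n) := by
  rintro _ ⟨z, rfl⟩
  induction z using TensorProduct.induction_on with
  | zero => simp
  | tmul x a =>
    exact ⟨⟨L.parity x, L.parity_mem_F x.2⟩ ⊗ₜ Sullivan.homotopy k n a, by simp [tensorHomotopy]⟩
  | add u v hu hv => rw [map_add]; exact add_mem hu hv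

/-- The map induced by `1 ⊗ h_n` on `(g ⊗ Ω_n)^(c)`. -/
def quotHomotopy (c : ℕ) : L.FormQuot n c →ₗ[k] L.FormQuot n c :=
  (L.formF n c).mapQ (L.formF n c) (L.tensorHomotopy n) (L.tensorHomotopy_mem_formF n c)

/-- The completed tensor product `lim_c (g / F_c g) ⊗ Ω_n`. -/
def completedForms : Submodule k (∀ c, L.FormQuot n c) where
  carrier := {α | ∀ b c (h : b ≤ c), Submodule.factor (L.formF_antitone n h) (α c) = α b}
  add_mem' := fun hα hβ b c h => by simp [hα b c h, hβ b c h]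
  zero_mem' := fun b c h => by simp
  smul_mem' := fun r α hα b c h => by simp [hα b c h]

/-- The partial sum `da + ∑_{r=2}^N ℓ_r(a,…,a) / r!` of the left-hand side of the Maurer-Cartan
equation in `g ⊗ Ω_n`. -/
def formCurvature (N : ℕ) (a : g ⊗[k] Sullivan k n) : g ⊗[k] Sullivan k n :=
  L.formD n a + ∑ r ∈ Finset.Icc 2 N, ((r.factorial : k)⁻¹) • L.formBracket n r fun _ => a

/-- The Maurer-Cartan elements of the nilpotent `L_∞`-algebra `(g / F_c g) ⊗ Ω_n`: the classes of
the `a` of degree `1` with `da + ∑_{r ≥ 2} ℓ_r(a,…,a) / r!` zero modulo `F_c g ⊗ Ω_n`. The sum is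
finite modulo `F_c g ⊗ Ω_n`. -/
def quotMC (c : ℕ) : Set (L.FormQuot n c) :=
  {q | ∃ a ∈ L.formDegOne n, Submodule.Quotient.mk a = q ∧
    ∃ N₀, ∀ N ≥ N₀, L.formCurvature n N a ∈ L.formF n c}

/-- The `n`-simplices `MC_n(g) = lim_c MC((g / F_c g) ⊗ Ω_n)` of the Deligne-Hinich-Getzler
`∞`-groupoid. -/
def MCForms : Set (∀ c, L.FormQuot n c) :=
  {α | α ∈ L.completedForms n ∧ ∀ c, α c ∈ L.quotMC n c}

/-- The `n`-simplices `γ_n(g) = {α ∈ MC_n(g) | h_n α = 0}` of Getzler's Kan complex. -/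
def gamma : Set (∀ c, L.FormQuot n c) :=
  {α | α ∈ L.MCForms n ∧ ∀ c, L.quotHomotopy n c (α c) = 0}

/-- The `L_∞`-algebra structure on `g ⊗ C_n` transferred along
`(1 ⊗ i_n, 1 ⊗ p_n, 1 ⊗ h_n)`. -/
def cellBracket (m : ℕ) (d : Fin m → ℤ) (y : Fin m → g ⊗[k] Sullivan.cellular k n) :
    g ⊗[k] Sullivan.cellular k n :=
  Transfer.bracket (L.formD n) (L.formBracket n) (tensorIncl n) (tensorProj n)
    (L.tensorHomotopy n) m d y

/-- The components of the `∞`-morphism `(1 ⊗ i_n)_∞ : g ⊗ C_n ⇝ g ⊗ Ω_n`. -/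
def inclInfty (m : ℕ) (d : Fin m → ℤ) (y : Fin m → g ⊗[k] Sullivan.cellular k n) :
    g ⊗[k] Sullivan k n :=
  Transfer.inclComponent (L.formBracket n) (tensorIncl n) (L.tensorHomotopy n) m d y

/-- The Maurer-Cartan elements of `g ⊗ C_n`: the `y` of degree `1` such that the series
`∑_{m ≥ 1} ℓ_m(y,…,y) / m!` converges to `0` for the filtration `F_c g ⊗ C_n`. -/
def MCCells : Set (g ⊗[k] Sullivan.cellular k n) :=
  {y | y ∈ L.cellDegOne n ∧ ∀ c, ∃ N₀, ∀ N ≥ N₀,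
    ∑ m ∈ Finset.Icc 1 N, ((m.factorial : k)⁻¹) • L.cellBracket n m (fun _ => 1) (fun _ => y) ∈
      L.cellF n c}

/-- The map `I_n(y) = ∑_{m ≥ 1} i_m(y,…,y) / m!` induced by `(1 ⊗ i_n)_∞` on Maurer-Cartan
elements, with values in `lim_c (g / F_c g) ⊗ Ω_n`. As `i_m` takes values in `F_m g ⊗ Ω_n`, its
component of index `c` only involves the terms with `m < c`. -/
def MCIncl (y : g ⊗[k] Sullivan.cellular k n) : ∀ c, L.FormQuot n c := fun c =>
  Submodule.Quotient.mk (∑ m ∈ Finset.Ico 1 c,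
    ((m.factorial : k)⁻¹) • L.inclInfty n m (fun _ => 1) fun _ => y)

end MaurerCartan

end LInftyAlgebra

end

noncomputable section

set_option linter.unusedSectionVars false

namespace PolyForms

variable {k : Type*} [Field k] {σ τ : Type*}

/-! ### Generators -/

/-- `ofPoly` is the inclusion of the polynomials as an algebra homomorphism. -/
theorem ofPoly_eq (f : MvPolynomial σ k) :
    ofPoly k f = (Algebra.TensorProduct.includeLeft :
      MvPolynomial σ k →ₐ[k] PolyForms k σ) f := rfl

theorem ofPoly_one : ofPoly k (1 : MvPolynomial σ k) = 1 := rfl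

theorem ofPoly_mul (f g : MvPolynomial σ k) : ofPoly k (f * g) = ofPoly k f * ofPoly k g := by
  simp [ofPoly_eq]

theorem mul_neg' (a b : PolyForms k σ) : a * -b = -(a * b) := mul_neg a b

theorem neg_mul' (a b : PolyForms k σ) : -a * b = -(a * b) := neg_mul a b

theorem ofPoly_add (f g : MvPolynomial σ k) : ofPoly k (f + g) = ofPoly k f + ofPoly k g :=
  TensorProduct.add_tmul _ _ _

theorem ofPoly_sub (f g : MvPolynomial σ k) : ofPoly k (f - g) = ofPoly k f - ofPoly k g :=
  TensorProduct.sub_tmul _ _ _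

theorem ofPoly_zero : ofPoly k (0 : MvPolynomial σ k) = 0 := by
  simp [ofPoly_eq]

theorem ofPoly_sum {α : Type*} (s : Finset α) (f : α → MvPolynomial σ k) :
    ofPoly k (∑ i ∈ s, f i) = ∑ i ∈ s, ofPoly k (f i) := by
  simp [ofPoly_eq]

theorem ofPoly_smul (c : k) (f : MvPolynomial σ k) : ofPoly k (c • f) = c • ofPoly k f := by
  simp [ofPoly_eq]

theorem ofPoly_C (c : k) : ofPoly k (MvPolynomial.C c : MvPolynomial σ k) = c • 1 := by
  rw [← ofPoly_one, ← ofPoly_smul, MvPolynomial.smul_eq_C_mul, mul_one]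

theorem ofPoly_mul_comm (f : MvPolynomial σ k) (z : PolyForms k σ) :
    ofPoly k f * z = z * ofPoly k f := by
  induction z using TensorProduct.induction_on with
  | zero => simp
  | tmul a b => simp [ofPoly, mul_comm]
  | add a b ha hb => rw [mul_add, add_mul, ha, hb]

theorem ofPoly_mul_tmul (f g : MvPolynomial σ k) (l : ExteriorAlgebra k (σ → k)) :
    ofPoly k f * (g ⊗ₜ[k] l : PolyForms k σ) = (f * g) ⊗ₜ l := by
  simp [ofPoly]

variable [DecidableEq σ]

variable (k) in
/-- The form `dx_i`. -/
def dX (i : σ) : PolyForms k σ :=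
  1 ⊗ₜ[k] ExteriorAlgebra.ι k (Pi.single i (1 : k) : σ → k)

theorem dX_mul_tmul (i : σ) (g : MvPolynomial σ k) (l : ExteriorAlgebra k (σ → k)) :
    dX k i * (g ⊗ₜ[k] l : PolyForms k σ) =
      g ⊗ₜ (ExteriorAlgebra.ι k (Pi.single i (1 : k) : σ → k) * l) := by
  simp [dX]

theorem dX_mul_dX (i j : σ) : dX k i * dX k j = -(dX k j * dX k i) := by
  rw [eq_neg_iff_add_eq_zero, dX, dX, Algebra.TensorProduct.tmul_mul_tmul,
    Algebra.TensorProduct.tmul_mul_tmul, ← TensorProduct.tmul_add,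
    ExteriorAlgebra.ι_add_mul_swap, TensorProduct.tmul_zero]

theorem dX_mul_self (i : σ) : dX k i * dX k i = 0 := by
  rw [dX, Algebra.TensorProduct.tmul_mul_tmul, ExteriorAlgebra.ι_sq_zero, TensorProduct.tmul_zero]

variable [Fintype σ] [Fintype τ] [DecidableEq τ]

theorem one_tmul_ι_mul (v : σ → k) (ω : PolyForms k σ) :
    (1 ⊗ₜ[k] ExteriorAlgebra.ι k v : PolyForms k σ) * ω = ∑ i, v i • (dX k i * ω) := by
  have h : (1 ⊗ₜ[k] ExteriorAlgebra.ι k v : PolyForms k σ) = ∑ i, v i • dX k i := by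
    conv_lhs => rw [pi_eq_sum_univ' v]
    simp [dX, TensorProduct.tmul_sum, map_sum]
  rw [h, Finset.sum_mul]
  exact Finset.sum_congr rfl fun i _ => smul_mul_assoc _ _ _

/-- A subspace which contains `1` and is stable under left multiplication by the generators
`x_i` and `dx_i` is everything. -/
theorem left_induction {S : Submodule k (PolyForms k σ)} (one : 1 ∈ S)
    (X_mul : ∀ i, ∀ ω ∈ S, ofPoly k (MvPolynomial.X i) * ω ∈ S)
    (dX_mul : ∀ i, ∀ ω ∈ S, dX k i * ω ∈ S) (ω : PolyForms k σ) : ω ∈ S := by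
  have h1 : ∀ l : ExteriorAlgebra k (σ → k), (1 ⊗ₜ l : PolyForms k σ) ∈ S := by
    intro l
    induction l using CliffordAlgebra.left_induction with
    | algebraMap r =>
      have : (1 ⊗ₜ[k] (algebraMap k (ExteriorAlgebra k (σ → k)) r) : PolyForms k σ) = r • 1 := by
        rw [Algebra.algebraMap_eq_smul_one, TensorProduct.tmul_smul]
        rfl
      exact this ▸ S.smul_mem _ one
    | add x y hx hy => rw [TensorProduct.tmul_add]; exact S.add_mem hx hy
    | ι_mul x m hx =>
      have := one_tmul_ι_mul m (1 ⊗ₜ[k] x : PolyForms k σ)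
      rw [Algebra.TensorProduct.tmul_mul_tmul, one_mul] at this
      exact this ▸ S.sum_mem fun i _ => S.smul_mem _ (dX_mul i _ hx)
  induction ω using TensorProduct.induction_on with
  | zero => exact S.zero_mem
  | add x y hx hy => exact S.add_mem hx hy
  | tmul f l =>
    induction f using MvPolynomial.induction_on with
    | C a =>
      have : ((MvPolynomial.C a) ⊗ₜ[k] l : PolyForms k σ) = a • (1 ⊗ₜ l) := by
        rw [TensorProduct.smul_tmul', MvPolynomial.smul_eq_C_mul, mul_one]
      exact this ▸ S.smul_mem _ (h1 l)
    | add p q hp hq => rw [TensorProduct.add_tmul]; exact S.add_mem hp hq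
    | mul_X p i hp =>
      rw [mul_comm, ← ofPoly_mul_tmul]
      exact X_mul i _ hp

theorem linearMap_ext {M : Type*} [AddCommGroup M] [Module k M] {A B : PolyForms k σ →ₗ[k] M}
    (one : A 1 = B 1)
    (X_mul : ∀ i ω, A ω = B ω →
      A (ofPoly k (MvPolynomial.X i) * ω) = B (ofPoly k (MvPolynomial.X i) * ω))
    (dX_mul : ∀ i ω, A ω = B ω → A (dX k i * ω) = B (dX k i * ω)) : A = B :=
  LinearMap.ext fun ω => left_induction (S := LinearMap.eqLocus A B) one X_mul dX_mul ω

/-! ### The de Rham differential -/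

theorem d_apply_tmul (f : MvPolynomial σ k) (l : ExteriorAlgebra k (σ → k)) :
    d k σ (f ⊗ₜ l) = ∑ i, (MvPolynomial.pderiv i f) ⊗ₜ[k]
      (ExteriorAlgebra.ι k (Pi.single i (1 : k) : σ → k) * l) := by
  simp [d]

theorem d_ofPoly (f : MvPolynomial σ k) :
    d k σ (ofPoly k f) = ∑ i, ofPoly k (MvPolynomial.pderiv i f) * dX k i := by
  rw [ofPoly, d_apply_tmul]
  simp [ofPoly, dX]

theorem d_ofPoly_eq_oneForm (f : MvPolynomial σ k) :
    d k σ (ofPoly k f) = oneForm k fun i => MvPolynomial.pderiv i f := by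
  rw [ofPoly, d_apply_tmul]
  simp [oneForm]

theorem d_one : d k σ 1 = 0 := by
  rw [← ofPoly_one, d_ofPoly]
  simp [ofPoly_zero]

theorem d_X (i : σ) : d k σ (ofPoly k (MvPolynomial.X i)) = dX k i := by
  rw [d_ofPoly, Finset.sum_eq_single i]
  · simp [ofPoly_one]
  · intro j _ h
    rw [MvPolynomial.pderiv_X_of_ne h.symm, ofPoly_zero, zero_mul]
  · simp

theorem d_ofPoly_mul (f : MvPolynomial σ k) (ω : PolyForms k σ) :
    d k σ (ofPoly k f * ω) = d k σ (ofPoly k f) * ω + ofPoly k f * d k σ ω := by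
  induction ω using TensorProduct.induction_on with
  | zero => simp
  | add x y hx hy => simp only [mul_add, map_add, hx, hy]; abel
  | tmul g l =>
    rw [ofPoly_mul_tmul, d_apply_tmul, d_apply_tmul, d_ofPoly, Finset.sum_mul, Finset.mul_sum,
      ← Finset.sum_add_distrib]
    refine Finset.sum_congr rfl fun i _ => ?_
    rw [mul_assoc, dX_mul_tmul, ofPoly_mul_tmul, ofPoly_mul_tmul, ← TensorProduct.add_tmul]
    congr 1
    rw [Derivation.leibniz, smul_eq_mul, smul_eq_mul]
    ring

theorem d_dX_mul (i : σ) (ω : PolyForms k σ) : d k σ (dX k i * ω) = -(dX k i * d k σ ω) := by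
  induction ω using TensorProduct.induction_on with
  | zero => simp
  | add x y hx hy => simp only [mul_add, map_add, hx, hy]; abel
  | tmul g l =>
    rw [dX_mul_tmul, d_apply_tmul, d_apply_tmul, Finset.mul_sum, ← Finset.sum_neg_distrib]
    refine Finset.sum_congr rfl fun j _ => ?_
    rw [dX_mul_tmul, ← TensorProduct.tmul_neg, ← mul_assoc, ← mul_assoc, ← neg_mul]
    congr 2
    rw [eq_neg_iff_add_eq_zero, ExteriorAlgebra.ι_add_mul_swap]

theorem d_d (ω : PolyForms k σ) : d k σ (d k σ ω) = 0 := by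
  have : d k σ ∘ₗ d k σ = 0 := by
    refine linearMap_ext (by simp [d_one]) (fun i ω h => ?_) (fun i ω h => ?_)
    · simp only [LinearMap.comp_apply, LinearMap.zero_apply] at h ⊢
      rw [d_ofPoly_mul, d_X, map_add, d_dX_mul, d_ofPoly_mul, d_X, h]
      simp
    · simp only [LinearMap.comp_apply, LinearMap.zero_apply] at h ⊢
      rw [d_dX_mul, map_neg, d_dX_mul, h]
      simp
  exact LinearMap.congr_fun this ω

theorem d_d_ofPoly_mul (f : MvPolynomial σ k) (ω : PolyForms k σ) :
    d k σ (d k σ (ofPoly k f) * ω) = -(d k σ (ofPoly k f) * d k σ ω) := by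
  have h := d_d (ofPoly k f * ω)
  rw [d_ofPoly_mul, map_add, d_ofPoly_mul, d_d, mul_zero, add_zero] at h
  exact eq_neg_of_add_eq_zero_left h

theorem d_mul_self (f : MvPolynomial σ k) :
    d k σ (ofPoly k f) * d k σ (ofPoly k f) = 0 := by
  rw [d_ofPoly_eq_oneForm, oneForm_mul_self]

theorem d_ofPoly_anticomm (f g : MvPolynomial σ k) :
    d k σ (ofPoly k f) * d k σ (ofPoly k g) = -(d k σ (ofPoly k g) * d k σ (ofPoly k f)) := by
  have h := d_mul_self (f + g)
  rw [ofPoly_add, map_add, add_mul, mul_add, mul_add, d_mul_self, d_mul_self, zero_add,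
    add_zero] at h
  exact eq_neg_of_add_eq_zero_left h

/-! ### Contraction with polynomial vector fields -/

/-- The contraction of forms with the vector field `∑ V_i ∂/∂x_i`. -/
def contract (V : σ → MvPolynomial σ k) : PolyForms k σ →ₗ[k] PolyForms k σ :=
  ∑ i, TensorProduct.map (LinearMap.mulLeft k (V i))
    (CliffordAlgebra.contractLeft (Q := (0 : QuadraticForm k (σ → k))) (LinearMap.proj i))

theorem contract_apply_tmul (V : σ → MvPolynomial σ k) (f : MvPolynomial σ k)
    (l : ExteriorAlgebra k (σ → k)) :
    contract V (f ⊗ₜ l) = ∑ i, (V i * f) ⊗ₜ[k]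
      (CliffordAlgebra.contractLeft (Q := (0 : QuadraticForm k (σ → k))) (LinearMap.proj i) l) := by
  simp [contract]

theorem contract_ofPoly_mul (V : σ → MvPolynomial σ k) (f : MvPolynomial σ k)
    (ω : PolyForms k σ) : contract V (ofPoly k f * ω) = ofPoly k f * contract V ω := by
  induction ω using TensorProduct.induction_on with
  | zero => simp
  | add x y hx hy => simp only [mul_add, map_add, hx, hy]
  | tmul g l =>
    rw [ofPoly_mul_tmul, contract_apply_tmul, contract_apply_tmul, Finset.mul_sum]
    refine Finset.sum_congr rfl fun i _ => ?_
    rw [ofPoly_mul_tmul, mul_left_comm]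

theorem contract_one (V : σ → MvPolynomial σ k) : contract V 1 = 0 := by
  rw [Algebra.TensorProduct.one_def, contract_apply_tmul]
  exact Finset.sum_eq_zero fun i _ => by
    rw [CliffordAlgebra.contractLeft_one, TensorProduct.tmul_zero]

theorem contract_ofPoly (V : σ → MvPolynomial σ k) (f : MvPolynomial σ k) :
    contract V (ofPoly k f) = 0 := by
  rw [← mul_one (ofPoly k f), contract_ofPoly_mul, contract_one, mul_zero]

theorem contract_dX_mul (V : σ → MvPolynomial σ k) (j : σ) (ω : PolyForms k σ) :
    contract V (dX k j * ω) = ofPoly k (V j) * ω - dX k j * contract V ω := by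
  induction ω using TensorProduct.induction_on with
  | zero => simp
  | add x y hx hy => simp only [mul_add, map_add, hx, hy]; abel
  | tmul g l =>
    rw [dX_mul_tmul, contract_apply_tmul, contract_apply_tmul, Finset.mul_sum, ofPoly_mul_tmul]
    simp only [dX_mul_tmul]
    have : ∀ i : σ, (V i * g) ⊗ₜ[k] (CliffordAlgebra.contractLeft
        (Q := (0 : QuadraticForm k (σ → k))) (LinearMap.proj i)
          (ExteriorAlgebra.ι k (Pi.single j (1 : k) : σ → k) * l)) =
        (if i = j then (V i * g) ⊗ₜ[k] l else 0) - (V i * g) ⊗ₜ[k]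
          (ExteriorAlgebra.ι k (Pi.single j (1 : k) : σ → k) * CliffordAlgebra.contractLeft
            (Q := (0 : QuadraticForm k (σ → k))) (LinearMap.proj i) l) := by
      intro i
      erw [CliffordAlgebra.contractLeft_ι_mul]
      rw [TensorProduct.tmul_sub]
      congr 1
      by_cases h : i = j
      · subst h; simp
      · simp [h]
    rw [Finset.sum_congr rfl fun i _ => this i, Finset.sum_sub_distrib]
    simp

/-- The derivative of a polynomial along a vector field. -/
def fieldDeriv (V : σ → MvPolynomial σ k) (f : MvPolynomial σ k) : MvPolynomial σ k :=
  ∑ i, V i * MvPolynomial.pderiv i f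

theorem fieldDeriv_X (V : σ → MvPolynomial σ k) (i : σ) : fieldDeriv V (MvPolynomial.X i) = V i := by
  rw [fieldDeriv, Finset.sum_eq_single i]
  · simp
  · intro j _ h
    rw [MvPolynomial.pderiv_X_of_ne h.symm, mul_zero]
  · simp

theorem contract_d_ofPoly_mul (V : σ → MvPolynomial σ k) (f : MvPolynomial σ k)
    (ω : PolyForms k σ) : contract V (d k σ (ofPoly k f) * ω) =
      ofPoly k (fieldDeriv V f) * ω - d k σ (ofPoly k f) * contract V ω := by
  rw [d_ofPoly, Finset.sum_mul, Finset.sum_mul, map_sum, fieldDeriv, ofPoly_sum, Finset.sum_mul,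
    ← Finset.sum_sub_distrib]
  refine Finset.sum_congr rfl fun i _ => ?_
  rw [mul_assoc, contract_ofPoly_mul, contract_dX_mul, mul_sub, ← mul_assoc, ← ofPoly_mul,
    mul_comm (V i), mul_assoc]

theorem contract_anticomm (V W : σ → MvPolynomial σ k) (ω : PolyForms k σ) :
    contract V (contract W ω) = -contract W (contract V ω) := by
  have : contract V ∘ₗ contract W = -(contract W ∘ₗ contract V) := by
    refine linearMap_ext (by simp [contract_one]) (fun i ω h => ?_) (fun i ω h => ?_)
    · simp only [LinearMap.comp_apply, LinearMap.neg_apply] at h ⊢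
      simp only [contract_ofPoly_mul, h, mul_neg']
    · simp only [LinearMap.comp_apply, LinearMap.neg_apply] at h ⊢
      simp only [contract_dX_mul, contract_ofPoly_mul, h, mul_neg', map_sub]
      abel
  exact LinearMap.congr_fun this ω

theorem contract_zero : contract (0 : σ → MvPolynomial σ k) = 0 := by
  simp [contract]

theorem contract_smul (g : MvPolynomial σ k) (V : σ → MvPolynomial σ k) (ω : PolyForms k σ) :
    contract (fun i => g * V i) ω = ofPoly k g * contract V ω := by
  have : contract (fun i => g * V i) = LinearMap.mulLeft k (ofPoly k g) ∘ₗ contract V := by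
    refine linearMap_ext (by simp [contract_one]) (fun i ω h => ?_) (fun i ω h => ?_)
    · simp only [LinearMap.comp_apply, LinearMap.mulLeft_apply] at h ⊢
      rw [contract_ofPoly_mul, contract_ofPoly_mul, h, ← mul_assoc, ← mul_assoc, ← ofPoly_mul,
        ← ofPoly_mul, mul_comm g]
    · simp only [LinearMap.comp_apply, LinearMap.mulLeft_apply] at h ⊢
      rw [contract_dX_mul, contract_dX_mul, h, mul_sub, ofPoly_mul, mul_assoc, ← mul_assoc (dX k i),
        ← mul_assoc _ (dX k i), ofPoly_mul_comm g (dX k i)]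
  exact LinearMap.congr_fun this ω

/-! ### Pullbacks -/

theorem pullback_ofPoly (f : τ → MvPolynomial σ k) (g : MvPolynomial τ k) :
    pullback k f (ofPoly k g) = ofPoly k (MvPolynomial.aeval f g) := by
  simp [pullback, ofPoly]

theorem pullback_dX (f : τ → MvPolynomial σ k) (j : τ) :
    pullback k f (dX k j) = d k σ (ofPoly k (f j)) := by
  rw [d_ofPoly_eq_oneForm]
  rw [pullback, dX]
  refine (Algebra.TensorProduct.lift_tmul _ _ _ _ _).trans ?_
  rw [map_one, one_mul, ExteriorAlgebra.lift_ι_apply]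
  simp only [pullbackOne, LinearMap.sum_apply, LinearMap.smulRight_apply,
      LinearMap.proj_apply]
  rw [Finset.sum_eq_single j]
  · simp
  · intro i _ h; simp [h]
  · simp

theorem pullback_d (f : τ → MvPolynomial σ k) (ω : PolyForms k τ) :
    pullback k f (d k τ ω) = d k σ (pullback k f ω) := by
  have : (pullback k f).toLinearMap ∘ₗ d k τ = d k σ ∘ₗ (pullback k f).toLinearMap := by
    refine linearMap_ext (by simp [d_one]) (fun i ω h => ?_) (fun i ω h => ?_)
    · simp only [LinearMap.comp_apply, AlgHom.toLinearMap_apply] at h ⊢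
      rw [d_ofPoly_mul, d_X, map_add, map_mul, map_mul, map_mul, pullback_dX, pullback_ofPoly,
        MvPolynomial.aeval_X, d_ofPoly_mul, h]
    · simp only [LinearMap.comp_apply, AlgHom.toLinearMap_apply] at h ⊢
      rw [d_dX_mul, map_neg, map_mul, map_mul, pullback_dX, h, d_d_ofPoly_mul]
  exact LinearMap.congr_fun this ω

theorem pullback_d_ofPoly (f : τ → MvPolynomial σ k) (g : MvPolynomial τ k) :
    pullback k f (d k τ (ofPoly k g)) = d k σ (ofPoly k (MvPolynomial.aeval f g)) := by
  rw [pullback_d, pullback_ofPoly]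

theorem pullback_pullback {υ : Type*} [Fintype υ] [DecidableEq υ] (f : τ → MvPolynomial σ k)
    (g : υ → MvPolynomial τ k) (ω : PolyForms k υ) :
    pullback k f (pullback k g ω) = pullback k (fun j => MvPolynomial.aeval f (g j)) ω := by
  have : (pullback k f).toLinearMap ∘ₗ (pullback k g).toLinearMap =
      (pullback k fun j => MvPolynomial.aeval f (g j)).toLinearMap := by
    refine linearMap_ext (by simp) (fun i ω h => ?_) (fun i ω h => ?_)
    · simp only [LinearMap.comp_apply, AlgHom.toLinearMap_apply] at h ⊢
      simp only [map_mul, h, pullback_ofPoly, MvPolynomial.aeval_X]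
    · simp only [LinearMap.comp_apply, AlgHom.toLinearMap_apply] at h ⊢
      simp only [map_mul, h, pullback_dX, pullback_d_ofPoly]
  exact LinearMap.congr_fun this ω

theorem pullback_X (ω : PolyForms k σ) : pullback k (MvPolynomial.X : σ → _) ω = ω := by
  have : (pullback k (MvPolynomial.X : σ → MvPolynomial σ k)).toLinearMap = LinearMap.id := by
    refine linearMap_ext (by simp) (fun i ω h => ?_) (fun i ω h => ?_)
    · simp only [LinearMap.id_apply, AlgHom.toLinearMap_apply] at h ⊢
      simp only [map_mul, h, pullback_ofPoly, MvPolynomial.aeval_X]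
    · simp only [LinearMap.id_apply, AlgHom.toLinearMap_apply] at h ⊢
      simp only [map_mul, h, pullback_dX, d_X]
  exact LinearMap.congr_fun this ω

/-- Contractions are compatible with pullbacks, for vector fields that are related by the map. -/
theorem contract_pullback (f : τ → MvPolynomial σ k) (W : σ → MvPolynomial σ k)
    (V : τ → MvPolynomial τ k) (h : ∀ j, fieldDeriv W (f j) = MvPolynomial.aeval f (V j))
    (ω : PolyForms k τ) :
    contract W (pullback k f ω) = pullback k f (contract V ω) := by
  have : contract W ∘ₗ (pullback k f).toLinearMap = (pullback k f).toLinearMap ∘ₗ contract V := by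
    refine linearMap_ext (by simp [contract_one]) (fun i ω ih => ?_) (fun i ω ih => ?_)
    · simp only [LinearMap.comp_apply, AlgHom.toLinearMap_apply] at ih ⊢
      simp only [map_mul, pullback_ofPoly, contract_ofPoly_mul, ih]
    · simp only [LinearMap.comp_apply, AlgHom.toLinearMap_apply] at ih ⊢
      simp only [map_mul, map_sub, pullback_dX, contract_d_ofPoly_mul, contract_dX_mul, ih, h,
        pullback_ofPoly]
  exact LinearMap.congr_fun this ω

end PolyForms

namespace PolyForms

variable {k : Type*} [Field k] {σ τ : Type*}
  [DecidableEq σ] [Fintype σ] [Fintype τ] [DecidableEq τ]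

/-! ### The grading -/

theorem tmul_mem_gr {p : ℕ} (f : MvPolynomial σ k) {l : ExteriorAlgebra k (σ → k)}
    (hl : l ∈ ⋀[k]^p (σ → k)) : (f ⊗ₜ l : PolyForms k σ) ∈ gr k σ p :=
  ⟨f ⊗ₜ ⟨l, hl⟩, by simp⟩

theorem gr_le {p : ℕ} {S : Submodule k (PolyForms k σ)}
    (h : ∀ f, ∀ l ∈ ⋀[k]^p (σ → k), (f ⊗ₜ l : PolyForms k σ) ∈ S) : gr k σ p ≤ S := by
  rintro _ ⟨z, rfl⟩
  induction z using TensorProduct.induction_on with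
  | zero => simp
  | tmul f l => exact h f l l.2
  | add a b ha hb => rw [map_add]; exact S.add_mem ha hb

theorem ofPoly_mem_gr (f : MvPolynomial σ k) : ofPoly k f ∈ gr k σ 0 :=
  tmul_mem_gr f (by rw [ExteriorAlgebra.exteriorPower, pow_zero]; exact Submodule.one_le.1 le_rfl)

theorem one_mem_gr : (1 : PolyForms k σ) ∈ gr k σ 0 := ofPoly_mem_gr 1

theorem exists_ofPoly_of_mem_gr {ω : PolyForms k σ} (h : ω ∈ gr k σ 0) :
    ∃ f, ω = ofPoly k f := by
  have : gr k σ 0 ≤ LinearMap.range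
      (Algebra.TensorProduct.includeLeft : MvPolynomial σ k →ₐ[k] PolyForms k σ).toLinearMap := by
    refine gr_le fun f l hl => ?_
    rw [ExteriorAlgebra.exteriorPower, pow_zero, Submodule.mem_one] at hl
    obtain ⟨c, rfl⟩ := hl
    refine ⟨c • f, ?_⟩
    simp [Algebra.algebraMap_eq_smul_one]
  obtain ⟨f, hf⟩ := this h
  exact ⟨f, hf.symm⟩

theorem ofPoly_mul_mem_gr {p : ℕ} (g : MvPolynomial σ k) {ω : PolyForms k σ}
    (h : ω ∈ gr k σ p) : ofPoly k g * ω ∈ gr k σ p := by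
  have : gr k σ p ≤ (gr k σ p).comap (LinearMap.mulLeft k (ofPoly k g)) :=
    gr_le fun f l hl => by
      rw [Submodule.mem_comap, LinearMap.mulLeft_apply, ofPoly_mul_tmul]
      exact tmul_mem_gr _ hl
  exact this h

theorem dX_mul_mem_gr {p : ℕ} (i : σ) {ω : PolyForms k σ}
    (h : ω ∈ gr k σ p) : dX k i * ω ∈ gr k σ (p + 1) := by
  have : gr k σ p ≤ (gr k σ (p + 1)).comap (LinearMap.mulLeft k (dX k i)) :=
    gr_le fun f l hl => by
      rw [Submodule.mem_comap, LinearMap.mulLeft_apply, dX_mul_tmul]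
      refine tmul_mem_gr _ ?_
      rw [ExteriorAlgebra.exteriorPower, pow_succ']
      exact Submodule.mul_mem_mul ⟨_, rfl⟩ hl
  exact this h

theorem dX_mem_gr (i : σ) : dX k i ∈ gr k σ 1 := by
  simpa using dX_mul_mem_gr i (one_mem_gr (k := k) (σ := σ))

theorem gr_succ_le {p : ℕ} {S : Submodule k (PolyForms k σ)}
    (h : ∀ i, ∀ ω ∈ gr k σ p, dX k i * ω ∈ S) : gr k σ (p + 1) ≤ S := by
  refine gr_le fun f l hl => ?_
  rw [ExteriorAlgebra.exteriorPower, pow_succ'] at hl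
  induction hl using Submodule.mul_induction_on' with
  | mem_mul_mem x hx y hy =>
    obtain ⟨v, rfl⟩ := hx
    have := one_tmul_ι_mul v (f ⊗ₜ[k] y : PolyForms k σ)
    rw [Algebra.TensorProduct.tmul_mul_tmul, one_mul] at this
    rw [this]
    exact S.sum_mem fun i _ => S.smul_mem _ (h i _ (tmul_mem_gr _ hy))
  | add x _ y _ hx hy => rw [TensorProduct.tmul_add]; exact S.add_mem hx hy

theorem gr_induction {S : Submodule k (PolyForms k σ)} (h : ∀ p, gr k σ p ≤ S)
    (ω : PolyForms k σ) : ω ∈ S := by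
  refine (iSup_le h) (left_induction (S := ⨆ p, gr k σ p) ?_ ?_ ?_ ω)
  · exact Submodule.mem_iSup_of_mem 0 one_mem_gr
  · intro i ω hω
    have : ⨆ p, gr k σ p ≤ (⨆ p, gr k σ p).comap
        (LinearMap.mulLeft k (ofPoly k (MvPolynomial.X i))) :=
      iSup_le fun p ω h => Submodule.mem_iSup_of_mem p (ofPoly_mul_mem_gr _ h)
    exact this hω
  · intro i ω hω
    have : ⨆ p, gr k σ p ≤ (⨆ p, gr k σ p).comap (LinearMap.mulLeft k (dX k i)) :=
      iSup_le fun p ω h => Submodule.mem_iSup_of_mem (p + 1) (dX_mul_mem_gr _ h)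
    exact this hω

theorem mul_mem_gr {p q : ℕ} {a b : PolyForms k σ} (ha : a ∈ gr k σ p) (hb : b ∈ gr k σ q) :
    a * b ∈ gr k σ (p + q) := by
  induction p generalizing a with
  | zero =>
    obtain ⟨f, rfl⟩ := exists_ofPoly_of_mem_gr ha
    rw [zero_add]
    exact ofPoly_mul_mem_gr _ hb
  | succ p ih =>
    have : gr k σ (p + 1) ≤ (gr k σ (p + 1 + q)).comap (LinearMap.mulRight k b) :=
      gr_succ_le fun i ω h => by
        rw [Submodule.mem_comap, LinearMap.mulRight_apply, mul_assoc, add_right_comm]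
        exact dX_mul_mem_gr i (ih h)
    exact this ha

theorem mul_dX {q : ℕ} (i : σ) {b : PolyForms k σ} (hb : b ∈ gr k σ q) :
    dX k i * b = (-1 : k) ^ q • (b * dX k i) := by
  induction q generalizing b with
  | zero =>
    obtain ⟨f, rfl⟩ := exists_ofPoly_of_mem_gr hb
    rw [ofPoly_mul_comm, pow_zero, one_smul]
  | succ q ih =>
    have : gr k σ (q + 1) ≤ LinearMap.eqLocus (LinearMap.mulLeft k (dX k i))
        ((-1 : k) ^ (q + 1) • LinearMap.mulRight k (dX k i)) :=
      gr_succ_le fun j ω h => by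
        rw [LinearMap.mem_eqLocus, LinearMap.smul_apply, LinearMap.mulLeft_apply,
          LinearMap.mulRight_apply, ← mul_assoc, dX_mul_dX, neg_mul', mul_assoc, ih h,
          mul_smul_comm, mul_assoc, pow_succ, mul_neg_one, neg_smul]
    exact this hb

theorem mul_comm_of_mem_gr {p q : ℕ} {a b : PolyForms k σ} (ha : a ∈ gr k σ p)
    (hb : b ∈ gr k σ q) : a * b = (-1 : k) ^ (p * q) • (b * a) := by
  induction p generalizing a with
  | zero =>
    obtain ⟨f, rfl⟩ := exists_ofPoly_of_mem_gr ha
    rw [ofPoly_mul_comm, zero_mul, pow_zero, one_smul]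
  | succ p ih =>
    have : gr k σ (p + 1) ≤ LinearMap.eqLocus (LinearMap.mulRight k b)
        ((-1 : k) ^ ((p + 1) * q) • LinearMap.mulLeft k b) :=
      gr_succ_le fun i ω h => by
        rw [LinearMap.mem_eqLocus, LinearMap.smul_apply, LinearMap.mulLeft_apply,
          LinearMap.mulRight_apply, mul_assoc, ih h, mul_smul_comm, ← mul_assoc, mul_dX i hb,
          smul_mul_assoc, smul_smul, mul_assoc, ← pow_add]
        congr 2
        ring
    exact this ha

theorem d_mem_gr {p : ℕ} {ω : PolyForms k σ} (h : ω ∈ gr k σ p) :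
    d k σ ω ∈ gr k σ (p + 1) := by
  induction p generalizing ω with
  | zero =>
    obtain ⟨f, rfl⟩ := exists_ofPoly_of_mem_gr h
    rw [d_ofPoly]
    exact Submodule.sum_mem _ fun i _ => ofPoly_mul_mem_gr _ (dX_mem_gr i)
  | succ p ih =>
    have : gr k σ (p + 1) ≤ (gr k σ (p + 1 + 1)).comap (d k σ) :=
      gr_succ_le fun i ω h => by
        rw [Submodule.mem_comap, d_dX_mul]
        exact Submodule.neg_mem _ (dX_mul_mem_gr i (ih h))
    exact this h

theorem contract_mem_gr {p : ℕ} (V : σ → MvPolynomial σ k) {ω : PolyForms k σ}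
    (h : ω ∈ gr k σ (p + 1)) : contract V ω ∈ gr k σ p := by
  induction p generalizing ω with
  | zero =>
    have : gr k σ 1 ≤ (gr k σ 0).comap (contract V) :=
      gr_succ_le fun i ω h => by
        obtain ⟨f, rfl⟩ := exists_ofPoly_of_mem_gr h
        rw [Submodule.mem_comap, contract_dX_mul, contract_ofPoly, mul_zero, sub_zero]
        exact ofPoly_mul_mem_gr _ h
    exact this h
  | succ p ih =>
    have : gr k σ (p + 1 + 1) ≤ (gr k σ (p + 1)).comap (contract V) :=
      gr_succ_le fun i ω h => by
        rw [Submodule.mem_comap, contract_dX_mul]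
        exact Submodule.sub_mem _ (ofPoly_mul_mem_gr _ h) (dX_mul_mem_gr i (ih h))
    exact this h

theorem contract_of_mem_gr_zero (V : σ → MvPolynomial σ k) {ω : PolyForms k σ}
    (h : ω ∈ gr k σ 0) : contract V ω = 0 := by
  obtain ⟨f, rfl⟩ := exists_ofPoly_of_mem_gr h
  exact contract_ofPoly V f

theorem pullback_mem_gr {p : ℕ} (f : τ → MvPolynomial σ k) {ω : PolyForms k τ}
    (h : ω ∈ gr k τ p) : pullback k f ω ∈ gr k σ p := by
  induction p generalizing ω with
  | zero =>
    obtain ⟨g, rfl⟩ := exists_ofPoly_of_mem_gr h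
    rw [pullback_ofPoly]
    exact ofPoly_mem_gr _
  | succ p ih =>
    have : gr k τ (p + 1) ≤ (gr k σ (p + 1)).comap (pullback k f).toLinearMap :=
      gr_succ_le fun i ω h => by
        rw [Submodule.mem_comap, AlgHom.toLinearMap_apply, map_mul, pullback_dX, add_comm p]
        exact mul_mem_gr (d_mem_gr (ofPoly_mem_gr _)) (ih h)
    exact this h

theorem parity_of_mem_gr {p : ℕ} {ω : PolyForms k σ} (h : ω ∈ gr k σ p) :
    parity k σ ω = (-1 : k) ^ p • ω := by
  have tm : ∀ f l, parity k σ (f ⊗ₜ l) = f ⊗ₜ CliffordAlgebra.involute l := fun f l => by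
    simp [parity]
  have mul : ∀ i ω, parity k σ (dX k i * ω) = -(dX k i * parity k σ ω) := by
    intro i ω
    induction ω using TensorProduct.induction_on with
    | zero => simp
    | add x y hx hy => simp only [mul_add, map_add, hx, hy, neg_add]
    | tmul g l =>
      rw [dX_mul_tmul, tm, tm, dX_mul_tmul, map_mul, CliffordAlgebra.involute_ι, neg_mul,
        TensorProduct.tmul_neg]
  induction p generalizing ω with
  | zero =>
    obtain ⟨g, rfl⟩ := exists_ofPoly_of_mem_gr h
    rw [ofPoly, tm, map_one, pow_zero, one_smul]
  | succ p ih =>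
    have : gr k σ (p + 1) ≤ LinearMap.eqLocus (parity k σ) ((-1 : k) ^ (p + 1) • LinearMap.id) :=
      gr_succ_le fun i ω h => by
        rw [LinearMap.mem_eqLocus, mul, ih h, LinearMap.smul_apply, LinearMap.id_apply,
          mul_smul_comm, pow_succ, mul_neg_one, neg_smul]
    exact this h

/-! ### Integration over the fibre -/

theorem d_ofPoly_rename (g : MvPolynomial σ k) :
    d k (Option σ) (ofPoly k (MvPolynomial.rename some g)) =
      ∑ i, ofPoly k (MvPolynomial.rename some (MvPolynomial.pderiv i g)) * dX k (some i) := by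
  rw [d_ofPoly, Fintype.sum_option]
  have h0 : MvPolynomial.pderiv none (MvPolynomial.rename some g : MvPolynomial (Option σ) k)
      = 0 := by
    induction g using MvPolynomial.induction_on with
    | C a => simp
    | add p q hp hq => simp [hp, hq]
    | mul_X p i hp => simp [hp]
  rw [h0, ofPoly_zero, zero_mul, zero_add]
  refine Finset.sum_congr rfl fun i _ => ?_
  rw [MvPolynomial.pderiv_rename (Option.some_injective σ)]

variable (k σ) in
/-- The integral of the coefficients, with `du ↦ 0`. -/
def coeffIntegral : PolyForms k (Option σ) →ₗ[k] PolyForms k σ :=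
  TensorProduct.map
    ((MvPolynomial.basisMonomials (Option σ) k).constr k fun a =>
      MvPolynomial.monomial a.some (((a none : ℕ) + 1 : k)⁻¹))
    ((ExteriorAlgebra.map (LinearMap.funLeft k k (Option.some : σ → Option σ))).toLinearMap)

theorem fibreIntegral_eq (ω : PolyForms k (Option σ)) :
    fibreIntegral k σ ω = coeffIntegral k σ (contract (Pi.single none 1) ω) := by
  induction ω using TensorProduct.induction_on with
  | zero => simp
  | add x y hx hy => simp only [map_add, hx, hy]
  | tmul f l =>
    rw [contract_apply_tmul, Finset.sum_eq_single none]
    · simp [fibreIntegral, coeffIntegral]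
    · intro i _ h; simp [h]
    · simp

theorem coeffIntegral_tmul (f : MvPolynomial (Option σ) k) (l) :
    coeffIntegral k σ (f ⊗ₜ l) = ((MvPolynomial.basisMonomials (Option σ) k).constr k fun a =>
      MvPolynomial.monomial a.some (((a none : ℕ) + 1 : k)⁻¹)) f ⊗ₜ
        ExteriorAlgebra.map (LinearMap.funLeft k k (Option.some : σ → Option σ)) l := by
  simp [coeffIntegral]

theorem coeffIntegral_dX_none_mul (ω : PolyForms k (Option σ)) :
    coeffIntegral k σ (dX k none * ω) = 0 := by
  induction ω using TensorProduct.induction_on with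
  | zero => simp
  | add x y hx hy => simp only [mul_add, map_add, hx, hy, add_zero]
  | tmul f l =>
    rw [dX_mul_tmul, coeffIntegral_tmul, map_mul, ExteriorAlgebra.map_apply_ι]
    have : (LinearMap.funLeft k k (Option.some : σ → Option σ)) (Pi.single none (1 : k)) = 0 := by
      ext j; simp [LinearMap.funLeft_apply]
    rw [this, map_zero, zero_mul, TensorProduct.tmul_zero]

theorem coeffIntegral_dX_some_mul (j : σ) (ω : PolyForms k (Option σ)) :
    coeffIntegral k σ (dX k (some j) * ω) = dX k j * coeffIntegral k σ ω := by
  induction ω using TensorProduct.induction_on with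
  | zero => simp
  | add x y hx hy => simp only [mul_add, map_add, hx, hy]
  | tmul f l =>
    rw [dX_mul_tmul, coeffIntegral_tmul, map_mul, ExteriorAlgebra.map_apply_ι, coeffIntegral_tmul,
      dX_mul_tmul]
    have : (LinearMap.funLeft k k (Option.some : σ → Option σ)) (Pi.single (some j) (1 : k)) =
        Pi.single j 1 := by
      ext i; simp [LinearMap.funLeft_apply, Pi.single_apply]
    rw [this]

theorem coeffIntegral_X_some_mul (j : σ) (ω : PolyForms k (Option σ)) :
    coeffIntegral k σ (ofPoly k (MvPolynomial.X (some j)) * ω) =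
      ofPoly k (MvPolynomial.X j) * coeffIntegral k σ ω := by
  induction ω using TensorProduct.induction_on with
  | zero => simp
  | add x y hx hy => simp only [mul_add, map_add, hx, hy]
  | tmul f l =>
    rw [ofPoly_mul_tmul, coeffIntegral_tmul, coeffIntegral_tmul, ofPoly_mul_tmul]
    congr 1
    induction f using MvPolynomial.induction_on' with
    | add p q hp hq => simp only [mul_add, map_add, hp, hq]
    | monomial a c =>
      have hm : ∀ (a : Option σ →₀ ℕ) (c : k),
          (MvPolynomial.basisMonomials (Option σ) k).constr k (fun a =>
            MvPolynomial.monomial a.some (((a none : ℕ) + 1 : k)⁻¹)) (MvPolynomial.monomial a c) =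
          c • MvPolynomial.monomial a.some (((a none : ℕ) + 1 : k)⁻¹) := by
        intro a c
        have : MvPolynomial.monomial a c = c • MvPolynomial.basisMonomials (Option σ) k a := by
          simp [MvPolynomial.smul_monomial]
        rw [this, map_smul, Module.Basis.constr_basis]
      rw [MvPolynomial.X, MvPolynomial.monomial_mul, hm, hm, mul_smul_comm, MvPolynomial.X,
        MvPolynomial.monomial_mul, one_mul, one_mul]
      congr 2
      · ext i
        simp
      · simp

theorem coeffIntegral_X_none_pow (a : ℕ) :
    coeffIntegral k σ (ofPoly k (MvPolynomial.X none ^ a)) = ((a : k) + 1)⁻¹ • 1 := by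
  rw [ofPoly, coeffIntegral_tmul, map_one]
  have : (MvPolynomial.X none ^ a : MvPolynomial (Option σ) k) =
      MvPolynomial.basisMonomials (Option σ) k (Finsupp.single none a) := by
    simp [MvPolynomial.X_pow_eq_monomial]
  rw [this, Module.Basis.constr_basis, Algebra.TensorProduct.one_def, TensorProduct.smul_tmul']
  congr 1
  have h0 : (Finsupp.single none a : Option σ →₀ ℕ).some = 0 := by ext; simp
  rw [h0, Finsupp.single_eq_same, MvPolynomial.monomial_zero', MvPolynomial.smul_eq_C_mul, mul_one]

theorem fibreIntegral_X_some_mul (j : σ) (ω : PolyForms k (Option σ)) :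
    fibreIntegral k σ (ofPoly k (MvPolynomial.X (some j)) * ω) =
      ofPoly k (MvPolynomial.X j) * fibreIntegral k σ ω := by
  rw [fibreIntegral_eq, fibreIntegral_eq, contract_ofPoly_mul, coeffIntegral_X_some_mul]

theorem fibreIntegral_dX_some_mul (j : σ) (ω : PolyForms k (Option σ)) :
    fibreIntegral k σ (dX k (some j) * ω) = -(dX k j * fibreIntegral k σ ω) := by
  rw [fibreIntegral_eq, fibreIntegral_eq, contract_dX_mul]
  simp [ofPoly_zero, coeffIntegral_dX_some_mul]

theorem fibreIntegral_X_none_pow (a : ℕ) :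
    fibreIntegral k σ (ofPoly k (MvPolynomial.X none ^ a)) = 0 := by
  rw [fibreIntegral_eq, contract_ofPoly, map_zero]

theorem fibreIntegral_X_none_pow_mul_dX (a : ℕ) :
    fibreIntegral k σ (ofPoly k (MvPolynomial.X none ^ a) * dX k none) = ((a : k) + 1)⁻¹ • 1 := by
  have h : contract (Pi.single none 1) (dX k none : PolyForms k (Option σ)) = 1 := by
    have := contract_dX_mul (k := k) (Pi.single none 1) (none : Option σ) 1
    simpa [contract_one, ofPoly_one] using this
  rw [fibreIntegral_eq, contract_ofPoly_mul, h, mul_one, coeffIntegral_X_none_pow]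

theorem fibreIntegral_rename_mul (g : MvPolynomial σ k) (ω : PolyForms k (Option σ)) :
    fibreIntegral k σ (ofPoly k (MvPolynomial.rename some g) * ω) =
      ofPoly k g * fibreIntegral k σ ω := by
  induction g using MvPolynomial.induction_on generalizing ω with
  | C a =>
    rw [MvPolynomial.rename_C, ofPoly_C, ofPoly_C, smul_mul_assoc, smul_mul_assoc, one_mul,
      one_mul, map_smul]
  | add p q hp hq => simp only [map_add, ofPoly_add, add_mul, hp, hq]
  | mul_X p i hp =>
    rw [map_mul (MvPolynomial.rename some), ofPoly_mul, MvPolynomial.rename_X, mul_assoc, hp,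
      fibreIntegral_X_some_mul, ← mul_assoc, ofPoly_mul]

theorem fibreIntegral_d_rename_mul (g : MvPolynomial σ k) (ω : PolyForms k (Option σ)) :
    fibreIntegral k σ (d k (Option σ) (ofPoly k (MvPolynomial.rename some g)) * ω) =
      -(d k σ (ofPoly k g) * fibreIntegral k σ ω) := by
  rw [d_ofPoly_rename, Finset.sum_mul, map_sum, d_ofPoly, Finset.sum_mul,
    ← Finset.sum_neg_distrib]
  refine Finset.sum_congr rfl fun i _ => ?_
  rw [mul_assoc, fibreIntegral_rename_mul, fibreIntegral_dX_some_mul, mul_neg', mul_assoc]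

theorem fibre_induction {S : Submodule k (PolyForms k (Option σ))}
    (pow : ∀ a : ℕ, ofPoly k (MvPolynomial.X none ^ a) ∈ S)
    (pow_dX : ∀ a : ℕ, ofPoly k (MvPolynomial.X none ^ a) * dX k none ∈ S)
    (X_mul : ∀ i, ∀ ω ∈ S, ofPoly k (MvPolynomial.X (some i)) * ω ∈ S)
    (dX_mul : ∀ i, ∀ ω ∈ S, dX k (some i) * ω ∈ S) (ω : PolyForms k (Option σ)) : ω ∈ S := by
  have h : ∀ ω : PolyForms k (Option σ),
      ω ∈ ((⨅ a : ℕ, S.comap (LinearMap.mulLeft k (ofPoly k (MvPolynomial.X none ^ a)))) ⊓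
        (⨅ a : ℕ, S.comap (LinearMap.mulLeft k
          (ofPoly k (MvPolynomial.X none ^ a) * dX k none)))) := by
    intro ω
    refine left_induction ?_ ?_ ?_ ω
    · simp only [Submodule.mem_inf, Submodule.mem_iInf, Submodule.mem_comap,
        LinearMap.mulLeft_apply, mul_one]
      exact ⟨pow, pow_dX⟩
    · rintro (_ | i) ω hω <;>
      simp only [Submodule.mem_inf, Submodule.mem_iInf, Submodule.mem_comap,
        LinearMap.mulLeft_apply] at hω ⊢
      · refine ⟨fun a => ?_, fun a => ?_⟩
        · rw [← mul_assoc, ← ofPoly_mul, ← pow_succ]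
          exact hω.1 _
        · rw [mul_assoc, ← mul_assoc (dX k none), ← ofPoly_mul_comm, mul_assoc, ← mul_assoc,
            ← ofPoly_mul, ← pow_succ, ← mul_assoc]
          exact hω.2 _
      · refine ⟨fun a => ?_, fun a => ?_⟩
        · rw [← mul_assoc, ofPoly_mul_comm, mul_assoc]
          exact X_mul i _ (hω.1 a)
        · rw [← mul_assoc, ← ofPoly_mul_comm, mul_assoc]
          exact X_mul i _ (hω.2 a)
    · rintro (_ | i) ω hω <;>
      simp only [Submodule.mem_inf, Submodule.mem_iInf, Submodule.mem_comap,
        LinearMap.mulLeft_apply] at hω ⊢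
      · refine ⟨fun a => ?_, fun a => ?_⟩
        · rw [← mul_assoc]
          exact hω.2 _
        · rw [mul_assoc, ← mul_assoc (dX k none), dX_mul_self, zero_mul, mul_zero]
          exact S.zero_mem
      · refine ⟨fun a => ?_, fun a => ?_⟩
        · rw [← mul_assoc, ofPoly_mul_comm, mul_assoc]
          exact dX_mul i _ (hω.1 a)
        · rw [mul_assoc, ← mul_assoc (dX k none), dX_mul_dX, neg_mul', mul_neg', mul_assoc,
            ← mul_assoc, ofPoly_mul_comm, mul_assoc, ← mul_assoc (ofPoly k _)]
          exact S.neg_mem (dX_mul i _ (hω.2 a))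
  have := h ω
  simp only [Submodule.mem_inf, Submodule.mem_iInf, Submodule.mem_comap,
    LinearMap.mulLeft_apply] at this
  simpa [ofPoly_one] using this.1 0

theorem linearMap_ext_fibre {M : Type*} [AddCommGroup M] [Module k M]
    {A B : PolyForms k (Option σ) →ₗ[k] M}
    (pow : ∀ a : ℕ, A (ofPoly k (MvPolynomial.X none ^ a)) =
      B (ofPoly k (MvPolynomial.X none ^ a)))
    (pow_dX : ∀ a : ℕ, A (ofPoly k (MvPolynomial.X none ^ a) * dX k none) =
      B (ofPoly k (MvPolynomial.X none ^ a) * dX k none))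
    (X_mul : ∀ i ω, A ω = B ω →
      A (ofPoly k (MvPolynomial.X (some i)) * ω) = B (ofPoly k (MvPolynomial.X (some i)) * ω))
    (dX_mul : ∀ i ω, A ω = B ω → A (dX k (some i) * ω) = B (dX k (some i) * ω)) : A = B :=
  LinearMap.ext fun ω => fibre_induction (S := LinearMap.eqLocus A B) pow pow_dX X_mul dX_mul ω

variable (k σ) in
/-- The restriction to the section `u = c` of the projection, for a constant `c`. -/
def fibreEval (c : k) : PolyForms k (Option σ) →ₐ[k] PolyForms k σ :=
  pullback k fun j => j.elim (MvPolynomial.C c) MvPolynomial.X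

theorem fibreEval_X_some_mul (c : k) (j : σ) (ω : PolyForms k (Option σ)) :
    fibreEval k σ c (ofPoly k (MvPolynomial.X (some j)) * ω) =
      ofPoly k (MvPolynomial.X j) * fibreEval k σ c ω := by
  rw [fibreEval, map_mul, pullback_ofPoly, MvPolynomial.aeval_X]
  rfl

theorem fibreEval_dX_some_mul (c : k) (j : σ) (ω : PolyForms k (Option σ)) :
    fibreEval k σ c (dX k (some j) * ω) = dX k j * fibreEval k σ c ω := by
  rw [fibreEval, map_mul, pullback_dX]
  congr 1
  exact d_X j

theorem fibreEval_pow (c : k) (a : ℕ) :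
    fibreEval k σ c (ofPoly k (MvPolynomial.X none ^ a)) = c ^ a • 1 := by
  rw [fibreEval, pullback_ofPoly, map_pow, MvPolynomial.aeval_X, Option.elim, ← map_pow, ofPoly_C]

theorem d_ofPoly_C (c : k) : d k σ (ofPoly k (MvPolynomial.C c)) = 0 := by
  rw [ofPoly_C, map_smul, d_one, smul_zero]

theorem fibreEval_pow_dX (c : k) (a : ℕ) :
    fibreEval k σ c (ofPoly k (MvPolynomial.X none ^ a) * dX k none) = 0 := by
  rw [map_mul, fibreEval, pullback_dX, Option.elim, d_ofPoly_C, mul_zero]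

theorem d_X_none_pow (a : ℕ) : d k (Option σ) (ofPoly k (MvPolynomial.X none ^ (a + 1))) =
    ((a : k) + 1) • (ofPoly k (MvPolynomial.X none ^ a) * dX k none) := by
  rw [d_ofPoly, Finset.sum_eq_single none]
  · rw [MvPolynomial.pderiv_pow, MvPolynomial.pderiv_X_self, mul_one, Nat.add_sub_cancel,
      ofPoly_mul, ← smul_mul_assoc]
    congr 1
    rw [← ofPoly_mul, ← ofPoly_smul, MvPolynomial.smul_eq_C_mul]
    simp
  · intro i _ h
    rw [MvPolynomial.pderiv_pow, MvPolynomial.pderiv_X_of_ne h.symm, mul_zero, ofPoly_zero,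
      zero_mul]
  · simp

/-- Stokes' theorem for the integration over the fibre `[0,1]`. -/
theorem fibreIntegral_stokes [CharZero k] (ω : PolyForms k (Option σ)) :
    d k σ (fibreIntegral k σ ω) + fibreIntegral k σ (d k (Option σ) ω) =
      fibreEval k σ 1 ω - fibreEval k σ 0 ω := by
  have : d k σ ∘ₗ fibreIntegral k σ + fibreIntegral k σ ∘ₗ d k (Option σ) =
      (fibreEval k σ 1).toLinearMap - (fibreEval k σ 0).toLinearMap := by
    refine linearMap_ext_fibre (fun a => ?_) (fun a => ?_) (fun i ω h => ?_) (fun i ω h => ?_)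
    · simp only [LinearMap.add_apply, LinearMap.sub_apply, LinearMap.comp_apply,
        AlgHom.toLinearMap_apply, fibreIntegral_X_none_pow, fibreEval_pow, map_zero, zero_add]
      rcases a with _ | a
      · simp [ofPoly_one, d_one]
      · have ha : (a : k) + 1 ≠ 0 := by exact_mod_cast a.succ_ne_zero
        rw [d_X_none_pow, map_smul, fibreIntegral_X_none_pow_mul_dX, smul_smul,
          mul_inv_cancel₀ ha]
        simp
    · simp only [LinearMap.add_apply, LinearMap.sub_apply, LinearMap.comp_apply,
        AlgHom.toLinearMap_apply, fibreIntegral_X_none_pow_mul_dX, fibreEval_pow_dX, map_smul,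
        d_one, smul_zero, zero_add, sub_zero]
      have hd : d k (Option σ) (dX k none) = 0 := by rw [← d_X, d_d]
      rcases a with _ | a
      · rw [pow_zero, ofPoly_one, one_mul, hd, map_zero]
      · rw [d_ofPoly_mul, hd, d_X_none_pow, smul_mul_assoc, mul_assoc, dX_mul_self]
        simp
    · simp only [LinearMap.add_apply, LinearMap.sub_apply, LinearMap.comp_apply,
        AlgHom.toLinearMap_apply] at h ⊢
      rw [fibreIntegral_X_some_mul, d_ofPoly_mul, d_X, d_ofPoly_mul, d_X, map_add,
        fibreIntegral_X_some_mul, fibreIntegral_dX_some_mul, fibreEval_X_some_mul,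
        fibreEval_X_some_mul, ← mul_sub, ← h, mul_add]
      abel
    · simp only [LinearMap.add_apply, LinearMap.sub_apply, LinearMap.comp_apply,
        AlgHom.toLinearMap_apply] at h ⊢
      rw [fibreIntegral_dX_some_mul, map_neg, d_dX_mul, d_dX_mul, map_neg,
        fibreIntegral_dX_some_mul, fibreEval_dX_some_mul,
        fibreEval_dX_some_mul, ← mul_sub, ← h, mul_add]
      abel
  exact LinearMap.congr_fun this ω

/-- Integration over the fibre commutes with base change. -/
theorem pullback_fibreIntegral (f : τ → MvPolynomial σ k) (ω : PolyForms k (Option τ)) :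
    pullback k f (fibreIntegral k τ ω) = fibreIntegral k σ (pullback k (fun j : Option τ =>
      j.elim (MvPolynomial.X none) fun j => MvPolynomial.rename some (f j)) ω) := by
  have : (pullback k f).toLinearMap ∘ₗ fibreIntegral k τ = fibreIntegral k σ ∘ₗ
      (pullback k (fun j : Option τ =>
        j.elim (MvPolynomial.X none) fun j => MvPolynomial.rename some (f j))).toLinearMap := by
    refine linearMap_ext_fibre (fun a => ?_) (fun a => ?_) (fun i ω h => ?_) (fun i ω h => ?_)
    · simp only [LinearMap.comp_apply, AlgHom.toLinearMap_apply, fibreIntegral_X_none_pow,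
        map_zero, pullback_ofPoly, map_pow, MvPolynomial.aeval_X, Option.elim]
    · simp only [LinearMap.comp_apply, AlgHom.toLinearMap_apply, fibreIntegral_X_none_pow_mul_dX,
        map_smul, map_one, map_mul, pullback_ofPoly, map_pow, MvPolynomial.aeval_X, Option.elim,
        pullback_dX, d_X]
    · simp only [LinearMap.comp_apply, AlgHom.toLinearMap_apply] at h ⊢
      rw [fibreIntegral_X_some_mul, map_mul, map_mul, pullback_ofPoly, pullback_ofPoly,
        MvPolynomial.aeval_X, MvPolynomial.aeval_X, Option.elim, fibreIntegral_rename_mul, h]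
    · simp only [LinearMap.comp_apply, AlgHom.toLinearMap_apply] at h ⊢
      rw [fibreIntegral_dX_some_mul, map_neg, map_mul, map_mul, pullback_dX, pullback_dX,
        Option.elim, fibreIntegral_d_rename_mul, h]
  exact LinearMap.congr_fun this ω

theorem fibreIntegral_eq_zero {ω : PolyForms k (Option σ)}
    (h : contract (Pi.single none 1) ω = 0) : fibreIntegral k σ ω = 0 := by
  rw [fibreIntegral_eq, h, map_zero]

theorem contract_self (V : σ → MvPolynomial σ k) (ω : PolyForms k σ) :
    contract V (contract V ω) = 0 := by
  have : contract V ∘ₗ contract V = 0 := by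
    refine linearMap_ext (by simp [contract_one]) (fun i ω h => ?_) (fun i ω h => ?_)
    · simp only [LinearMap.comp_apply, LinearMap.zero_apply] at h ⊢
      simp only [contract_ofPoly_mul, h, mul_zero]
    · simp only [LinearMap.comp_apply, LinearMap.zero_apply] at h ⊢
      simp only [contract_dX_mul, contract_ofPoly_mul, h, mul_zero, map_sub, sub_zero, sub_self]
  exact LinearMap.congr_fun this ω

theorem contract_single (g : MvPolynomial (Option σ) k) (ω : PolyForms k (Option σ)) :
    contract (Pi.single none g) ω = ofPoly k g * contract (Pi.single none 1) ω := by
  rw [← contract_smul]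
  congr 2
  ext1 i
  rcases i with _ | i <;> simp

theorem fibreIntegral_contract_single (g : MvPolynomial (Option σ) k)
    (ω : PolyForms k (Option σ)) : fibreIntegral k σ (contract (Pi.single none g) ω) = 0 := by
  refine fibreIntegral_eq_zero ?_
  rw [contract_single g, contract_ofPoly_mul, contract_self, mul_zero]

theorem fibreEval_X_none_mul (c : k) (ω : PolyForms k (Option σ)) :
    fibreEval k σ c (ofPoly k (MvPolynomial.X none) * ω) = c • fibreEval k σ c ω := by
  have := fibreEval_pow (σ := σ) c 1
  rw [pow_one, pow_one] at this
  rw [map_mul, this, smul_mul_assoc, one_mul]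

theorem fibreEval_dX_none_mul (c : k) (ω : PolyForms k (Option σ)) :
    fibreEval k σ c (dX k none * ω) = 0 := by
  have := fibreEval_pow_dX (σ := σ) c 0
  rw [pow_zero, ofPoly_one, one_mul] at this
  rw [map_mul, this, zero_mul]

/-- The integral over `[0,1]` of the Lie derivative along `u ∂/∂u`. -/
theorem fibreIntegral_lie [CharZero k] (ω : PolyForms k (Option σ)) :
    fibreIntegral k σ (d k _ (contract (Pi.single none (MvPolynomial.X none)) ω) +
      contract (Pi.single none (MvPolynomial.X none)) (d k _ ω)) =
    fibreEval k σ 1 (contract (Pi.single none (MvPolynomial.X none)) ω) := by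
  have h := fibreIntegral_stokes (contract (Pi.single none (MvPolynomial.X none)) ω)
  rw [fibreIntegral_contract_single, map_zero, zero_add] at h
  rw [map_add, h, fibreIntegral_contract_single, add_zero, contract_single,
    fibreEval_X_none_mul 0, zero_smul, sub_zero]

theorem fibreIntegral_lie_add [CharZero k] (ω : PolyForms k (Option σ)) :
    fibreIntegral k σ (dX k none * (d k _ (contract (Pi.single none (MvPolynomial.X none)) ω) +
      contract (Pi.single none (MvPolynomial.X none)) (d k _ ω) + ω)) = fibreEval k σ 1 ω := by
  set E : PolyForms k (Option σ) →ₗ[k] PolyForms k (Option σ) :=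
    contract (Pi.single none (MvPolynomial.X none)) with hE
  have h1 : ∀ η, fibreIntegral k σ (dX k none * E η) =
      fibreIntegral k σ (ofPoly k (MvPolynomial.X none) * η) := by
    intro η
    have := fibreIntegral_contract_single (MvPolynomial.X none) (dX k none * η)
    rw [contract_dX_mul, map_sub, sub_eq_zero, Pi.single_eq_same] at this
    exact this.symm
  have h2 := fibreIntegral_stokes (dX k none * E ω)
  rw [fibreEval_dX_none_mul, fibreEval_dX_none_mul, sub_zero, h1, d_dX_mul, map_neg] at h2
  have h3 := fibreIntegral_stokes (ofPoly k (MvPolynomial.X none) * ω)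
  rw [fibreEval_X_none_mul, fibreEval_X_none_mul, one_smul, zero_smul, sub_zero, d_ofPoly_mul,
    d_X, map_add] at h3
  rw [mul_add, mul_add, map_add, map_add, h1, ← h3, ← add_neg_eq_zero.1 h2]
  abel

theorem contract_fibreIntegral (V : σ → MvPolynomial σ k) (ω : PolyForms k (Option σ)) :
    contract V (fibreIntegral k σ ω) = -fibreIntegral k σ (contract (fun j : Option σ =>
      j.elim 0 fun j => MvPolynomial.rename some (V j)) ω) := by
  have : contract V ∘ₗ fibreIntegral k σ = -(fibreIntegral k σ ∘ₗ contract (fun j : Option σ =>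
      j.elim 0 fun j => MvPolynomial.rename some (V j))) := by
    refine linearMap_ext_fibre (fun a => ?_) (fun a => ?_) (fun i ω h => ?_) (fun i ω h => ?_)
    · simp only [LinearMap.comp_apply, LinearMap.neg_apply, fibreIntegral_X_none_pow,
        contract_ofPoly, map_zero, neg_zero]
    · have h0 : contract (fun j : Option σ => j.elim 0 fun j => MvPolynomial.rename some (V j))
          (dX k none) = 0 := by
        rw [← mul_one (dX k none), contract_dX_mul, contract_one, mul_zero, Option.elim,
          ofPoly_zero, zero_mul, sub_zero]
      simp only [LinearMap.comp_apply, LinearMap.neg_apply, fibreIntegral_X_none_pow_mul_dX,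
        contract_ofPoly_mul, h0, map_smul, contract_one, mul_zero, map_zero, neg_zero, smul_zero]
    · simp only [LinearMap.comp_apply, LinearMap.neg_apply] at h ⊢
      rw [fibreIntegral_X_some_mul, contract_ofPoly_mul, contract_ofPoly_mul,
        fibreIntegral_X_some_mul, h, mul_neg']
    · simp only [LinearMap.comp_apply, LinearMap.neg_apply] at h ⊢
      rw [fibreIntegral_dX_some_mul, map_neg, contract_dX_mul, contract_dX_mul, map_sub,
        Option.elim, fibreIntegral_rename_mul, fibreIntegral_dX_some_mul, h, mul_neg']
  exact LinearMap.congr_fun this ω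

theorem fibreIntegral_mem_gr {p : ℕ} {ω : PolyForms k (Option σ)}
    (h : ω ∈ gr k (Option σ) (p + 1)) : fibreIntegral k σ ω ∈ gr k σ p := by
  have key : ∀ q, gr k (Option σ) q ≤ (gr k σ q).comap (coeffIntegral k σ) := by
    intro q
    refine gr_le fun f l hl => ?_
    rw [Submodule.mem_comap, coeffIntegral_tmul]
    refine tmul_mem_gr _ ?_
    have h1 := Submodule.mem_map_of_mem
      (f := (ExteriorAlgebra.map (LinearMap.funLeft k k (Option.some : σ → Option σ))).toLinearMap)
      hl
    rw [ExteriorAlgebra.exteriorPower, Submodule.map_pow] at h1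
    suffices h2 : (LinearMap.range (ExteriorAlgebra.ι k : (Option σ → k) →ₗ[k] _)).map
        (ExteriorAlgebra.map (LinearMap.funLeft k k (Option.some : σ → Option σ))).toLinearMap ≤
        LinearMap.range (ExteriorAlgebra.ι k : (σ → k) →ₗ[k] _) from
      pow_le_pow_left' h2 q h1
    rintro _ ⟨_, ⟨v, rfl⟩, rfl⟩
    exact ⟨_, (ExteriorAlgebra.map_apply_ι _ _).symm⟩
  rw [fibreIntegral_eq]
  exact key p (contract_mem_gr _ h)

theorem fibreIntegral_of_mem_gr_zero {ω : PolyForms k (Option σ)}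
    (h : ω ∈ gr k (Option σ) 0) : fibreIntegral k σ ω = 0 :=
  fibreIntegral_eq_zero (contract_of_mem_gr_zero _ h)

theorem eq_zero_of_ofPoly_mul {g : MvPolynomial σ k} (hg : g ≠ 0) {ω : PolyForms k σ}
    (h : ofPoly k g * ω = 0) : ω = 0 := by
  have hinj : Function.Injective (LinearMap.rTensor (ExteriorAlgebra k (σ → k))
      (LinearMap.mulLeft k g)) :=
    Module.Flat.rTensor_preserves_injective_linearMap _ (mul_right_injective₀ hg)
  have heq : ∀ ω : PolyForms k σ, LinearMap.rTensor (ExteriorAlgebra k (σ → k))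
      (LinearMap.mulLeft k g) ω = ofPoly k g * ω := by
    intro ω
    induction ω using TensorProduct.induction_on with
    | zero => simp
    | tmul a b => rw [ofPoly_mul_tmul, LinearMap.rTensor_tmul, LinearMap.mulLeft_apply]
    | add a b ha hb => rw [map_add, mul_add, ha, hb]
  exact hinj (by rw [heq, h, map_zero])

end PolyForms

namespace Sullivan

open PolyForms

variable {k : Type*} [Field k] {n : ℕ}

variable (k n) in
/-- The coordinates of the `i`-th vertex. -/
def vertex (i : Fin (n + 1)) : Fin n → MvPolynomial (Fin n) k := fun j => if j.succ = i then 1 else 0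

variable (k n) in
/-- The vector field `t - e_i`. -/
def radial (i : Fin (n + 1)) : Fin n → MvPolynomial (Fin n) k :=
  fun j => MvPolynomial.X j - vertex k n i j

variable (k n) in
/-- The contraction with the radial vector field of the `i`-th vertex. -/
def ctr (i : Fin (n + 1)) : Sullivan k n →ₗ[k] Sullivan k n := contract (radial k n i)

variable (k n) in
/-- The restriction to the `i`-th vertex, as a constant form. -/
def atVertex (i : Fin (n + 1)) : Sullivan k n →ₐ[k] Sullivan k n := pullback k (vertex k n i)

variable (k n) in
/-- The map `(u, t) ↦ u t + (1 - u) e_i`. -/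
def cone (i : Fin (n + 1)) : Fin n → MvPolynomial (Option (Fin n)) k :=
  fun j => MvPolynomial.X none * MvPolynomial.X (some j) +
        if j.succ = i then 1 - MvPolynomial.X none else 0

theorem vertexHomotopy_apply (i : Fin (n + 1)) (ω : Sullivan k n) :
    vertexHomotopy k n i ω = fibreIntegral k (Fin n) (pullback k (cone k n i) ω) := rfl

theorem fibreEval_cone_one (i : Fin (n + 1)) (ω : Sullivan k n) :
    fibreEval k (Fin n) 1 (pullback k (cone k n i) ω) = ω := by
  rw [fibreEval, pullback_pullback]
  conv_rhs => rw [← pullback_X ω]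
  congr 2
  ext1 j
  by_cases h : j.succ = i <;> simp [cone, h]

theorem fibreEval_cone_zero (i : Fin (n + 1)) (ω : Sullivan k n) :
    fibreEval k (Fin n) 0 (pullback k (cone k n i) ω) = atVertex k n i ω := by
  rw [fibreEval, pullback_pullback, atVertex]
  congr 2
  ext1 j
  by_cases h : j.succ = i <;> simp [cone, h, vertex]

theorem d_vertexHomotopy_add [CharZero k] (i : Fin (n + 1)) (ω : Sullivan k n) :
    d k _ (vertexHomotopy k n i ω) + vertexHomotopy k n i (d k _ ω) = ω - atVertex k n i ω := by
  rw [vertexHomotopy_apply, vertexHomotopy_apply, pullback_d, fibreIntegral_stokes,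
    fibreEval_cone_one, fibreEval_cone_zero]

theorem fieldDeriv_single (g : MvPolynomial (Option (Fin n)) k) (f : MvPolynomial (Option (Fin n)) k) :
    fieldDeriv (Pi.single none g) f = g * MvPolynomial.pderiv none f := by
  rw [fieldDeriv, Finset.sum_eq_single none]
  · simp
  · intro i _ h; simp [h]
  · simp

theorem pderiv_none_cone (i : Fin (n + 1)) (j : Fin n) :
    MvPolynomial.pderiv none (cone k n i j) =
      MvPolynomial.X (some j) - if j.succ = i then 1 else 0 := by
  by_cases h : j.succ = i <;>
  simp [cone, h, sub_eq_add_neg]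

theorem contract_cone (i : Fin (n + 1)) (ω : Sullivan k n) :
    contract (Pi.single none (MvPolynomial.X none)) (pullback k (cone k n i) ω) =
      pullback k (cone k n i) (ctr k n i ω) := by
  refine contract_pullback _ _ _ (fun j => ?_) ω
  rw [fieldDeriv_single, pderiv_none_cone]
  by_cases h : j.succ = i
  · simp [radial, vertex, h, cone]; ring
  · simp [radial, vertex, h, cone]

theorem contract_cone' (i : Fin (n + 1)) (ω : Sullivan k n) :
    contract (fun j : Option (Fin n) => j.elim 0 fun j => MvPolynomial.rename some
      (radial k n i j)) (pullback k (cone k n i) ω) =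
      pullback k (cone k n i) (ctr k n i ω) := by
  refine contract_pullback _ _ _ (fun j => ?_) ω
  rw [fieldDeriv, Fintype.sum_option, Finset.sum_eq_single j]
  · by_cases h : j.succ = i
    · simp [radial, vertex, h, cone]; ring
    · simp [radial, vertex, h, cone]; ring
  · intro l _ hl
    by_cases h : j.succ = i <;> simp [h, cone, hl.symm]
  · simp

theorem ctr_vertexHomotopy (i : Fin (n + 1)) (ω : Sullivan k n) :
    ctr k n i (vertexHomotopy k n i ω) = 0 := by
  rw [vertexHomotopy_apply, ctr, contract_fibreIntegral, contract_cone', ← contract_cone,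
    fibreIntegral_contract_single, neg_zero]

theorem atVertex_vertexHomotopy_eq (i j : Fin (n + 1)) (ω : Sullivan k n) :
    atVertex k n j (vertexHomotopy k n i ω) = fibreIntegral k (Fin n) (pullback k (fun l =>
      MvPolynomial.X none * (if l.succ = j then 1 else 0) +
        if l.succ = i then 1 - MvPolynomial.X none else 0) ω) := by
  rw [vertexHomotopy_apply, atVertex, pullback_fibreIntegral, pullback_pullback]
  congr 3
  ext1 l
  rw [cone, map_add, map_mul, MvPolynomial.aeval_X, MvPolynomial.aeval_X, Option.elim, Option.elim,
    vertex]
  congr 1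
  · split_ifs <;> simp
  · split_ifs <;> simp

theorem atVertex_vertexHomotopy_self (i : Fin (n + 1)) (ω : Sullivan k n) :
    atVertex k n i (vertexHomotopy k n i ω) = 0 := by
  rw [atVertex_vertexHomotopy_eq]
  refine fibreIntegral_eq_zero ?_
  rw [contract_pullback _ _ 0, contract_zero, LinearMap.zero_apply, map_zero]
  intro j
  rw [fieldDeriv_single]
  by_cases h : j.succ = i <;> simp [h]

theorem vertexHomotopy_atVertex (i j : Fin (n + 1)) (ω : Sullivan k n) :
    vertexHomotopy k n i (atVertex k n j ω) = 0 := by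
  rw [vertexHomotopy_apply, atVertex, pullback_pullback]
  refine fibreIntegral_eq_zero ?_
  rw [contract_pullback _ _ 0, contract_zero, LinearMap.zero_apply, map_zero]
  intro l
  rw [fieldDeriv_single]
  by_cases h : l.succ = j <;> simp [h, vertex]

theorem ctr_atVertex (i j : Fin (n + 1)) (ω : Sullivan k n) :
    ctr k n i (atVertex k n j ω) = 0 := by
  rw [ctr, atVertex, contract_pullback _ _ 0, contract_zero, LinearMap.zero_apply, map_zero]
  intro l
  by_cases h : l.succ = j <;> simp [h, vertex, fieldDeriv]

theorem atVertex_ctr (i : Fin (n + 1)) (ω : Sullivan k n) :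
    atVertex k n i (ctr k n i ω) = 0 := by
  rw [ctr, atVertex, ← contract_pullback _ 0, contract_zero, LinearMap.zero_apply]
  intro l
  by_cases h : l.succ = i <;> simp [h, vertex, fieldDeriv, radial]

theorem atVertex_d (i : Fin (n + 1)) (ω : Sullivan k n) :
    atVertex k n i (d k _ ω) = 0 := by
  have : (atVertex k n i).toLinearMap ∘ₗ d k (Fin n) = 0 := by
    have hv : ∀ j, d k (Fin n) (ofPoly k (vertex k n i j)) = 0 := by
      intro j
      by_cases h : j.succ = i <;> simp [vertex, h, ofPoly_one, ofPoly_zero, d_one]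
    refine linearMap_ext (by simp [d_one]) (fun i ω h => ?_) (fun i ω h => ?_)
    · simp only [LinearMap.comp_apply, LinearMap.zero_apply, AlgHom.toLinearMap_apply] at h ⊢
      rw [d_ofPoly_mul, map_add, map_mul, map_mul, h, d_X, atVertex, pullback_dX, hv]
      simp
    · simp only [LinearMap.comp_apply, LinearMap.zero_apply, AlgHom.toLinearMap_apply] at h ⊢
      rw [d_dX_mul, map_neg, map_mul, h, mul_zero, neg_zero]
  exact LinearMap.congr_fun this ω

theorem atVertex_atVertex (i j : Fin (n + 1)) (ω : Sullivan k n) :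
    atVertex k n i (atVertex k n j ω) = atVertex k n j ω := by
  rw [atVertex, atVertex, pullback_pullback]
  congr 2
  ext1 l
  by_cases h : l.succ = j <;> simp [h, vertex]

theorem atVertex_vertexHomotopy_of_ctr (i j : Fin (n + 1)) {ω : Sullivan k n}
    (h : ctr k n j ω = 0) : atVertex k n j (vertexHomotopy k n i ω) = 0 := by
  rw [atVertex_vertexHomotopy_eq]
  refine fibreIntegral_eq_zero ?_
  have hg : (MvPolynomial.X none - 1 : MvPolynomial (Option (Fin n)) k) ≠ 0 := by
    intro h
    have := congrArg (MvPolynomial.eval 0) h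
    simp at this
  refine eq_zero_of_ofPoly_mul hg ?_
  rw [← contract_single, contract_pullback _ _ (radial k n j)]
  · rw [← ctr, h, map_zero]
  · intro l
    rw [fieldDeriv_single]
    rw [radial, vertex, map_sub, MvPolynomial.aeval_X]
    split_ifs <;> simp

theorem vertexHomotopy_of_ctr (i : Fin (n + 1)) {ω : Sullivan k n}
    (h : ctr k n i ω = 0) : vertexHomotopy k n i ω = 0 := by
  rw [vertexHomotopy_apply]
  refine fibreIntegral_eq_zero (eq_zero_of_ofPoly_mul (MvPolynomial.X_ne_zero none) ?_)
  rw [← contract_single, contract_cone, h, map_zero]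

variable (k n) in
/-- The Lie derivative along the radial vector field of the `i`-th vertex. -/
def lie (i : Fin (n + 1)) : Sullivan k n →ₗ[k] Sullivan k n :=
  d k _ ∘ₗ ctr k n i + ctr k n i ∘ₗ d k _

theorem lie_apply (i : Fin (n + 1)) (ω : Sullivan k n) :
    lie k n i ω = d k _ (ctr k n i ω) + ctr k n i (d k _ ω) := rfl

theorem vertexHomotopy_lie [CharZero k] (i : Fin (n + 1)) (ω : Sullivan k n) :
    vertexHomotopy k n i (lie k n i ω) = ctr k n i ω := by
  rw [lie_apply, vertexHomotopy_apply, map_add (pullback k (cone k n i)), pullback_d,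
    ← contract_cone, ← contract_cone, pullback_d, fibreIntegral_lie, contract_cone,
    fibreEval_cone_one]

theorem eq_zero_of_lie_add [CharZero k] (i : Fin (n + 1)) {ω : Sullivan k n}
    (h : lie k n i ω + ω = 0) : ω = 0 := by
  have := fibreIntegral_lie_add (pullback k (cone k n i) ω)
  rw [fibreEval_cone_one, contract_cone, ← pullback_d, ← pullback_d, contract_cone, ← map_add,
    ← map_add, ← lie_apply, h, map_zero, mul_zero, map_zero] at this
  exact this.symm

theorem eq_zero_of_lie [CharZero k] (i : Fin (n + 1)) {ω : Sullivan k n}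
    (h : lie k n i ω = 0) (h' : atVertex k n i ω = 0) : ω = 0 := by
  have h1 : ctr k n i ω = 0 := by rw [← vertexHomotopy_lie, h, map_zero]
  have h2 : ctr k n i (d k _ ω) = 0 := by
    rw [lie_apply, h1, map_zero, zero_add] at h
    exact h
  have := d_vertexHomotopy_add i ω
  rw [h', vertexHomotopy_of_ctr i h1, vertexHomotopy_of_ctr i h2, map_zero, sub_zero,
    zero_add] at this
  exact this.symm

theorem lie_X_mul (i : Fin (n + 1)) (j : Fin n) (ω : Sullivan k n) :
    lie k n i (ofPoly k (MvPolynomial.X j) * ω) = ofPoly k (radial k n i j) * ω +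
      ofPoly k (MvPolynomial.X j) * lie k n i ω := by
  rw [lie_apply, lie_apply, ctr, contract_ofPoly_mul, d_ofPoly_mul, d_ofPoly_mul, d_X, map_add,
    contract_dX_mul, contract_ofPoly_mul, mul_add]
  abel

theorem d_radial (i : Fin (n + 1)) (j : Fin n) :
    d k _ (ofPoly k (radial k n i j)) = dX k j := by
  rw [radial, ofPoly_sub, map_sub, d_X, vertex]
  by_cases h : j.succ = i <;> simp [h, ofPoly_one, ofPoly_zero, d_one]

theorem lie_radial_mul (i j : Fin (n + 1)) (l : Fin n) (ω : Sullivan k n) :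
    lie k n i (ofPoly k (radial k n j l) * ω) = ofPoly k (radial k n i l) * ω +
      ofPoly k (radial k n j l) * lie k n i ω := by
  rw [lie_apply, lie_apply, ctr, contract_ofPoly_mul, d_ofPoly_mul, d_ofPoly_mul, d_radial, map_add,
    contract_dX_mul, contract_ofPoly_mul, mul_add]
  abel

theorem lie_dX_mul (i : Fin (n + 1)) (j : Fin n) (ω : Sullivan k n) :
    lie k n i (dX k j * ω) = dX k j * ω + dX k j * lie k n i ω := by
  rw [lie_apply, lie_apply, ctr, contract_dX_mul, d_dX_mul, map_sub, d_ofPoly_mul, d_radial,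
    map_neg, contract_dX_mul, d_dX_mul, mul_add]
  abel

theorem lie_ctr (i j : Fin (n + 1)) (ω : Sullivan k n) :
    lie k n i (ctr k n j ω) - ctr k n j (lie k n i ω) = ctr k n i ω - ctr k n j ω := by
  have : lie k n i ∘ₗ ctr k n j - ctr k n j ∘ₗ lie k n i = ctr k n i - ctr k n j := by
    refine linearMap_ext (by simp [lie_apply, ctr, contract_one, d_one]) (fun l ω h => ?_)
      (fun l ω h => ?_)
    · simp only [LinearMap.comp_apply, LinearMap.sub_apply] at h ⊢
      have e : ∀ i f (η : Sullivan k n), ctr k n i (ofPoly k f * η) = ofPoly k f * ctr k n i η :=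
        fun i f η => contract_ofPoly_mul _ _ _
      rw [lie_X_mul, e, map_add, e, e, lie_X_mul, e, ← mul_sub, ← h, mul_sub]
      abel
    · simp only [LinearMap.comp_apply, LinearMap.sub_apply] at h ⊢
      have e : ∀ i (η : Sullivan k n), ctr k n i (dX k l * η) =
          ofPoly k (radial k n i l) * η - dX k l * ctr k n i η := fun i η =>
        contract_dX_mul _ _ _
      rw [lie_dX_mul, map_add, e, e, e, map_sub, lie_radial_mul, lie_dX_mul]
      have h' : lie k n i (ctr k n j ω) = ctr k n j (lie k n i ω) + (ctr k n i ω - ctr k n j ω) := by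
        rw [← h]; abel
      rw [h', mul_add, mul_sub]
      abel
  exact LinearMap.congr_fun this ω

/-! ### Barycentric coordinates -/

variable (k n) in
/-- The barycentric coordinates, as forms. -/
def tForm (j : Fin (n + 1)) : Sullivan k n := ofPoly k (t k n j)

theorem fieldDeriv_radial_t (i j : Fin (n + 1)) :
    fieldDeriv (radial k n i) (t k n j) = t k n j - if i = j then 1 else 0 := by
  have hs : ∀ j : Fin n, fieldDeriv (radial k n i) (t k n j.succ) =
      t k n j.succ - if i = j.succ then 1 else 0 := by
    intro j
    rw [t, Fin.cons_succ, fieldDeriv_X, radial, vertex]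
    simp only [eq_comm]
  refine Fin.cases ?_ hs j
  have h0 : fieldDeriv (radial k n i) (t k n 0) = -∑ j, radial k n i j := by
    simp only [fieldDeriv, t, Fin.cons_zero, map_sub, map_sum]
    rw [← Finset.sum_neg_distrib]
    refine Finset.sum_congr rfl fun l _ => ?_
    rw [Finset.sum_eq_single l] <;> simp +contextual
  rw [h0]
  simp only [radial, vertex, t, Fin.cons_zero, Finset.sum_sub_distrib]
  refine Fin.cases ?_ (fun l => ?_) i
  · simp
  · simp [Fin.succ_ne_zero]

theorem sum_t : ∑ j, t k n j = 1 := by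
  rw [Fin.sum_univ_succ]
  simp [t]

theorem sum_tForm : ∑ j, tForm k n j = 1 := by
  rw [← ofPoly_one, ← sum_t, ofPoly_sum]
  rfl

theorem dt_eq (j : Fin (n + 1)) : dt k n j = d k _ (tForm k n j) := rfl

theorem sum_dt : ∑ j, dt k n j = 0 := by
  simp only [dt_eq]
  rw [← map_sum, sum_tForm, d_one]

theorem d_tForm_mul (j : Fin (n + 1)) (ω : Sullivan k n) :
    d k _ (tForm k n j * ω) = dt k n j * ω + tForm k n j * d k _ ω := d_ofPoly_mul _ _

theorem d_dt_mul (j : Fin (n + 1)) (ω : Sullivan k n) :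
    d k _ (dt k n j * ω) = -(dt k n j * d k _ ω) := d_d_ofPoly_mul _ _

theorem dt_mul_dt (i j : Fin (n + 1)) : dt k n i * dt k n j = -(dt k n j * dt k n i) :=
  d_ofPoly_anticomm _ _

theorem ctr_tForm_mul (i j : Fin (n + 1)) (ω : Sullivan k n) :
    ctr k n i (tForm k n j * ω) = tForm k n j * ctr k n i ω := contract_ofPoly_mul _ _ _

theorem ctr_dt_mul (i j : Fin (n + 1)) (ω : Sullivan k n) :
    ctr k n i (dt k n j * ω) =
      tForm k n j * ω - (if i = j then ω else 0) - dt k n j * ctr k n i ω := by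
  rw [ctr, dt, contract_d_ofPoly_mul, fieldDeriv_radial_t, ofPoly_sub, sub_mul, tForm]
  by_cases h : i = j <;> simp [h, ofPoly_one, ofPoly_zero]

theorem ctr_mul_X (j : Fin (n + 1)) (l : Fin n) (ω : Sullivan k n) :
    ctr k n j (dX k l * ω) =
          ofPoly k (radial k n j l) * ω - dX k l * ctr k n j ω := contract_dX_mul _ _ _

theorem sum_tForm_mul_ctr (ω : Sullivan k n) : ∑ j, tForm k n j * ctr k n j ω = 0 := by
  have : ∑ j, LinearMap.mulLeft k (tForm k n j) ∘ₗ ctr k n j = 0 := by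
    refine linearMap_ext (by simp [ctr, contract_one]) (fun l ω h => ?_) (fun l ω h => ?_)
    · simp only [LinearMap.sum_apply, LinearMap.comp_apply, LinearMap.zero_apply,
        LinearMap.mulLeft_apply] at h ⊢
      have : ∀ j, tForm k n j * ctr k n j (ofPoly k (MvPolynomial.X l) * ω) =
          ofPoly k (MvPolynomial.X l) * (tForm k n j * ctr k n j ω) := by
        intro j
        rw [ctr, contract_ofPoly_mul, ← mul_assoc, ← ofPoly_mul_comm, mul_assoc]
      rw [Finset.sum_congr rfl fun j _ => this j, ← Finset.mul_sum, h, mul_zero]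
    · simp only [LinearMap.sum_apply, LinearMap.comp_apply, LinearMap.zero_apply,
        LinearMap.mulLeft_apply] at h ⊢
      have : ∀ j, tForm k n j * ctr k n j (dX k l * ω) =
          ofPoly k (t k n j * radial k n j l) * ω - dX k l * (tForm k n j * ctr k n j ω) := by
        intro j
        rw [ctr_mul_X, mul_sub, ← mul_assoc, tForm, ← ofPoly_mul, ← mul_assoc, ofPoly_mul_comm _
          (dX k l), mul_assoc]
      rw [Finset.sum_congr rfl fun j _ => this j, Finset.sum_sub_distrib, ← Finset.mul_sum, h,
        mul_zero, sub_zero, ← Finset.sum_mul, ← ofPoly_sum]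
      have : ∑ j, t k n j * radial k n j l = 0 := by
        simp only [radial, mul_sub, Finset.sum_sub_distrib, ← Finset.sum_mul, sum_t, one_mul]
        simp [vertex, t]
      rw [this, ofPoly_zero, zero_mul]
  have h := LinearMap.congr_fun this ω
  simpa only [LinearMap.sum_apply, LinearMap.comp_apply, LinearMap.zero_apply,
        LinearMap.mulLeft_apply] using h

theorem vertexHomotopy_mem_gr {p : ℕ} (i : Fin (n + 1)) {ω : Sullivan k n}
    (h : ω ∈ gr k (Fin n) (p + 1)) : vertexHomotopy k n i ω ∈ gr k (Fin n) p := by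
  rw [vertexHomotopy_apply]
  exact fibreIntegral_mem_gr (pullback_mem_gr _ h)

theorem vertexHomotopy_of_mem_gr_zero (i : Fin (n + 1)) {ω : Sullivan k n}
    (h : ω ∈ gr k (Fin n) 0) : vertexHomotopy k n i ω = 0 := by
  rw [vertexHomotopy_apply]
  exact fibreIntegral_of_mem_gr_zero (pullback_mem_gr _ h)

/-- The homotopies lower the degree, so that a subspace with `(∀ j, h^j ω ∈ S) → ω ∈ S` is
everything. -/
theorem mem_of_vertexHomotopy_mem {S : Submodule k (Sullivan k n)}
    (h : ∀ ω, (∀ j, vertexHomotopy k n j ω ∈ S) → ω ∈ S) (ω : Sullivan k n) : ω ∈ S := by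
  refine gr_induction (fun p => ?_) ω
  induction p with
  | zero =>
    exact fun ω hω => h ω fun j => by
      rw [vertexHomotopy_of_mem_gr_zero j hω]
      exact S.zero_mem
  | succ p ih => exact fun ω hω => h ω fun j => ih (vertexHomotopy_mem_gr j hω)

end Sullivan

/-! ### Algebraic form of Dupont's contraction -/

theorem eq_zero_of_eq_neg (k : Type*) {Ω : Type*} [Field k] [CharZero k] [AddCommGroup Ω]
    [Module k Ω] {x : Ω} (h : x = -x) : x = 0 := by
  have h2 : (2 : k) • x = 0 := by
    rw [two_smul]
    nth_rewrite 1 [h]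
    exact neg_add_cancel x
  exact (smul_eq_zero.1 h2).resolve_left two_ne_zero

theorem sum_antisymm (k : Type*) {Ω J : Type*} [Field k] [CharZero k] [AddCommGroup Ω]
    [Module k Ω] [Fintype J] {f : J → J → Ω} (hf : ∀ i j, f i j = -f j i) : ∑ i, ∑ j, f i j = 0 := by
  refine eq_zero_of_eq_neg k ?_
  conv_lhs => rw [Finset.sum_comm]
  rw [← Finset.sum_neg_distrib]
  refine Finset.sum_congr rfl fun i _ => ?_
  rw [← Finset.sum_neg_distrib]
  exact Finset.sum_congr rfl fun j _ => hf j i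

/-- The Lie derivative `d c + c d` attached to a contraction `c`. -/
def cartan {k Ω : Type*} [Field k] [Ring Ω] [Algebra k Ω] (d c : Ω →ₗ[k] Ω) : Ω →ₗ[k] Ω :=
  d ∘ₗ c + c ∘ₗ d

/-- The algebraic properties of the forms on a simplex, the homotopies `h j` and the contractions
`ctr j` attached to its vertices, the restrictions `ε j` to the vertices, and the barycentric
coordinates `t j` with their differentials `s j`. -/
structure ConeSystem (k : Type*) {Ω J : Type*} [Field k] [Ring Ω] [Algebra k Ω] [Fintype J]
    [DecidableEq J] (d : Ω →ₗ[k] Ω) (h ctr ε : J → Ω →ₗ[k] Ω) (t s : J → Ω) : Prop where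
  d_one : d 1 = 0
  d_d : ∀ x, d (d x) = 0
  d_t_mul : ∀ j x, d (t j * x) = s j * x + t j * d x
  d_s_mul : ∀ j x, d (s j * x) = -(s j * d x)
  t_comm : ∀ j x, t j * x = x * t j
  s_anticomm : ∀ i j, s i * s j = -(s j * s i)
  sum_t : ∑ j, t j = 1
  sum_s : ∑ j, s j = 0
  d_h : ∀ j x, d (h j x) + h j (d x) = x - ε j x
  ctr_one : ∀ i, ctr i 1 = 0
  ctr_t_mul : ∀ i j x, ctr i (t j * x) = t j * ctr i x
  ctr_s_mul : ∀ i j x, ctr i (s j * x) = t j * x - (if i = j then x else 0) - s j * ctr i x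
  ctr_ctr : ∀ i j x, ctr i (ctr j x) = -ctr j (ctr i x)
  ctr_self : ∀ i x, ctr i (ctr i x) = 0
  ctr_h : ∀ i x, ctr i (h i x) = 0
  ctr_ε : ∀ i j x, ctr i (ε j x) = 0
  sum_t_ctr : ∀ x, ∑ j, t j * ctr j x = 0
  ε_h : ∀ i x, ε i (h i x) = 0
  h_ε : ∀ i j x, h i (ε j x) = 0
  ε_h_of_ctr : ∀ i j x, ctr j x = 0 → ε j (h i x) = 0
  h_of_ctr : ∀ i x, ctr i x = 0 → h i x = 0
  ε_ctr : ∀ i x, ε i (ctr i x) = 0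
  ε_d : ∀ i x, ε i (d x) = 0
  ε_ε : ∀ i j x, ε i (ε j x) = ε j x
  ε_t_mul : ∀ i j x, ε i (t j * x) = if i = j then ε i x else 0
  ε_s_mul : ∀ i j x, ε i (s j * x) = 0
  lie_ctr : ∀ i j x, cartan d (ctr i) (ctr j x) - ctr j (cartan d (ctr i) x) = ctr i x - ctr j x
  eq_zero_of_lie_add : ∀ i x, cartan d (ctr i) x + x = 0 → x = 0
  eq_zero_of_lie : ∀ i x, cartan d (ctr i) x = 0 → ε i x = 0 → x = 0
  mem_of_h_mem : ∀ S : Submodule k Ω, (∀ x, (∀ j, h j x ∈ S) → x ∈ S) → ∀ x, x ∈ S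

namespace ConeSystem

variable {k Ω J : Type*} [Field k] [CharZero k] [Ring Ω] [Algebra k Ω] [Fintype J]
  [DecidableEq J] {d : Ω →ₗ[k] Ω} {h ctr ε : J → Ω →ₗ[k] Ω} {t s : J → Ω}
  (D : ConeSystem k d h ctr ε t s)

include D

/-! #### The homotopies of the vertices -/

theorem lie_apply (i : J) (x : Ω) :
    cartan d (ctr i) x = d (ctr i x) + ctr i (d x) := rfl

theorem lie_h (i : J) (x : Ω) : cartan d (ctr i) (h i x) = ctr i x := by
  have e : d (h i x) = x - ε i x - h i (d x) := by rw [← D.d_h]; abel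
  rw [D.lie_apply, D.ctr_h, map_zero, zero_add, e, map_sub, map_sub, D.ctr_ε, D.ctr_h, sub_zero,
    sub_zero]

theorem h_self (i : J) (x : Ω) : h i (h i x) = 0 :=
  D.eq_zero_of_lie i _ (by rw [D.lie_h, D.ctr_h]) (D.ε_h _ _)

theorem ε_h_swap (i j : J) (x : Ω) : ε i (h j x) = -ε j (h i x) := by
  have q1 : ∀ y, ε i (h j (h j y)) + ε j (h i (h j y)) = 0 := fun y => by
    rw [D.h_self, map_zero, zero_add, D.ε_h_of_ctr i j _ (D.ctr_h _ _)]
  have q2 : ∀ y, ε i (h j (d y)) + ε j (h i (d y)) = 0 := fun y => by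
    have e : ∀ j, h j (d y) = y - ε j y - d (h j y) := fun j => by rw [← D.d_h]; abel
    rw [e, e, map_sub, map_sub, map_sub, map_sub, D.ε_d, D.ε_d, D.ε_ε, D.ε_ε]
    abel
  have q3 : ∀ y, ε i (h j (ε j y)) + ε j (h i (ε j y)) = 0 := fun y => by
    rw [D.h_ε, D.h_ε, map_zero, map_zero, add_zero]
  have e : x = d (h j x) + h j (d x) + ε j x := by rw [D.d_h]; abel
  rw [← add_eq_zero_iff_eq_neg]
  calc ε i (h j x) + ε j (h i x)
      = (ε i (h j (d (h j x))) + ε j (h i (d (h j x)))) +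
        (ε i (h j (h j (d x))) + ε j (h i (h j (d x)))) +
        (ε i (h j (ε j x)) + ε j (h i (ε j x))) := by
        conv_lhs => rw [e]
        simp only [map_add]
        abel
    _ = 0 := by rw [q1, q2, q3, add_zero, add_zero]

theorem lie_add_ctr_h (i j : J) (x : Ω) :
    cartan d (ctr j) (ctr i (h j x)) + ctr i (h j x) = ctr i (ctr j x) := by
  have := D.lie_ctr j i (h j x)
  rw [D.lie_h, D.ctr_h, zero_sub, sub_eq_iff_eq_add] at this
  rw [this]
  abel

theorem lie_d (i : J) (x : Ω) : cartan d (ctr i) (d x) = d (cartan d (ctr i) x) := by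
  rw [D.lie_apply, D.lie_apply, D.d_d, map_zero, map_add, D.d_d, add_zero, zero_add]

/-- The Lie derivatives of two radial vector fields satisfy `[L_i, L_j] = L_i - L_j`. -/
theorem lie_lie (i j : J) (x : Ω) :
    cartan d (ctr i) (cartan d (ctr j) x) + cartan d (ctr j) x =
      cartan d (ctr j) (cartan d (ctr i) x) + cartan d (ctr i) x := by
  have h1 := D.lie_ctr i j (d x)
  have h2 := congrArg d (D.lie_ctr i j x)
  rw [map_sub, map_sub, ← D.lie_d] at h2
  rw [D.lie_d] at h1
  have e1 : cartan d (ctr i) (cartan d (ctr j) x) =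
      cartan d (ctr i) (d (ctr j x)) + cartan d (ctr i) (ctr j (d x)) := by
    rw [D.lie_apply j, map_add]
  have e2 : cartan d (ctr j) (cartan d (ctr i) x) =
      d (ctr j (cartan d (ctr i) x)) + ctr j (d (cartan d (ctr i) x)) := D.lie_apply j _
  rw [e1, e2, sub_eq_iff_eq_add.1 h1, sub_eq_iff_eq_add.1 h2, D.lie_apply j, D.lie_apply i x]
  abel

theorem h_swap (i j : J) (x : Ω) : h i (h j x) = -h j (h i x) := by
  rw [← add_eq_zero_iff_eq_neg]
  have e1 : cartan d (ctr j) (cartan d (ctr i) (h i (h j x))) + cartan d (ctr i) (h i (h j x)) =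
      ctr i (ctr j x) := by rw [D.lie_h, D.lie_add_ctr_h]
  have e2 : cartan d (ctr j) (cartan d (ctr i) (h j (h i x))) + cartan d (ctr i) (h j (h i x)) =
      ctr j (ctr i x) := by rw [← D.lie_lie, D.lie_h, D.lie_add_ctr_h]
  refine D.eq_zero_of_lie i _ (D.eq_zero_of_lie_add j _ ?_) ?_
  · rw [map_add, map_add, add_add_add_comm, e1, e2, D.ctr_ctr, neg_add_cancel]
  · rw [map_add, D.ε_h, D.ε_h_swap, D.h_self, map_zero, neg_zero, add_zero]

/-! #### The homotopy -/

variable {H P : Ω →ₗ[k] Ω}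

theorem lie_t_mul (i j : J) (x : Ω) : cartan d (ctr i) (t j * x) =
    t j * x - (if i = j then x else 0) + t j * cartan d (ctr i) x := by
  rw [D.lie_apply, D.lie_apply, D.ctr_t_mul, D.d_t_mul, D.d_t_mul, map_add, D.ctr_s_mul,
    D.ctr_t_mul, mul_add]
  abel

theorem lie_s_mul (i j : J) (x : Ω) : cartan d (ctr i) (s j * x) =
    s j * x + s j * cartan d (ctr i) x := by
  rw [D.lie_apply, D.lie_apply, D.ctr_s_mul, D.d_s_mul, map_sub, map_sub, D.d_t_mul, D.d_s_mul,
    map_neg, D.ctr_s_mul, mul_add]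
  by_cases h : i = j <;> simp only [h, if_true, if_false, map_zero] <;> abel

theorem t_mul_t_mul (i j : J) (x : Ω) : t i * (t j * x) = t j * (t i * x) := by
  rw [← mul_assoc, D.t_comm i, mul_assoc]

theorem t_mul_s_mul (i j : J) (x : Ω) : t i * (s j * x) = s j * (t i * x) := by
  rw [← mul_assoc, D.t_comm i, mul_assoc]

section Homotopy

variable (HF : ∀ x, H x = ∑ j, (t j * h j x + s j * H (h j x)))
  (PF : ∀ x, P x = ∑ j, (t j * ε j x - s j * P (h j x)))

include HF in
theorem homotopy_ε (j : J) (x : Ω) : H (ε j x) = 0 := by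
  rw [HF]
  exact Finset.sum_eq_zero fun i _ => by rw [D.h_ε, map_zero, mul_zero, mul_zero, add_zero]

include HF PF in
/-- Dupont's homotopy formula `1 - P = d H + H d`. -/
theorem d_homotopy_add (x : Ω) : d (H x) + H (d x) = x - P x := by
  have key : ∀ x, x ∈ LinearMap.ker (d ∘ₗ H + H ∘ₗ d - (LinearMap.id - P)) := by
    refine D.mem_of_h_mem _ fun x hx => ?_
    simp only [LinearMap.mem_ker, LinearMap.sub_apply, LinearMap.add_apply, LinearMap.comp_apply,
      LinearMap.id_apply, sub_eq_zero] at hx ⊢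
    have e1 : ∀ j, d (H (h j x)) = h j x - P (h j x) - H (d (h j x)) := fun j => by
      rw [← hx]; abel
    have e2 : ∀ j, h j (d x) = x - ε j x - d (h j x) := fun j => by rw [← D.d_h]; abel
    have hs : ∑ j, s j * H x = 0 := by rw [← Finset.sum_mul, D.sum_s, zero_mul]
    have ht : ∑ j, t j * x = x := by rw [← Finset.sum_mul, D.sum_t, one_mul]
    calc d (H x) + H (d x)
        = ∑ j, ((t j * x + s j * H x) - (t j * ε j x - s j * P (h j x))) := by
          conv_lhs => rw [HF x, HF (d x), map_sum, ← Finset.sum_add_distrib]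
          refine Finset.sum_congr rfl fun j _ => ?_
          rw [map_add, D.d_t_mul, D.d_s_mul, e1, e2]
          simp only [mul_sub, map_sub, D.homotopy_ε HF, mul_zero]
          abel
      _ = x - P x := by
          rw [Finset.sum_sub_distrib, Finset.sum_add_distrib, ← PF, hs, ht, add_zero]
  have := key x
  simpa only [LinearMap.mem_ker, LinearMap.sub_apply, LinearMap.add_apply, LinearMap.comp_apply,
      LinearMap.id_apply, sub_eq_zero] using this

include HF in
theorem sum_t_homotopy_h (x : Ω) : ∑ j, t j * H (h j x) = 0 := by
  have key : ∀ x, x ∈ LinearMap.ker (∑ j, LinearMap.mulLeft k (t j) ∘ₗ H ∘ₗ h j) := by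
    refine D.mem_of_h_mem _ fun x hx => ?_
    simp only [LinearMap.mem_ker, LinearMap.sum_apply, LinearMap.comp_apply,
      LinearMap.mulLeft_apply] at hx ⊢
    have h1 : ∑ j, ∑ i, t j * (t i * h i (h j x)) = 0 :=
      sum_antisymm k fun i j => by rw [D.h_swap, mul_neg, mul_neg, D.t_mul_t_mul]
    have h2 : ∑ j, ∑ i, t j * (s i * H (h i (h j x))) = 0 := by
      rw [Finset.sum_comm]
      refine Finset.sum_eq_zero fun i _ => ?_
      have : ∑ j, t j * H (h i (h j x)) = 0 := by
        rw [← neg_eq_zero, ← hx i, ← Finset.sum_neg_distrib]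
        exact Finset.sum_congr rfl fun j _ => by rw [D.h_swap, map_neg, mul_neg, neg_neg]
      rw [← mul_zero (s i), ← this, Finset.mul_sum]
      exact Finset.sum_congr rfl fun j _ => D.t_mul_s_mul _ _ _
    calc ∑ j, t j * H (h j x)
        = ∑ j, ∑ i, t j * (t i * h i (h j x)) + ∑ j, ∑ i, t j * (s i * H (h i (h j x))) := by
          rw [← Finset.sum_add_distrib]
          refine Finset.sum_congr rfl fun j _ => ?_
          rw [HF, Finset.mul_sum, ← Finset.sum_add_distrib]
          simp only [mul_add]
      _ = 0 := by rw [h1, h2, add_zero]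
  have := key x
  simpa only [LinearMap.mem_ker, LinearMap.sum_apply, LinearMap.comp_apply,
      LinearMap.mulLeft_apply] using this

include HF in
theorem h_homotopy (i : J) (x : Ω) : h i (H x) = -H (h i x) := by
  have key : ∀ x, x ∈ LinearMap.ker (h i ∘ₗ H + H ∘ₗ h i) := by
    refine D.mem_of_h_mem _ fun x hx => ?_
    simp only [LinearMap.mem_ker, LinearMap.add_apply, LinearMap.comp_apply] at hx ⊢
    refine D.eq_zero_of_lie i _ ?_ ?_
    · have e1 : ctr i (H x) = ∑ j, (t j * ctr i (h j x) - s j * ctr i (H (h j x))) - H (h i x) := by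
        have : ∀ j, ctr i (t j * h j x + s j * H (h j x)) =
            (t j * ctr i (h j x) - s j * ctr i (H (h j x))) + t j * H (h j x) -
              (if i = j then H (h j x) else 0) := fun j => by
          rw [map_add, D.ctr_t_mul, D.ctr_s_mul]; abel
        rw [HF x, map_sum, Finset.sum_congr rfl fun j _ => this j, Finset.sum_sub_distrib,
          Finset.sum_add_distrib, D.sum_t_homotopy_h HF, add_zero, Finset.sum_ite_eq,
          if_pos (Finset.mem_univ i)]
      have e2 : cartan d (ctr i) (H (h i x)) =
          H (h i x) - ∑ j, (t j * ctr i (h j x) - s j * ctr i (H (h j x))) := by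
        have : ∀ j, cartan d (ctr i) (t j * h j (h i x) + s j * H (h j (h i x))) =
            (t j * h j (h i x) + s j * H (h j (h i x))) - (if i = j then h j (h i x) else 0) -
              (t j * ctr i (h j x) - s j * ctr i (H (h j x))) := fun j => by
          have hH : cartan d (ctr i) (H (h j (h i x))) = ctr i (H (h j x)) := by
            rw [D.h_swap j i, map_neg, neg_eq_iff_add_eq_zero.2 (by rw [add_comm]; exact hx j),
              D.lie_h]
          have hh : cartan d (ctr i) (h j (h i x)) = -ctr i (h j x) := by
            rw [D.h_swap j i, map_neg, D.lie_h]
          rw [map_add, D.lie_t_mul, D.lie_s_mul, hH, hh, mul_neg]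
          abel
        rw [HF (h i x), map_sum, Finset.sum_congr rfl fun j _ => this j, Finset.sum_sub_distrib,
          Finset.sum_sub_distrib, Finset.sum_ite_eq, if_pos (Finset.mem_univ i), D.h_self,
          sub_zero]
      rw [map_add, D.lie_h, e1, e2]
      abel
    · rw [map_add, D.ε_h, zero_add, HF, map_sum]
      refine Finset.sum_eq_zero fun j _ => ?_
      rw [map_add, D.ε_t_mul, D.ε_s_mul, add_zero]
      by_cases h : i = j
      · rw [if_pos h, ← h, D.ε_h]
      · rw [if_neg h]
  have := key x
  simpa only [LinearMap.mem_ker, LinearMap.add_apply, LinearMap.comp_apply,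
    add_eq_zero_iff_eq_neg] using this

include HF in
theorem homotopy_homotopy (x : Ω) : H (H x) = 0 := by
  have key : ∀ x, x ∈ LinearMap.ker (H ∘ₗ H) := by
    refine D.mem_of_h_mem _ fun x hx => ?_
    simp only [LinearMap.mem_ker, LinearMap.comp_apply] at hx ⊢
    rw [HF (H x), ← neg_eq_zero, ← D.sum_t_homotopy_h HF x, ← Finset.sum_neg_distrib]
    refine Finset.sum_congr rfl fun j _ => ?_
    rw [D.h_homotopy HF, map_neg, hx, neg_zero, mul_zero, add_zero, mul_neg, neg_neg]
  exact key x

end Homotopy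

end ConeSystem

/-! ### Whitney forms -/

namespace ConeSystem

section Whitney

variable {k Ω J : Type*} [Field k] [Ring Ω] [Algebra k Ω]

/-- The product `s_{a_1} ⋯ s_{a_m}`. -/
def sProd (s : J → Ω) (l : List J) : Ω := (l.map s).prod

/-- The Whitney form `∑_j (-1)^j t_{a_j} s_{a_0} ⋯ (omit s_{a_j}) ⋯ s_{a_m}`. -/
def whitney (t s : J → Ω) : List J → Ω
  | [] => 0
  | a :: l => t a * sProd s l - s a * whitney t s l

/-- The composition `g a_m ∘ h a_{m-1} ∘ ⋯ ∘ h a_0`. -/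
def chain (g h : J → Ω →ₗ[k] Ω) : List J → Ω →ₗ[k] Ω
  | [] => 0
  | [a] => g a
  | a :: b :: l => chain g h (b :: l) ∘ₗ h a

@[simp] theorem sProd_nil (s : J → Ω) : sProd s [] = 1 := rfl

@[simp] theorem sProd_cons (s : J → Ω) (a : J) (l : List J) :
    sProd s (a :: l) = s a * sProd s l := rfl

@[simp] theorem whitney_nil (t s : J → Ω) : whitney t s [] = 0 := rfl

theorem whitney_cons (t s : J → Ω) (a : J) (l : List J) :
    whitney t s (a :: l) = t a * sProd s l - s a * whitney t s l := rfl

theorem chain_cons (g h : J → Ω →ₗ[k] Ω) (a : J) {l : List J} (hl : l ≠ []) :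
    chain g h (a :: l) = chain g h l ∘ₗ h a := by
  cases l with
  | nil => exact absurd rfl hl
  | cons b l => rfl

variable [CharZero k] [Fintype J] [DecidableEq J] {d : Ω →ₗ[k] Ω}
  {h ctr ε : J → Ω →ₗ[k] Ω} {t s : J → Ω} (D : ConeSystem k d h ctr ε t s)

include D

theorem d_sProd (l : List J) : d (sProd s l) = 0 := by
  induction l with
  | nil => exact D.d_one
  | cons a l ih => rw [sProd_cons, D.d_s_mul, ih, mul_zero, neg_zero]

theorem d_whitney (l : List J) : d (whitney t s l) = l.length • sProd s l := by
  induction l with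
  | nil => simp
  | cons a l ih =>
    rw [whitney_cons, map_sub, D.d_t_mul, D.d_s_mul, D.d_sProd, ih, mul_zero, add_zero,
      sub_neg_eq_add, mul_smul_comm , sProd_cons, List.length_cons, succ_nsmul, add_comm]

theorem lie_whitney (j : J) (l : List J) :
    cartan d (ctr j) (whitney t s l) + whitney t s l =
      l.length • whitney t s l + ctr j (sProd s l) := by
  induction l with
  | nil => simp [D.ctr_one]
  | cons a l ih =>
    have h1 : cartan d (ctr j) (sProd s l) = l.length • sProd s l := by
      clear ih
      induction l with
      | nil => rw [sProd_nil, D.lie_apply, D.ctr_one, D.d_one]; simp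
      | cons a l ih =>
        rw [sProd_cons, D.lie_s_mul, ih, List.length_cons, succ_nsmul, mul_smul_comm]
        abel
    rw [← eq_sub_iff_add_eq] at ih
    rw [whitney_cons, map_sub, D.lie_t_mul, D.lie_s_mul, h1, ih, sProd_cons, D.ctr_s_mul,
      List.length_cons, succ_nsmul, smul_sub, mul_sub, mul_add, mul_smul_comm,
      mul_smul_comm]
    abel

theorem h_whitney (j : J) (l : List J) :
    l.length • h j (whitney t s l) = h j (whitney t s l) + ctr j (whitney t s l) := by
  have e : cartan d (ctr j) (ctr j (whitney t s l)) =
      l.length • ctr j (whitney t s l) - ctr j (whitney t s l) := by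
    have h1 := D.lie_ctr j j (whitney t s l)
    rw [sub_self, sub_eq_zero] at h1
    rw [h1, eq_sub_of_add_eq (D.lie_whitney j l), map_sub, map_add, D.ctr_self, map_nsmul, add_zero]
  rw [← sub_eq_zero]
  refine D.eq_zero_of_lie j _ ?_ ?_
  · rw [map_sub, map_nsmul, map_add, D.lie_h, e]
    abel
  · rw [map_sub, map_nsmul, map_add, D.ε_h, D.ε_ctr]
    simp

/-- The contractions of `sProd s l` and of `whitney t s l` are the boundary of `l`. -/
theorem ctr_whitney_mem (j : J) (l : List J) :
    (whitney t s l - ctr j (sProd s l), ctr j (whitney t s l)) ∈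
      Submodule.span k {p : Ω × Ω | ∃ w : List J, w.length + 1 = l.length ∧
        p = (sProd s w, whitney t s w)} := by
  induction l with
  | nil => simp [D.ctr_one]
  | cons a l ih =>
    set S := Submodule.span k {p : Ω × Ω | ∃ w : List J, w.length + 1 = (a :: l).length ∧
        p = (sProd s w, whitney t s w)} with hS
    have hΦ : ∀ p ∈ Submodule.span k {p : Ω × Ω | ∃ w : List J, w.length + 1 = l.length ∧
        p = (sProd s w, whitney t s w)}, (s a * p.1, t a * p.1 - s a * p.2) ∈ S := by
      intro p hp
      induction hp using Submodule.span_induction with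
      | mem p hp =>
        obtain ⟨w, hw, rfl⟩ := hp
        exact Submodule.subset_span ⟨a :: w, by simp [hw], rfl⟩
      | zero =>
        convert zero_mem S using 1
        simp
      | add x y _ _ hx hy =>
        convert add_mem hx hy using 1
        simp only [Prod.fst_add, Prod.snd_add, mul_add, Prod.mk_add_mk]
        congr 1
        abel
      | smul c x _ hx =>
        convert S.smul_mem c hx using 1
        simp [smul_sub]
    have h1 := hΦ _ ih
    have h2 : (if j = a then (sProd s l, whitney t s l) else (0 : Ω × Ω)) ∈ S := by
      split_ifs
      · exact Submodule.subset_span ⟨l, by simp, rfl⟩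
      · exact zero_mem _
    convert sub_mem h2 h1 using 1
    rw [whitney_cons, sProd_cons, D.ctr_s_mul, map_sub, D.ctr_t_mul, D.ctr_s_mul]
    by_cases hj : j = a
    · simp only [if_pos hj, Prod.mk_sub_mk, mul_sub]
      congr 1 <;> abel
    · simp only [if_neg hj, mul_sub]
      rw [← Prod.mk_zero_zero, Prod.mk_sub_mk]
      congr 1 <;> abel

section Homotopy

variable {H P : Ω →ₗ[k] Ω} (HF : ∀ x, H x = ∑ j, (t j * h j x + s j * H (h j x)))

include HF in
theorem homotopy_whitney (l : List J) : H (whitney t s l) = 0 := by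
  induction hm : l.length generalizing l with
  | zero => rw [List.length_eq_zero_iff.1 hm, whitney_nil, map_zero]
  | succ m ih =>
    have hc : ∀ j, H (ctr j (whitney t s l)) = 0 := fun j => by
      have : ∀ p ∈ Submodule.span k {p : Ω × Ω | ∃ w : List J, w.length + 1 = l.length ∧
          p = (sProd s w, whitney t s w)}, H p.2 = 0 := by
        intro p hp
        induction hp using Submodule.span_induction with
        | mem p hp =>
          obtain ⟨w, hw, rfl⟩ := hp
          exact ih w (by omega)
        | zero => simp
        | add x y _ _ hx hy => rw [Prod.snd_add, map_add, hx, hy, add_zero]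
        | smul c x _ hx => rw [Prod.smul_snd, map_smul, hx, smul_zero]
      exact this _ (D.ctr_whitney_mem j l)
    rcases Nat.eq_zero_or_pos m with rfl | hpos
    · obtain ⟨a, rfl⟩ := List.length_eq_one_iff.1 hm
      rw [HF]
      refine Finset.sum_eq_zero fun j _ => ?_
      rw [D.h_of_ctr j, map_zero, mul_zero, mul_zero, add_zero]
      rw [whitney_cons, whitney_nil, mul_zero, sub_zero, D.ctr_t_mul, sProd_nil, D.ctr_one,
        mul_zero]
    · have e : ∀ j, m • h j (whitney t s l) = ctr j (whitney t s l) := fun j => by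
        have := D.h_whitney j l
        rw [hm, succ_nsmul, add_comm (h j _)] at this
        exact add_right_cancel this
      have : m • H (whitney t s l) = 0 := by
        rw [HF, Finset.smul_sum, ← D.sum_t_ctr (whitney t s l)]
        refine Finset.sum_congr rfl fun j _ => ?_
        rw [smul_add, ← mul_smul_comm, ← mul_smul_comm, ← map_nsmul H, e, hc, mul_zero, add_zero]
      rw [← Nat.cast_smul_eq_nsmul k] at this
      exact (smul_eq_zero.1 this).resolve_left (Nat.cast_ne_zero.2 (by omega))

theorem sum_whitney_cons (l : List J) : ∑ i, whitney t s (i :: l) = sProd s l := by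
  simp only [whitney_cons, Finset.sum_sub_distrib, ← Finset.sum_mul, D.sum_t, D.sum_s, one_mul,
    zero_mul, sub_zero]

variable (PF : ∀ x, P x = ∑ j, (t j * ε j x - s j * P (h j x)))

include HF PF in
theorem projection_whitney (l : List J) : P (whitney t s l) = whitney t s l := by
  have := D.d_homotopy_add HF PF (whitney t s l)
  have h2 : H (sProd s l) = 0 := by
    rw [← D.sum_whitney_cons, map_sum]
    exact Finset.sum_eq_zero fun i _ => D.homotopy_whitney HF _
  rw [D.homotopy_whitney HF, D.d_whitney, map_nsmul, h2, map_zero, smul_zero, add_zero] at this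
  exact (sub_eq_zero.1 this.symm).symm

include HF PF in
theorem projection_d_whitney (l : List J) : P (d (whitney t s l)) = d (whitney t s l) := by
  rw [D.d_whitney, map_nsmul, ← D.sum_whitney_cons, map_sum]
  simp only [D.projection_whitney HF PF]

end Homotopy

/-! #### Symmetrization -/

theorem whitney_swap (a b : J) (l : List J) :
    whitney t s (b :: a :: l) = -whitney t s (a :: b :: l) := by
  have e : ∀ a b x, s a * (t b * x) = t b * (s a * x) := fun a b x => (D.t_mul_s_mul b a x).symm
  have e2 : s b * (s a * whitney t s l) = -(s a * (s b * whitney t s l)) := by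
    rw [← mul_assoc, D.s_anticomm, neg_mul, mul_assoc]
  rw [whitney_cons, whitney_cons, whitney_cons, whitney_cons, sProd_cons, sProd_cons, mul_sub,
    mul_sub, e, e, e2]
  abel

theorem exists_sign_of_perm {g : J → Ω →ₗ[k] Ω} (hg : ∀ a b x, g b (h a x) = -g a (h b x))
    {l l' : List J} (hl : l.Perm l') : ∃ c : ℤ, c * c = 1 ∧ sProd s l' = c • sProd s l ∧
      whitney t s l' = c • whitney t s l ∧ ∀ x, chain g h l' x = c • chain g h l x := by
  induction hl with
  | nil => exact ⟨1, by simp⟩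
  | @cons a l l' hl ih =>
    obtain ⟨c, hc, h1, h2, h3⟩ := ih
    refine ⟨c, hc, ?_, ?_, fun x => ?_⟩
    · rw [sProd_cons, sProd_cons, h1, mul_smul_comm]
    · rw [whitney_cons, whitney_cons, h1, h2, mul_smul_comm, mul_smul_comm, smul_sub]
    · by_cases hn : l = []
      · subst hn
        rw [List.nil_perm.1 hl] at h1 ⊢
        rcases Int.isUnit_iff.1 (IsUnit.of_mul_eq_one c hc) with rfl | rfl
        · rw [one_smul]
        · have h0 : (1 : Ω) = 0 := by
            refine eq_zero_of_eq_neg k ?_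
            simpa using h1
          have : ∀ y : Ω, y = 0 := fun y => by rw [← one_mul y, h0, zero_mul]
          rw [this (chain g h [a] x), smul_zero]
      · have hn' : l' ≠ [] := fun h0 => hn (List.perm_nil.1 (h0 ▸ hl))
        rw [chain_cons g h a hn, chain_cons g h a hn']
        exact h3 _
  | swap a b l =>
    refine ⟨-1, by norm_num, ?_, ?_, fun x => ?_⟩
    · rw [sProd_cons, sProd_cons, sProd_cons, sProd_cons, ← mul_assoc, D.s_anticomm, neg_mul,
        mul_assoc, neg_smul, one_smul]
    · rw [D.whitney_swap, neg_smul, one_smul]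
    · rw [neg_smul, one_smul]
      cases l with
      | nil => exact hg _ _ _
      | cons e l =>
        change chain g h (e :: l) (h b (h a x)) = -chain g h (e :: l) (h a (h b x))
        rw [D.h_swap, map_neg]
  | trans _ _ ih1 ih2 =>
    obtain ⟨c, hc, h1, h2, h3⟩ := ih1
    obtain ⟨c', hc', h1', h2', h3'⟩ := ih2
    refine ⟨c' * c, ?_, ?_, ?_, fun x => ?_⟩
    · rw [mul_mul_mul_comm, hc, hc', one_mul]
    · rw [h1', h1, smul_smul]
    · rw [h2', h2, smul_smul]
    · rw [h3', h3, smul_smul]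

theorem whitney_mul_chain_perm {g : J → Ω →ₗ[k] Ω} (hg : ∀ a b x, g b (h a x) = -g a (h b x))
    {l l' : List J} (hl : l.Perm l') (x : Ω) :
    whitney t s l' * chain g h l' x = whitney t s l * chain g h l x := by
  obtain ⟨c, hc, -, h2, h3⟩ := D.exists_sign_of_perm hg hl
  rw [h2, h3, smul_mul_smul_comm, hc, one_smul]

theorem whitney_of_not_nodup {l : List J} (hl : ¬l.Nodup) : whitney t s l = 0 := by
  obtain ⟨a, ha⟩ := List.exists_duplicate_iff_not_nodup.2 hl
  obtain ⟨w, hw⟩ := (List.duplicate_iff_sublist.1 ha).exists_perm_append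
  obtain ⟨c, -, -, h2, -⟩ := D.exists_sign_of_perm (g := h) (fun a b x => D.h_swap _ _ _) hw.symm
  rw [h2]
  have : whitney t s (a :: a :: w) = 0 := eq_zero_of_eq_neg k (D.whitney_swap a a w)
  exact (congrArg _ this).trans (smul_zero _)

end Whitney

theorem sum_ofFn_succ {J M : Type*} [Fintype J] [AddCommMonoid M] (m : ℕ) (F : List J → M) :
    ∑ v : Fin (m + 1) → J, F (List.ofFn v) = ∑ a, ∑ w : Fin m → J, F (a :: List.ofFn w) := by
  rw [← Fintype.sum_prod_type', ← (Fin.consEquiv fun _ : Fin (m + 1) => J).sum_comp]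
  refine Finset.sum_congr rfl fun p _ => ?_
  simp [Fin.consEquiv, List.ofFn_succ]

theorem sum_ofFn_eq_factorial_smul {J M : Type*} [Fintype J] [LinearOrder J] [AddCommMonoid M]
    (m : ℕ) (F : List J → M) (hF : ∀ l l', l.Perm l' → F l' = F l)
    (h0 : ∀ l, ¬l.Nodup → F l = 0) :
    ∑ v : Fin m → J, F (List.ofFn v) = m.factorial • ∑ I : Fin m ↪o J, F (List.ofFn I) := by
  classical
  have e : ∑ v : Fin m → J, F (List.ofFn v) =
      ∑ p : (Fin m ↪o J) × Equiv.Perm (Fin m), F (List.ofFn (p.1 ∘ p.2)) := by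
    symm
    refine Finset.sum_of_injOn (fun p => p.1 ∘ p.2) ?_ (by simp) ?_ fun _ _ => rfl
    · rintro ⟨I, σ⟩ - ⟨I', σ'⟩ - hp
      change (I : Fin m → J) ∘ σ = I' ∘ σ' at hp
      have hI : I = I' := by
        refine OrderEmbedding.range_inj.1 ?_
        rw [← σ.surjective.range_comp I, hp, σ'.surjective.range_comp]
      subst hI
      have hσ : σ = σ' := Equiv.ext fun i => I.injective (congrFun hp i)
      rw [hσ]
    · intro v _ hv
      refine h0 _ fun hn => hv ?_
      have hinj : Function.Injective v := List.nodup_ofFn.1 hn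
      have hmono : StrictMono (v ∘ Tuple.sort v) :=
        (Tuple.monotone_sort v).strictMono_of_injective (hinj.comp (Tuple.sort v).injective)
      refine ⟨(OrderEmbedding.ofStrictMono _ hmono, (Tuple.sort v)⁻¹), by simp, ?_⟩
      funext i
      simp
  rw [e, Fintype.sum_prod_type, Finset.smul_sum]
  refine Finset.sum_congr rfl fun I _ => ?_
  rw [Finset.sum_congr rfl fun σ _ => hF (List.ofFn I) _ (Equiv.Perm.ofFn_comp_perm σ I).symm]
  simp [Fintype.card_perm]

section Symmetrize

variable {k Ω J : Type*} [Field k] [Ring Ω] [Algebra k Ω] [Fintype J]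

/-- The operators with `X_0 = ∑ t_j g_j` and `X_{m+1} = -∑ s_j X_m h_j`. -/
def layer (g h : J → Ω →ₗ[k] Ω) (t s : J → Ω) : ℕ → Ω →ₗ[k] Ω
  | 0 => ∑ j, LinearMap.mulLeft k (t j) ∘ₗ g j
  | m + 1 => -∑ j, LinearMap.mulLeft k (s j) ∘ₗ layer g h t s m ∘ₗ h j

theorem layer_zero (g h : J → Ω →ₗ[k] Ω) (t s : J → Ω) (x : Ω) :
    layer g h t s 0 x = ∑ j, t j * g j x := by
  simp [layer]

theorem layer_succ (g h : J → Ω →ₗ[k] Ω) (t s : J → Ω) (m : ℕ) (x : Ω) :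
    layer g h t s (m + 1) x = -∑ j, s j * layer g h t s m (h j x) := by
  simp [layer]

variable [CharZero k] [LinearOrder J] {d : Ω →ₗ[k] Ω} {h ctr ε : J → Ω →ₗ[k] Ω} {t s : J → Ω}
  (D : ConeSystem k d h ctr ε t s)

include D

theorem layer_eq_sum {g : J → Ω →ₗ[k] Ω} (hg : ∀ a b x, g b (h a x) = -g a (h b x)) (m : ℕ)
    (x : Ω) : layer g h t s m x =
      ∑ a, ∑ w : Fin m → J, t a * sProd s (List.ofFn w) * chain g h (a :: List.ofFn w) x := by
  induction m generalizing x with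
  | zero =>
    rw [layer_zero]
    refine Finset.sum_congr rfl fun a _ => ?_
    rw [Fintype.sum_unique]
    simp [chain]
  | succ m ih =>
    rw [layer_succ]
    simp only [fun a => sum_ofFn_succ m fun l => t a * sProd s l * chain g h (a :: l) x]
    rw [Finset.sum_comm, ← Finset.sum_neg_distrib]
    refine Finset.sum_congr rfl fun b _ => ?_
    rw [ih, Finset.mul_sum, ← Finset.sum_neg_distrib]
    refine Finset.sum_congr rfl fun a _ => ?_
    rw [Finset.mul_sum, ← Finset.sum_neg_distrib]
    refine Finset.sum_congr rfl fun w _ => ?_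
    have e : chain g h (a :: b :: List.ofFn w) x = -chain g h (a :: List.ofFn w) (h b x) := by
      rcases hw : List.ofFn w with _ | ⟨c, l⟩
      · exact hg _ _ _
      · change chain g h (c :: l) (h b (h a x)) = -chain g h (c :: l) (h a (h b x))
        rw [D.h_swap, map_neg]
    rw [e, mul_neg, sProd_cons, D.t_mul_s_mul, mul_assoc (s b)]

theorem sum_whitney_mul_chain {g : J → Ω →ₗ[k] Ω} (hg : ∀ a b x, g b (h a x) = -g a (h b x))
    (m : ℕ) (x : Ω) : ∑ v : Fin (m + 1) → J,
      whitney t s (List.ofFn v) * chain g h (List.ofFn v) x = (m + 1) • layer g h t s m x := by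
  induction m generalizing x with
  | zero =>
    rw [sum_ofFn_succ 0 fun l => whitney t s l * chain g h l x, layer_zero, zero_add, one_smul]
    refine Finset.sum_congr rfl fun a _ => ?_
    rw [Fintype.sum_unique]
    simp [whitney_cons, chain]
  | succ m ih =>
    rw [sum_ofFn_succ (m + 1) fun l => whitney t s l * chain g h l x, succ_nsmul']
    nth_rewrite 1 [D.layer_eq_sum hg]
    rw [layer_succ, smul_neg, Finset.smul_sum, ← sub_eq_add_neg, ← Finset.sum_sub_distrib]
    refine Finset.sum_congr rfl fun a _ => ?_
    rw [← mul_smul_comm, ← ih, Finset.mul_sum, ← Finset.sum_sub_distrib]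
    refine Finset.sum_congr rfl fun w _ => ?_
    rw [whitney_cons, sub_mul, chain_cons g h a (by simp)]
    simp only [mul_assoc, LinearMap.comp_apply]

theorem sum_orderEmbedding {g : J → Ω →ₗ[k] Ω} (hg : ∀ a b x, g b (h a x) = -g a (h b x))
    (m : ℕ) (x : Ω) : ∑ I : Fin (m + 1) ↪o J, (m.factorial : k) •
      (whitney t s (List.ofFn I) * chain g h (List.ofFn I) x) = layer g h t s m x := by
  have e := D.sum_whitney_mul_chain hg m x
  rw [sum_ofFn_eq_factorial_smul (m + 1) (fun l => whitney t s l * chain g h l x)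
    (fun l l' hl => D.whitney_mul_chain_perm hg hl x)
    (fun l hl => by rw [D.whitney_of_not_nodup hl, zero_mul]), Nat.factorial_succ, mul_smul,
    ← Nat.cast_smul_eq_nsmul k (m + 1), ← Nat.cast_smul_eq_nsmul k (m + 1)] at e
  have := smul_right_injective Ω (Nat.cast_ne_zero.2 (Nat.succ_ne_zero m) : ((m + 1 : ℕ) : k) ≠ 0) e
  rw [← this, Finset.smul_sum]
  exact Finset.sum_congr rfl fun I _ => Nat.cast_smul_eq_nsmul k _ _

end Symmetrize

end ConeSystem

/-! ### Integration over simplices -/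

namespace Sullivan

open PolyForms

variable {k : Type*} [Field k] {n m : ℕ}

theorem map_t {A : Type*} [CommRing A] [Algebra k A] (φ : MvPolynomial (Fin n) k →ₐ[k] A)
    (c : Fin (n + 1) → A) (hc : ∑ i, c i = 1) (h : ∀ j : Fin n, φ (MvPolynomial.X j) = c j.succ)
    (i : Fin (n + 1)) : φ (t k n i) = c i := by
  cases i using Fin.cases with
  | succ j => exact h j
  | zero =>
    rw [Fin.sum_univ_succ] at hc
    rw [t, Fin.cons_zero, map_sub, map_one, map_sum, Finset.sum_congr rfl fun j _ => h j, ← hc]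
    abel

variable (k) in
/-- The barycentric coordinates of `restrict k v`. -/
def restrictCoord (v : Fin (m + 1) → Fin (n + 1)) (i : Fin (n + 1)) : MvPolynomial (Fin m) k :=
  ∑ l : Fin (m + 1), if v l = i then t k m l else 0

theorem restrict_apply (v : Fin (m + 1) → Fin (n + 1)) (ω : Sullivan k n) :
    restrict k v ω = pullback k (fun j : Fin n => restrictCoord k v j.succ) ω := rfl

theorem sum_restrictCoord (v : Fin (m + 1) → Fin (n + 1)) : ∑ i, restrictCoord k v i = 1 := by
  simp only [restrictCoord]
  rw [Finset.sum_comm]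
  simp [sum_t]

theorem aeval_restrictCoord_t (v : Fin (m + 1) → Fin (n + 1)) (i : Fin (n + 1)) :
    MvPolynomial.aeval (fun j : Fin n => restrictCoord k v j.succ) (t k n i) =
      restrictCoord k v i :=
  map_t _ _ (sum_restrictCoord v) (fun j => by simp) i

theorem restrict_restrict {l : ℕ} (w : Fin (l + 1) → Fin (m + 1)) (v : Fin (m + 1) → Fin (n + 1))
    (ω : Sullivan k n) : restrict k w (restrict k v ω) = restrict k (v ∘ w) ω := by
  rw [restrict_apply, restrict_apply, restrict_apply, pullback_pullback]
  congr 2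
  ext1 j
  rw [restrictCoord, map_sum]
  simp only [apply_ite (MvPolynomial.aeval _), map_zero, aeval_restrictCoord_t]
  simp only [restrictCoord, ← Finset.sum_filter]
  rw [Finset.sum_comm' (t' := Finset.univ) (s' := fun x => Finset.univ.filter fun y =>
    v y = j.succ ∧ w x = y) (by simp [and_comm])]
  rw [Finset.sum_filter]
  refine Finset.sum_congr rfl fun x _ => ?_
  by_cases h : v (w x) = j.succ
  · rw [Finset.sum_filter, Finset.sum_eq_single (w x)]
    · simp [h]
    · intro y _ hy
      simp [hy.symm]
    · simp
  · rw [Finset.sum_filter, Finset.sum_eq_zero]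
    · simp [h]
    · intro y _
      rw [if_neg]
      rintro ⟨h1, rfl⟩
      exact h h1

theorem atVertex_restrict (v : Fin (m + 1) → Fin (n + 1)) (l : Fin (m + 1)) (ω : Sullivan k n) :
    pullback k (fun j : Fin m => if j.succ = l then (1 : MvPolynomial (Fin n) k) else 0)
      (restrict k v ω) = atVertex k n (v l) ω := by
  rw [restrict_apply, pullback_pullback, atVertex]
  congr 2
  ext1 j
  have ht : ∀ l', MvPolynomial.aeval (fun j : Fin m => if j.succ = l then
      (1 : MvPolynomial (Fin n) k) else 0) (t k m l') = if l' = l then 1 else 0 := fun l' =>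
    map_t _ (fun l' => if l' = l then (1 : MvPolynomial (Fin n) k) else 0) (by simp)
      (fun j => by simp) l'
  rw [restrictCoord, map_sum, vertex]
  simp only [apply_ite (MvPolynomial.aeval _), map_zero, ht]
  rw [Finset.sum_eq_single l]
  · by_cases h : v l = j.succ <;> simp [h, eq_comm]
  · intro l' _ h
    simp [h]
  · simp

theorem restrict_vertexHomotopy (v : Fin (m + 1) → Fin (n + 1)) (l : Fin (m + 1))
    (ω : Sullivan k n) :
    restrict k v (vertexHomotopy k n (v l) ω) = vertexHomotopy k m l (restrict k v ω) := by
  rw [vertexHomotopy_apply, vertexHomotopy_apply, restrict_apply, restrict_apply,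
    pullback_fibreIntegral, pullback_pullback, pullback_pullback]
  congr 3
  ext1 j
  have ht : ∀ l', MvPolynomial.aeval (cone k m l) (t k m l') =
      MvPolynomial.X none * MvPolynomial.rename some (t k m l') +
        if l' = l then 1 - MvPolynomial.X none else 0 := fun l' =>
    map_t _ (fun l' => MvPolynomial.X none * MvPolynomial.rename some (t k m l') +
        if l' = l then (1 - MvPolynomial.X none : MvPolynomial (Option (Fin m)) k) else 0)
      (by rw [Finset.sum_add_distrib, ← Finset.mul_sum, ← map_sum, sum_t]; simp)
      (fun j => by simp [cone, t]) l'
  rw [restrictCoord, map_sum, cone]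
  simp only [apply_ite (MvPolynomial.aeval _), map_zero, ht, map_add, map_mul, map_sub, map_one,
    MvPolynomial.aeval_X, Option.elim_none, Option.elim_some]
  have e : ∀ x : Fin (m + 1), (if v x = j.succ then (MvPolynomial.X none *
      MvPolynomial.rename some (t k m x) + if x = l then 1 - MvPolynomial.X none else 0 :
        MvPolynomial (Option (Fin m)) k) else 0) =
      MvPolynomial.X none * (if v x = j.succ then MvPolynomial.rename some (t k m x) else 0) +
      if x = l then (if v x = j.succ then 1 - MvPolynomial.X none else 0) else 0 := by
    intro x
    split_ifs <;> simp
  rw [Finset.sum_congr rfl fun x _ => e x, Finset.sum_add_distrib, Finset.sum_ite_eq',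
    if_pos (Finset.mem_univ l)]
  congr 1
  · rw [restrictCoord, map_sum, Finset.mul_sum]
    refine Finset.sum_congr rfl fun x _ => ?_
    rw [apply_ite (MvPolynomial.rename some), map_zero]
  · simp only [eq_comm]

/-! #### Top degree -/

variable (k n) in
/-- The form `dX_0 ⋯ dX_{n-1}`. -/
def vol : Sullivan k n := (List.ofFn fun i : Fin n => dX k i).prod

theorem one_tmul_list_prod {σ : Type*} (l : List (ExteriorAlgebra k (σ → k))) :
    (1 ⊗ₜ[k] l.prod : PolyForms k σ) = (l.map fun x => (1 ⊗ₜ[k] x : PolyForms k σ)).prod := by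
  induction l with
  | nil => rfl
  | cons x l ih => rw [List.prod_cons, List.map_cons, List.prod_cons, ← ih,
      Algebra.TensorProduct.tmul_mul_tmul, one_mul]

theorem ofPoly_mul_vol (f : MvPolynomial (Fin n) k) : ofPoly k f * vol k n =
    f ⊗ₜ ExteriorAlgebra.ιMulti k n (Pi.basisFun k (Fin n)) := by
  have : vol k n = 1 ⊗ₜ ExteriorAlgebra.ιMulti k n (Pi.basisFun k (Fin n)) := by
    rw [ExteriorAlgebra.ιMulti_apply, one_tmul_list_prod, List.map_ofFn, vol]
    congr 2
    ext1 i
    simp [dX]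
  rw [this, ofPoly_mul_tmul, mul_one]

/-- A linear functional which vanishes on forms of degree `≠ n` is determined by its values on
the forms `X^a dX_0 ⋯ dX_{n-1}`. -/
theorem functional_ext {A B : Sullivan k n →ₗ[k] k}
    (hA : ∀ p ≠ n, ∀ ω ∈ gr k (Fin n) p, A ω = 0) (hB : ∀ p ≠ n, ∀ ω ∈ gr k (Fin n) p, B ω = 0)
    (h : ∀ a : Fin n →₀ ℕ, A (ofPoly k (MvPolynomial.monomial a 1) * vol k n) =
      B (ofPoly k (MvPolynomial.monomial a 1) * vol k n)) : A = B := by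
  refine LinearMap.ext fun ω => gr_induction (S := LinearMap.eqLocus A B) (fun p => ?_) ω
  by_cases hp : p = n
  · subst hp
    have h1 : ∀ f : MvPolynomial (Fin p) k, A (f ⊗ₜ ExteriorAlgebra.ιMulti k p
        (Pi.basisFun k (Fin p))) = B (f ⊗ₜ ExteriorAlgebra.ιMulti k p (Pi.basisFun k (Fin p))) := by
      intro f
      have : A ∘ₗ (TensorProduct.mk k (MvPolynomial (Fin p) k) _).flip (ExteriorAlgebra.ιMulti k p
          (Pi.basisFun k (Fin p))) = B ∘ₗ (TensorProduct.mk k (MvPolynomial (Fin p) k) _).flip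
          (ExteriorAlgebra.ιMulti k p (Pi.basisFun k (Fin p))) := by
        refine (MvPolynomial.basisMonomials (Fin p) k).ext fun a => ?_
        have := h a
        rw [ofPoly_mul_vol] at this
        simpa using this
      exact LinearMap.congr_fun this f
    refine gr_le fun f l hl => ?_
    rw [← ExteriorAlgebra.ιMulti_span_fixedDegree] at hl
    have h2 : ((A - B) ∘ₗ TensorProduct.mk k (MvPolynomial (Fin p) k) _ f).compAlternatingMap
        (ExteriorAlgebra.ιMulti k p) = (0 : (Fin p → k) [⋀^Fin p]→ₗ[k] k) := by
      refine Module.Basis.ext_alternating (Pi.basisFun k (Fin p)) fun v hv => ?_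
      have e : (fun i => Pi.basisFun k (Fin p) (v i)) = (Pi.basisFun k (Fin p)) ∘
        Equiv.ofBijective v (Finite.injective_iff_bijective.1 hv) := rfl
      rw [e, AlternatingMap.map_perm]
      simp [sub_eq_zero.2 (h1 f)]
    induction hl using Submodule.span_induction with
    | mem l hl =>
      obtain ⟨v, rfl⟩ := hl
      have := congrArg (fun g : (Fin p → k) [⋀^Fin p]→ₗ[k] k => g v) h2
      simpa [sub_eq_zero] using this
    | zero => simp
    | add x y _ _ hx hy => rw [TensorProduct.tmul_add]; exact add_mem hx hy
    | smul c x _ hx => rw [TensorProduct.tmul_smul]; exact Submodule.smul_mem _ _ hx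
  · intro ω hω
    change A ω = B ω
    rw [hA p hp ω hω, hB p hp ω hω]

variable (k n) in
/-- The integral of `f dX_0 ⋯ dX_{n-1}` over the simplex. -/
def polyIntegral : MvPolynomial (Fin n) k →ₗ[k] k :=
  (MvPolynomial.basisMonomials (Fin n) k).constr k fun a =>
      (∏ i, ((a i).factorial : k)) / (((∑ i, a i) + n).factorial : k)

theorem polyIntegral_monomial (a : Fin n →₀ ℕ) : polyIntegral k n (MvPolynomial.monomial a 1) =
    (∏ i, ((a i).factorial : k)) / (((∑ i, a i) + n).factorial : k) := by
  have : (MvPolynomial.monomial a (1 : k)) = MvPolynomial.basisMonomials (Fin n) k a := by simp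
  rw [this, polyIntegral, Module.Basis.constr_basis]

theorem integral_tmul (f : MvPolynomial (Fin n) k) (l : ExteriorAlgebra k (Fin n → k)) :
    integral k n (f ⊗ₜ l) = polyIntegral k n f *
      ExteriorAlgebra.liftAlternating (R := k) (M := Fin n → k) (N := k)
        (Pi.single n (Matrix.detRowAlternating (R := k) (n := Fin n))) l := by
  simp [integral, polyIntegral]

theorem integral_of_mem_gr {p : ℕ} (hp : p ≠ n) {ω : Sullivan k n} (hω : ω ∈ gr k (Fin n) p) :
    integral k n ω = 0 := by
  have : gr k (Fin n) p ≤ LinearMap.ker (integral k n) := by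
    refine gr_le fun f l hl => ?_
    rw [← ExteriorAlgebra.ιMulti_span_fixedDegree] at hl
    induction hl using Submodule.span_induction with
    | mem l hl =>
      obtain ⟨v, rfl⟩ := hl
      rw [LinearMap.mem_ker, integral_tmul, ExteriorAlgebra.liftAlternating_apply_ιMulti,
        Pi.single_eq_of_ne hp]
      simp
    | zero => simp
    | add x y _ _ hx hy => rw [TensorProduct.tmul_add]; exact add_mem hx hy
    | smul c x _ hx => rw [TensorProduct.tmul_smul]; exact Submodule.smul_mem _ _ hx
  exact this hω

theorem integral_ofPoly_mul_vol (f : MvPolynomial (Fin n) k) :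
    integral k n (ofPoly k f * vol k n) = polyIntegral k n f := by
  rw [ofPoly_mul_vol, integral_tmul, ExteriorAlgebra.liftAlternating_apply_ιMulti,
    Pi.single_eq_same]
  have : (Matrix.detRowAlternating (R := k) (n := Fin n)) (Pi.basisFun k (Fin n)) = 1 := by
    have h := Matrix.det_one (R := k) (n := Fin n)
    convert h using 1
    change Matrix.det _ = _
    congr 1
    ext i j
    simp [Matrix.one_apply, Pi.single_apply, eq_comm]
  rw [this, mul_one]

/-- Dirichlet's formula. -/
theorem polyIntegral_dirichlet [CharZero k] (b : ℕ) (a : Fin n →₀ ℕ) :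
    polyIntegral k n (t k n 0 ^ b * MvPolynomial.monomial a 1) =
      (b.factorial * ∏ i, ((a i).factorial : k)) / (((∑ i, a i) + b + n).factorial : k) := by
  induction b generalizing a with
  | zero => simp [polyIntegral_monomial]
  | succ b ih =>
    have e : t k n 0 ^ (b + 1) * MvPolynomial.monomial a 1 =
        t k n 0 ^ b * MvPolynomial.monomial a 1 -
        ∑ j, t k n 0 ^ b * MvPolynomial.monomial (a + Finsupp.single j 1) 1 := by
      have h0 : t k n 0 = 1 - ∑ j : Fin n, MvPolynomial.X j := rfl
      have h1 : ∀ j, MvPolynomial.monomial (a + Finsupp.single j 1) (1 : k) =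
          MvPolynomial.X j * MvPolynomial.monomial a 1 := fun j => by
        rw [MvPolynomial.X, MvPolynomial.monomial_mul, add_comm, one_mul]
      simp only [h1, ← Finset.mul_sum, ← Finset.sum_mul]
      rw [pow_succ]
      nth_rewrite 2 [h0]
      ring
    have h2 : ∀ j, ∑ i, (a + Finsupp.single j 1 : Fin n →₀ ℕ) i = ∑ i, a i + 1 := fun j => by
      simp [Finset.sum_add_distrib, Finsupp.single_apply]
    have h3 : ∀ j, ∏ i, (((a + Finsupp.single j 1 : Fin n →₀ ℕ) i).factorial : k) =
        ((a j : k) + 1) * ∏ i, ((a i).factorial : k) := fun j => by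
      rw [← Finset.mul_prod_erase _ _ (Finset.mem_univ j), ← Finset.mul_prod_erase
        _ (fun i => ((a i).factorial : k)) (Finset.mem_univ j), ← mul_assoc]
      congr 1
      · simp [Nat.factorial_succ]
      · refine Finset.prod_congr rfl fun i hi => ?_
        simp [Finsupp.single_eq_of_ne (Finset.ne_of_mem_erase hi)]
    rw [e, map_sub, map_sum, ih]
    simp only [ih, h2, h3]
    have h4 : ∑ i, a i + (b + 1) + n = (∑ i, a i + b + n) + 1 := by ring
    have h5 : ∑ i, a i + 1 + b + n = (∑ i, a i + b + n) + 1 := by ring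
    have h6 : (((∑ i, a i + b + n).factorial : ℕ) : k) ≠ 0 :=
      Nat.cast_ne_zero.2 (Nat.factorial_ne_zero _)
    have h7 : (((∑ i, a i + b + n : ℕ) : k) + 1) ≠ 0 := Nat.cast_add_one_ne_zero _
    rw [h4, h5, ← Finset.sum_div, ← Finset.mul_sum, ← Finset.sum_mul, Nat.factorial_succ,
      Nat.factorial_succ, Finset.sum_add_distrib, Nat.cast_mul, Nat.cast_mul,
      Nat.cast_succ (∑ i, a i + b + n), Nat.cast_succ b, div_sub_div _ _ h6 (mul_ne_zero h7 h6),
      div_eq_div_iff (mul_ne_zero h6 (mul_ne_zero h7 h6)) (mul_ne_zero h7 h6)]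
    simp only [Finset.sum_const, Finset.card_univ, Fintype.card_fin, nsmul_eq_mul, mul_one]
    push_cast
    ring

end Sullivan

namespace Sullivan

open PolyForms

variable {k : Type*} [Field k] {n m : ℕ}

/-! #### Integration in stages -/

variable (k m) in
/-- The map `(u, t) ↦ u t` onto the `m + 1`-simplex, whose zeroth vertex is the origin. -/
def join : Fin (m + 1) → MvPolynomial (Option (Fin m)) k :=
  fun j => MvPolynomial.X none * MvPolynomial.rename some (t k m j)

theorem sum_join : ∑ j, join k m j = MvPolynomial.X none := by
  simp only [join]
  rw [← Finset.mul_sum, ← map_sum, sum_t, map_one, mul_one]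

theorem restrict_succ_vertexHomotopy (ω : Sullivan k (m + 1)) :
    restrict k (Fin.succ : Fin (m + 1) → Fin (m + 2)) (vertexHomotopy k (m + 1) 0 ω) =
      fibreIntegral k (Fin m) (pullback k (join k m) ω) := by
  rw [vertexHomotopy_apply, restrict_apply, pullback_fibreIntegral, pullback_pullback]
  congr 3
  ext1 j
  have h : restrictCoord k (Fin.succ : Fin (m + 1) → Fin (m + 2)) j.succ = t k m j := by
    simp [restrictCoord]
  simp [cone, join, h]

theorem dX_mul_prod_eq_zero {σ : Type*} [DecidableEq σ] {i : σ} {l : List σ} (h : i ∈ l) :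
    dX k i * (l.map (dX k)).prod = 0 := by
  induction l with
  | nil => simp at h
  | cons j l ih =>
    rw [List.map_cons, List.prod_cons, ← mul_assoc]
    rcases List.mem_cons.1 h with rfl | h
    · rw [dX_mul_self, zero_mul]
    · rw [dX_mul_dX, neg_mul', mul_assoc, ih h, mul_zero, neg_zero]

theorem vol_succ : vol k (m + 1) =
    dX k 0 * ((List.ofFn (Fin.succ : Fin m → Fin (m + 1))).map (dX k)).prod := by
  rw [vol, List.ofFn_succ, List.prod_cons, List.map_ofFn]
  rfl

theorem vol_succ_eq_sum : vol k (m + 1) =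
    (∑ i, dX k i) * ((List.ofFn (Fin.succ : Fin m → Fin (m + 1))).map (dX k)).prod := by
  rw [vol_succ, Fin.sum_univ_succ, add_mul, Finset.sum_mul, Finset.sum_eq_zero, add_zero]
  intro i _
  exact dX_mul_prod_eq_zero (by simp)

theorem fibreIntegral_dX_none_mul (ω : PolyForms k (Option (Fin m))) :
    fibreIntegral k (Fin m) (dX k none * ω) = coeffIntegral k (Fin m) ω := by
  rw [fibreIntegral_eq, contract_dX_mul, map_sub, coeffIntegral_dX_none_mul, sub_zero]
  simp [ofPoly_one]

theorem coeffIntegral_prod (p : ℕ) (l : List (Fin m)) :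
    coeffIntegral k (Fin m) (ofPoly k (MvPolynomial.X none ^ p) *
      (l.map fun j => ofPoly k (MvPolynomial.X none) * dX k (some j) +
        ofPoly k (MvPolynomial.X (some j)) * dX k none).prod) =
      (((p + l.length : ℕ) : k) + 1)⁻¹ • (l.map (dX k)).prod := by
  induction l generalizing p with
  | nil => simp [coeffIntegral_X_none_pow]
  | cons j l ih =>
    rw [List.map_cons, List.prod_cons, List.map_cons, List.prod_cons, add_mul, mul_add, map_add]
    have e1 : ∀ R : PolyForms k (Option (Fin m)), ofPoly k (MvPolynomial.X none ^ p) *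
        (ofPoly k (MvPolynomial.X none) * dX k (some j) * R) =
        dX k (some j) * (ofPoly k (MvPolynomial.X none ^ (p + 1)) * R) := fun R => by
      rw [← mul_assoc, ← mul_assoc, ← ofPoly_mul, ← pow_succ, ofPoly_mul_comm, mul_assoc]
    have e2 : ∀ R : PolyForms k (Option (Fin m)), ofPoly k (MvPolynomial.X none ^ p) *
        (ofPoly k (MvPolynomial.X (some j)) * dX k none * R) =
        dX k none * (ofPoly k (MvPolynomial.X none ^ p * MvPolynomial.X (some j)) * R) :=
      fun R => by
        rw [← mul_assoc, ← mul_assoc, ← ofPoly_mul, ofPoly_mul_comm, mul_assoc]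
    rw [e1, e2, coeffIntegral_dX_none_mul, coeffIntegral_dX_some_mul, ih, add_zero,
      mul_smul_comm, List.length_cons, add_right_comm, ← add_assoc]

theorem pullback_join_vol : fibreIntegral k (Fin m) (ofPoly k (MvPolynomial.X none ^ n) *
    pullback k (join k m) (vol k (m + 1))) = (((n + m : ℕ) : k) + 1)⁻¹ • vol k m := by
  have h1 : pullback k (join k m) (∑ i, dX k i) = dX k none := by
    rw [map_sum, Finset.sum_congr rfl fun i _ => pullback_dX _ i, ← map_sum, ← ofPoly_sum,
      sum_join, d_X]
  have h2 : ∀ j : Fin m, pullback k (join k m) (dX k j.succ) =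
      ofPoly k (MvPolynomial.X none) * dX k (some j) +
        ofPoly k (MvPolynomial.X (some j)) * dX k none := fun j => by
    rw [pullback_dX, join, ofPoly_mul, d_ofPoly_mul, d_X]
    simp only [t, Fin.cons_succ, MvPolynomial.rename_X]
    rw [d_X, ofPoly_mul_comm (MvPolynomial.X (some j)), add_comm]
  rw [vol_succ_eq_sum, map_mul (pullback k (join k m)), h1, map_list_prod, List.map_map, List.map_ofFn, ← mul_assoc,
    ofPoly_mul_comm, mul_assoc, fibreIntegral_dX_none_mul]
  have h3 := coeffIntegral_prod (k := k) n (List.finRange m)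
  rw [← List.ofFn_eq_map, ← List.ofFn_eq_map, List.length_finRange] at h3
  rw [vol, ← h3]
  congr 4
  ext1 j
  exact h2 j

theorem integral_succ [CharZero k] (ω : Sullivan k (m + 1)) : integral k (m + 1) ω =
    integral k m (restrict k (Fin.succ : Fin (m + 1) → Fin (m + 2))
      (vertexHomotopy k (m + 1) 0 ω)) := by
  have : integral k (m + 1) = integral k m ∘ₗ
      (restrict k (Fin.succ : Fin (m + 1) → Fin (m + 2))).toLinearMap ∘ₗ
      vertexHomotopy k (m + 1) 0 := by
    refine functional_ext (fun p hp ω hω => integral_of_mem_gr hp hω) (fun p hp ω hω => ?_)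
      (fun a => ?_)
    · change integral k m (restrict k (Fin.succ : Fin (m + 1) → Fin (m + 2)) _) = 0
      cases p with
      | zero => rw [vertexHomotopy_of_mem_gr_zero 0 hω, map_zero, map_zero]
      | succ p =>
        exact integral_of_mem_gr (p := p) (fun h => hp (by rw [h]))
          (pullback_mem_gr _ (vertexHomotopy_mem_gr 0 hω))
    · change _ = integral k m (restrict k (Fin.succ : Fin (m + 1) → Fin (m + 2)) _)
      rw [restrict_succ_vertexHomotopy, integral_ofPoly_mul_vol, polyIntegral_monomial,
        map_mul (pullback k (join k m)), pullback_ofPoly]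
      have h1 : MvPolynomial.aeval (join k m) (MvPolynomial.monomial a (1 : k)) =
          MvPolynomial.rename some (∏ i, t k m i ^ a i) * MvPolynomial.X none ^ (∑ i, a i) := by
        rw [MvPolynomial.aeval_monomial, map_one, one_mul, Finsupp.prod_fintype _ _ (by simp),
          map_prod, ← Finset.prod_pow_eq_pow_sum, ← Finset.prod_mul_distrib]
        refine Finset.prod_congr rfl fun i _ => ?_
        rw [join, mul_pow, map_pow, mul_comm]
      have h2 : ∏ i, t k m i ^ a i = t k m 0 ^ a 0 *
          MvPolynomial.monomial (Finsupp.equivFunOnFinite.symm fun i => a (Fin.succ i)) 1 := by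
        rw [Fin.prod_univ_succ, MvPolynomial.monomial_eq, map_one, one_mul,
          Finsupp.prod_fintype _ _ (by simp)]
        simp [t]
      rw [h1, ofPoly_mul, mul_assoc, fibreIntegral_rename_mul, pullback_join_vol, mul_smul_comm,
        map_smul, integral_ofPoly_mul_vol, h2, polyIntegral_dirichlet, Fin.prod_univ_succ,
        smul_eq_mul]
      have h3 : ∑ i, (Finsupp.equivFunOnFinite.symm fun i : Fin m => a (Fin.succ i)) i + a 0 =
          ∑ i, a i := by
        rw [Fin.sum_univ_succ, add_comm]
        simp
      rw [h3, ← add_assoc, Nat.factorial_succ, Nat.cast_mul, Nat.cast_succ, inv_mul_eq_div, div_div,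
        mul_comm (((∑ i, a i + m).factorial : ℕ) : k)]
      simp
  exact LinearMap.congr_fun this ω

theorem integral_zero_smul_one (ω : Sullivan k 0) : integral k 0 ω • (1 : Sullivan k 0) = ω := by
  have : (integral k 0).smulRight (1 : Sullivan k 0) = LinearMap.id := by
    refine linearMap_ext ?_ (fun i => i.elim0) (fun i => i.elim0)
    have h := integral_ofPoly_mul_vol (k := k) (n := 0) 1
    have h1 : polyIntegral k 0 1 = 1 := by
      simpa using polyIntegral_monomial (k := k) (n := 0) 0
    rw [ofPoly_one, one_mul, h1] at h
    have h2 : vol k 0 = 1 := rfl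
    rw [h2] at h
    simp [h]
  exact LinearMap.congr_fun this ω

variable (k n) in
/-- The restrictions to the vertices, as linear maps. -/
def atVertexₗ (i : Fin (n + 1)) : Sullivan k n →ₗ[k] Sullivan k n := (atVertex k n i).toLinearMap

theorem chain_atVertex [CharZero k] (v : Fin (m + 1) → Fin (n + 1)) (ω : Sullivan k n) :
    ConeSystem.chain (atVertexₗ k n) (vertexHomotopy k n) (List.ofFn v) ω =
      integral k m (restrict k v ω) • (1 : Sullivan k n) := by
  induction m generalizing ω with
  | zero =>
    have h := atVertex_restrict v 0 ω
    rw [← integral_zero_smul_one (restrict k v ω), map_smul, map_one] at h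
    rw [h, List.ofFn_succ, List.ofFn_zero]
    rfl
  | succ m ih =>
    rw [List.ofFn_succ, ConeSystem.chain_cons _ _ _ (by simp), LinearMap.comp_apply, ih,
      integral_succ, ← restrict_vertexHomotopy, restrict_restrict]
    rfl

end Sullivan

/-! ### Dupont's contraction -/

namespace Sullivan

open PolyForms ConeSystem

variable {k : Type*} [Field k] {n m : ℕ}

theorem atVertex_tForm (i j : Fin (n + 1)) :
    atVertex k n i (tForm k n j) = if i = j then 1 else 0 := by
  rw [atVertex, tForm, pullback_ofPoly, map_t _ (fun j => if i = j then 1 else 0) (by simp)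
    (fun l => by simp [vertex, eq_comm])]
  split_ifs <;> simp [ofPoly_one, ofPoly_zero]

variable (k n) in
theorem coneSystem [CharZero k] : ConeSystem k (d k (Fin n)) (vertexHomotopy k n) (ctr k n)
    (atVertexₗ k n) (tForm k n) (dt k n) where
  d_one := d_one
  d_d := d_d
  d_t_mul := d_tForm_mul
  d_s_mul := d_dt_mul
  t_comm j x := ofPoly_mul_comm _ x
  s_anticomm := dt_mul_dt
  sum_t := sum_tForm
  sum_s := sum_dt
  d_h := d_vertexHomotopy_add
  ctr_one i := contract_one _
  ctr_t_mul := ctr_tForm_mul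
  ctr_s_mul := ctr_dt_mul
  ctr_ctr i j x := contract_anticomm _ _ x
  ctr_self i x := contract_self _ x
  ctr_h := ctr_vertexHomotopy
  ctr_ε := ctr_atVertex
  sum_t_ctr := sum_tForm_mul_ctr
  ε_h := atVertex_vertexHomotopy_self
  h_ε := vertexHomotopy_atVertex
  ε_h_of_ctr i j x h := atVertex_vertexHomotopy_of_ctr i j h
  h_of_ctr i x h := vertexHomotopy_of_ctr i h
  ε_ctr := atVertex_ctr
  ε_d := atVertex_d
  ε_ε := atVertex_atVertex
  ε_t_mul i j x := by
    change atVertex k n i (tForm k n j * x) = if i = j then atVertex k n i x else 0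
    rw [map_mul, atVertex_tForm, ite_mul, one_mul, zero_mul]
  ε_s_mul i j x := by
    change atVertex k n i (dt k n j * x) = 0
    rw [map_mul, dt, atVertex_d, zero_mul]
  lie_ctr := lie_ctr
  eq_zero_of_lie_add i x h := eq_zero_of_lie_add i h
  eq_zero_of_lie i x h h' := eq_zero_of_lie i h h'
  mem_of_h_mem S h x := mem_of_vertexHomotopy_mem h x

theorem whitney_ofFn {Ω J : Type*} [Ring Ω] [Algebra k Ω] {t s : J → Ω} (ht : ∀ j x, t j * x = x * t j)
    (v : Fin (m + 1) → J) : whitney t s (List.ofFn v) = ∑ j : Fin (m + 1), ((-1 : k) ^ (j : ℕ)) •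
      (t (v j) * (List.ofFn fun l : Fin m => s (v (j.succAbove l))).prod) := by
  induction m with
  | zero => simp [whitney_cons]
  | succ m ih =>
    conv_rhs => rw [Fin.sum_univ_succ]
    rw [List.ofFn_succ, whitney_cons, ih, sProd, List.map_ofFn, sub_eq_add_neg,
      Finset.mul_sum, ← Finset.sum_neg_distrib]
    congr 1
    · simp [Function.comp_def]
    · refine Finset.sum_congr rfl fun j _ => ?_
      rw [Fin.val_succ, pow_succ, mul_neg_one, neg_smul, mul_smul_comm, neg_inj,
        List.ofFn_succ, List.prod_cons]
      simp only [Fin.succ_succAbove_zero, Fin.succ_succAbove_succ]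
      rw [← mul_assoc, ← ht, mul_assoc]

theorem basicForm_eq (I : Fin (m + 1) ↪o Fin (n + 1)) :
    basicForm k I = (m.factorial : k) • whitney (tForm k n) (dt k n) (List.ofFn I) := by
  rw [whitney_ofFn (k := k) (t := tForm k n) fun j x => ofPoly_mul_comm (t k n j) x]
  rfl

theorem foldl_eq_chain (h : Fin (n + 1) → Sullivan k n →ₗ[k] Sullivan k n)
    {l : List (Fin (n + 1))} (hl : l ≠ []) (T : Sullivan k n →ₗ[k] Sullivan k n) :
    l.foldl (fun T i => h i ∘ₗ T) T = chain h h l ∘ₗ T := by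
  induction l generalizing T with
  | nil => exact absurd rfl hl
  | cons a l ih =>
    rw [List.foldl_cons]
    by_cases hl : l = []
    · subst hl
      rfl
    · rw [ih hl, chain_cons _ _ _ hl, LinearMap.comp_assoc]

theorem homotopy_apply [CharZero k] (ω : Sullivan k n) :
    homotopy k n ω = ∑ m ∈ Finset.range n, (-1 : k) ^ m •
      layer (vertexHomotopy k n) (vertexHomotopy k n) (tForm k n) (dt k n) m ω := by
  simp only [homotopy, LinearMap.sum_apply, LinearMap.smul_apply, ← Finset.smul_sum]
  refine Finset.sum_congr rfl fun m _ => ?_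
  rw [← (coneSystem k n).sum_orderEmbedding (fun a b x => (coneSystem k n).h_swap _ _ _)]
  congr 1
  refine Finset.sum_congr rfl fun I _ => ?_
  rw [foldl_eq_chain _ (by simp), basicForm_eq]
  exact smul_mul_assoc _ _ _

theorem incl_proj_apply [CharZero k] (ω : Sullivan k n) :
    incl k n (proj k n ω) = ∑ m ∈ Finset.range (n + 1),
      layer (atVertexₗ k n) (vertexHomotopy k n) (tForm k n) (dt k n) m ω := by
  simp only [proj, LinearMap.sum_apply, map_sum]
  refine Finset.sum_congr rfl fun m _ => ?_
  rw [← (coneSystem k n).sum_orderEmbedding (fun a b x => (coneSystem k n).ε_h_swap _ _ _)]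
  refine Finset.sum_congr rfl fun I _ => ?_
  rw [chain_atVertex, mul_smul_comm, mul_one, smul_comm, ← basicForm_eq, LinearMap.smulRight_apply,
    map_smul]
  rfl

theorem layer_atVertex_eq_zero [CharZero k] (ω : Sullivan k n) :
    layer (atVertexₗ k n) (vertexHomotopy k n) (tForm k n) (dt k n) (n + 1) ω = 0 := by
  rw [← (coneSystem k n).sum_orderEmbedding (fun a b x => (coneSystem k n).ε_h_swap _ _ _)]
  refine Finset.sum_eq_zero fun I _ => ?_
  have := Fintype.card_le_of_injective I I.injective
  simp at this

theorem gr_eq_bot {p : ℕ} (hp : n < p) : gr k (Fin n) p = ⊥ := by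
  have h : Module.finrank k (⋀[k]^p (Fin n → k)) = 0 := by
    rw [exteriorPower.finrank_eq, Module.finrank_fin_fun, Nat.choose_eq_zero_of_lt hp]
  rw [eq_bot_iff]
  refine gr_le fun f l hl => ?_
  have : (⟨l, hl⟩ : ⋀[k]^p (Fin n → k)) = 0 := by
    have := Module.finrank_zero_iff.1 h
    exact Subsingleton.elim _ _
  rw [Subtype.ext_iff] at this
  change l = 0 at this
  rw [this, TensorProduct.tmul_zero]
  exact zero_mem _

theorem layer_of_mem_gr {p m : ℕ} (hp : p ≤ m) {ω : Sullivan k n} (hω : ω ∈ gr k (Fin n) p) :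
    layer (vertexHomotopy k n) (vertexHomotopy k n) (tForm k n) (dt k n) m ω = 0 := by
  induction m generalizing p ω with
  | zero =>
    obtain rfl := Nat.le_zero.1 hp
    rw [layer_zero]
    exact Finset.sum_eq_zero fun j _ => by rw [vertexHomotopy_of_mem_gr_zero j hω, mul_zero]
  | succ m ih =>
    rw [layer_succ, neg_eq_zero]
    refine Finset.sum_eq_zero fun j _ => ?_
    cases p with
    | zero => rw [vertexHomotopy_of_mem_gr_zero j hω, map_zero, mul_zero]
    | succ p => rw [ih (Nat.le_of_succ_le_succ hp) (vertexHomotopy_mem_gr j hω), mul_zero]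

theorem layer_vertexHomotopy_eq_zero (ω : Sullivan k n) :
    layer (vertexHomotopy k n) (vertexHomotopy k n) (tForm k n) (dt k n) n ω = 0 := by
  refine gr_induction (S := LinearMap.ker
    (layer (vertexHomotopy k n) (vertexHomotopy k n) (tForm k n) (dt k n) n)) (fun p => ?_) ω
  rcases le_or_gt p n with hp | hp
  · exact fun ω hω => layer_of_mem_gr hp hω
  · rw [gr_eq_bot hp]
    exact bot_le

theorem homotopy_fixedPoint [CharZero k] (ω : Sullivan k n) : homotopy k n ω =
    ∑ j, (tForm k n j * vertexHomotopy k n j ω +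
      dt k n j * homotopy k n (vertexHomotopy k n j ω)) := by
  have e : ∑ j, dt k n j * homotopy k n (vertexHomotopy k n j ω) =
      ∑ m ∈ Finset.range n, (-1 : k) ^ (m + 1) •
      layer (vertexHomotopy k n) (vertexHomotopy k n) (tForm k n) (dt k n) (m + 1) ω := by
    simp only [homotopy_apply, Finset.mul_sum]
    rw [Finset.sum_comm]
    refine Finset.sum_congr rfl fun m _ => ?_
    rw [layer_succ, pow_succ, mul_neg_one]
    refine Eq.trans ?_ (neg_smul_neg _ _).symm
    rw [Finset.smul_sum]
    exact Finset.sum_congr rfl fun j _ => mul_smul_comm _ _ _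
  have e2 := Finset.sum_range_succ' (fun m => (-1 : k) ^ m •
    layer (vertexHomotopy k n) (vertexHomotopy k n) (tForm k n) (dt k n) m ω) n
  rw [Finset.sum_range_succ, layer_vertexHomotopy_eq_zero, smul_zero, add_zero, pow_zero,
    one_smul, layer_zero] at e2
  rw [Finset.sum_add_distrib, e, homotopy_apply, e2, add_comm]

theorem incl_proj_fixedPoint [CharZero k] (ω : Sullivan k n) :
    (incl k n ∘ₗ proj k n) ω = ∑ j, (tForm k n j * atVertexₗ k n j ω -
      dt k n j * (incl k n ∘ₗ proj k n) (vertexHomotopy k n j ω)) := by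
  have e : ∑ j, dt k n j * (incl k n ∘ₗ proj k n) (vertexHomotopy k n j ω) =
      -∑ m ∈ Finset.range (n + 1),
      layer (atVertexₗ k n) (vertexHomotopy k n) (tForm k n) (dt k n) (m + 1) ω := by
    simp only [LinearMap.comp_apply, incl_proj_apply, Finset.mul_sum]
    rw [Finset.sum_comm, ← Finset.sum_neg_distrib]
    refine Finset.sum_congr rfl fun m _ => ?_
    rw [layer_succ, neg_neg]
  have e2 := Finset.sum_range_succ' (fun m =>
    layer (atVertexₗ k n) (vertexHomotopy k n) (tForm k n) (dt k n) m ω) (n + 1)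
  rw [Finset.sum_range_succ, layer_atVertex_eq_zero, add_zero, layer_zero] at e2
  rw [Finset.sum_sub_distrib, e, LinearMap.comp_apply, incl_proj_apply, e2, sub_neg_eq_add,
    add_comm]

theorem d_homotopy_add [CharZero k] (ω : Sullivan k n) :
    d k _ (homotopy k n ω) + homotopy k n (d k _ ω) = ω - incl k n (proj k n ω) :=
  (coneSystem k n).d_homotopy_add homotopy_fixedPoint incl_proj_fixedPoint ω

theorem homotopy_homotopy [CharZero k] (ω : Sullivan k n) :
    homotopy k n (homotopy k n ω) = 0 :=
  (coneSystem k n).homotopy_homotopy homotopy_fixedPoint ω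

theorem homotopy_incl [CharZero k] (c : cellular k n) : homotopy k n (incl k n c) = 0 := by
  have : cellular k n ≤ LinearMap.ker (homotopy k n) := by
    refine Submodule.span_le.2 ?_
    rintro _ ⟨m, I, rfl⟩
    change homotopy k n _ = 0
    rw [basicForm_eq, map_smul, (coneSystem k n).homotopy_whitney homotopy_fixedPoint, smul_zero]
  exact this c.2

theorem incl_proj_d_incl [CharZero k] (c : cellular k n) :
    incl k n (proj k n (d k _ (incl k n c))) = d k _ (incl k n c) := by
  have : cellular k n ≤ LinearMap.eqLocus (incl k n ∘ₗ proj k n ∘ₗ d k (Fin n)) (d k (Fin n)) := by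
    refine Submodule.span_le.2 ?_
    rintro _ ⟨m, I, rfl⟩
    change incl k n (proj k n (d k _ _)) = d k _ _
    rw [basicForm_eq, map_smul, map_smul, map_smul]
    exact congrArg _ ((coneSystem k n).projection_d_whitney homotopy_fixedPoint incl_proj_fixedPoint _)
  exact this c.2

theorem incl_proj_incl [CharZero k] (c : cellular k n) :
    incl k n (proj k n (incl k n c)) = incl k n c := by
  have : cellular k n ≤ LinearMap.eqLocus (incl k n ∘ₗ proj k n) LinearMap.id := by
    refine Submodule.span_le.2 ?_
    rintro _ ⟨m, I, rfl⟩
    change incl k n (proj k n _) = _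
    rw [basicForm_eq, map_smul, map_smul]
    exact congrArg _ ((coneSystem k n).projection_whitney homotopy_fixedPoint incl_proj_fixedPoint _)
  exact this c.2

theorem layer_vertexHomotopy_mem_gr {p m : ℕ} {ω : Sullivan k n} (hω : ω ∈ gr k (Fin n) (p + 1)) :
    layer (vertexHomotopy k n) (vertexHomotopy k n) (tForm k n) (dt k n) m ω ∈
      gr k (Fin n) p := by
  induction m generalizing p ω with
  | zero =>
    rw [layer_zero]
    exact sum_mem fun j _ => ofPoly_mul_mem_gr _ (vertexHomotopy_mem_gr j hω)
  | succ m ih =>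
    rw [layer_succ]
    refine neg_mem (sum_mem fun j _ => ?_)
    have h := vertexHomotopy_mem_gr j hω
    cases p with
    | zero =>
      rw [layer_of_mem_gr (Nat.zero_le m) h, mul_zero]
      exact zero_mem _
    | succ p =>
      rw [add_comm]
      exact mul_mem_gr (d_mem_gr (ofPoly_mem_gr _)) (ih h)

theorem homotopy_mem_gr [CharZero k] {p : ℕ} {ω : Sullivan k n}
    (hω : ω ∈ gr k (Fin n) (p + 1)) : homotopy k n ω ∈ gr k (Fin n) p := by
  rw [homotopy_apply]
  exact sum_mem fun m _ => Submodule.smul_mem _ _ (layer_vertexHomotopy_mem_gr hω)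

theorem homotopy_of_mem_gr_zero [CharZero k] {ω : Sullivan k n} (hω : ω ∈ gr k (Fin n) 0) :
    homotopy k n ω = 0 := by
  rw [homotopy_apply]
  exact Finset.sum_eq_zero fun m _ => by rw [layer_of_mem_gr (Nat.zero_le m) hω, smul_zero]

end Sullivan

/-! ### Signs -/

/-- The sign `(-1)^m`. -/
def sg (m : ℤ) : ℤ := (m.negOnePow : ℤ)

theorem sg_add (a b : ℤ) : sg (a + b) = sg a * sg b := by
  simp [sg, Int.negOnePow_add]

theorem sg_zero : sg 0 = 1 := by simp [sg]

theorem sg_one : sg 1 = -1 := by simp [sg]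

theorem sg_congr {a b : ℤ} (h : Even (a - b)) : sg a = sg b := by
  rw [sg, sg, (Int.negOnePow_eq_iff a b).2 h]

theorem sg_mul_self (a : ℤ) : sg a * sg a = 1 := by
  rw [← sg_add, sg_congr (b := 0) (by simp), sg_zero]

theorem sg_sum {ι : Type*} (s : Finset ι) (f : ι → ℤ) : sg (∑ i ∈ s, f i) = ∏ i ∈ s, sg (f i) := by
  classical
  induction s using Finset.induction_on with
  | empty => exact sg_zero
  | insert i s hi ih => rw [Finset.sum_insert hi, Finset.prod_insert hi, sg_add, ih]

theorem sg_natCast (m : ℕ) : sg m = (-1) ^ m := by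
  induction m with
  | zero => exact sg_zero
  | succ m ih => rw [Nat.cast_succ, sg_add, ih, sg_one, pow_succ]

theorem sg_smul_sg_smul {M : Type*} [AddCommGroup M] (a : ℤ) (x : M) : sg a • sg a • x = x := by
  rw [smul_smul, sg_mul_self, one_smul]

theorem neg_one_pow_smul {k M : Type*} [Field k] [AddCommGroup M] [Module k M] (m : ℕ) (x : M) :
    ((-1 : k) ^ m) • x = sg m • x := by
  rw [sg_natCast, ← Int.cast_smul_eq_zsmul k]
  simp

/-- The sign `∏_{i < j} (-1)^{p_i e_j}`. -/
def pairSign {r : ℕ} (p e : Fin r → ℤ) : ℤ := ∏ i, ∏ j, if i < j then sg (p i * e j) else 1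

theorem pairSign_succ {r : ℕ} (p e : Fin (r + 1) → ℤ) : pairSign p e =
    (∏ j : Fin r, sg (p 0 * e j.succ)) * pairSign (fun j => p j.succ) fun j => e j.succ := by
  rw [pairSign, Fin.prod_univ_succ, pairSign]
  simp [Fin.prod_univ_succ]

/-! ### Multilinear maps on spans -/

theorem MultilinearMap.eq_zero_of_mem_span {k V W ι : Type*} [Field k] [AddCommGroup V]
    [Module k V] [AddCommGroup W] [Module k W] [Fintype ι]
    (f : MultilinearMap k (fun _ : ι => V) W) (P : ι → Set V)
    (h : ∀ v : ι → V, (∀ i, v i ∈ P i) → f v = 0) (v : ι → V)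
    (hv : ∀ i, v i ∈ Submodule.span k (P i)) : f v = 0 := by
  classical
  have h1 : ∀ i, ∃ (m : ℕ) (c : Fin m → k) (z : Fin m → P i), ∑ j, c j • (z j : V) = v i :=
    fun i => Submodule.mem_span_set'.1 (hv i)
  choose m c z hz using h1
  have h2 : v = fun i => ∑ j, c i j • (z i j : V) := funext fun i => (hz i).symm
  rw [h2, f.map_sum]
  refine Finset.sum_eq_zero fun r _ => ?_
  rw [f.map_smul_univ, h _ fun i => (z i (r i)).2, smul_zero]

theorem MultilinearMap.mem_of_mem_span {k V W ι : Type*} [Field k] [AddCommGroup V]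
    [Module k V] [AddCommGroup W] [Module k W] [Fintype ι]
    (f : MultilinearMap k (fun _ : ι => V) W) (P : ι → Set V) (S : Submodule k W)
    (h : ∀ v : ι → V, (∀ i, v i ∈ P i) → f v ∈ S) (v : ι → V)
    (hv : ∀ i, v i ∈ Submodule.span k (P i)) : f v ∈ S := by
  have := (S.mkQ.compMultilinearMap f).eq_zero_of_mem_span P (fun v hv => by
    simpa using h v hv) v hv
  simpa using this

/-! ### Products of homogeneous forms -/

namespace PolyForms

variable {k : Type*} [Field k] {σ : Type*} [Fintype σ] [DecidableEq σ]

theorem parity_X_mul (i : σ) (a : PolyForms k σ) : parity k σ (ofPoly k (MvPolynomial.X i) * a) =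
    ofPoly k (MvPolynomial.X i) * parity k σ a := by
  induction a using TensorProduct.induction_on with
  | zero => simp
  | add x y hx hy => simp only [mul_add, map_add, hx, hy]
  | tmul f l => simp [ofPoly_mul_tmul, parity]

theorem parity_dX_mul (i : σ) (a : PolyForms k σ) : parity k σ (dX k i * a) =
    -(dX k i * parity k σ a) := by
  induction a using TensorProduct.induction_on with
  | zero => simp
  | add x y hx hy => simp only [mul_add, map_add, hx, hy, neg_add]
  | tmul f l =>
    simp only [dX_mul_tmul, parity, TensorProduct.map_tmul, AlgHom.toLinearMap_apply, map_mul,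
      LinearMap.id_apply]
    rw [show CliffordAlgebra.involute (ExteriorAlgebra.ι k (Pi.single i (1 : k) : σ → k)) =
      -(ExteriorAlgebra.ι k (Pi.single i (1 : k) : σ → k)) from CliffordAlgebra.involute_ι _,
      neg_mul, TensorProduct.tmul_neg]

theorem d_mul (a b : PolyForms k σ) :
    d k σ (a * b) = d k σ a * b + parity k σ a * d k σ b := by
  have : ∀ b, d k σ ∘ₗ LinearMap.mulRight k b =
      LinearMap.mulRight k b ∘ₗ d k σ + LinearMap.mulRight k (d k σ b) ∘ₗ parity k σ := by
    intro b
    refine linearMap_ext ?_ (fun i ω h => ?_) (fun i ω h => ?_)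
    · have h1 := parity_of_mem_gr (one_mem_gr (k := k) (σ := σ))
      rw [pow_zero, one_smul] at h1
      simp [d_one, h1]
    · simp only [LinearMap.comp_apply, LinearMap.add_apply, LinearMap.mulRight_apply] at h ⊢
      rw [mul_assoc, d_ofPoly_mul, h, d_ofPoly_mul, parity_X_mul, mul_add, add_mul, mul_assoc,
        mul_assoc, mul_assoc, add_assoc]
    · simp only [LinearMap.comp_apply, LinearMap.add_apply, LinearMap.mulRight_apply] at h ⊢
      rw [mul_assoc, d_dX_mul, h, d_dX_mul, parity_dX_mul, mul_add, neg_mul', neg_mul', mul_assoc,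
        mul_assoc, neg_add]
  exact LinearMap.congr_fun (this b) a

theorem mul_comm_sg {p q : ℕ} {a b : PolyForms k σ} (ha : a ∈ gr k σ p) (hb : b ∈ gr k σ q) :
    a * b = sg (p * q) • (b * a) := by
  rw [mul_comm_of_mem_gr ha hb, ← Nat.cast_mul]
  exact neg_one_pow_smul (k := k) (M := PolyForms k σ) _ _

theorem parity_sg {p : ℕ} {a : PolyForms k σ} (ha : a ∈ gr k σ p) : parity k σ a = sg p • a := by
  rw [parity_of_mem_gr ha]
  exact neg_one_pow_smul (k := k) (M := PolyForms k σ) _ _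

theorem prod_ofFn_mem_gr {r : ℕ} {p : Fin r → ℕ} {a : Fin r → PolyForms k σ}
    (ha : ∀ j, a j ∈ gr k σ (p j)) : (List.ofFn a).prod ∈ gr k σ (∑ j, p j) := by
  induction r with
  | zero => simpa using one_mem_gr
  | succ r ih =>
    rw [List.ofFn_succ, List.prod_cons, Fin.sum_univ_succ]
    exact mul_mem_gr (ha 0) (ih fun j => ha j.succ)

theorem d_prod_ofFn {r : ℕ} {p : Fin r → ℕ} {a : Fin r → PolyForms k σ}
    (ha : ∀ j, a j ∈ gr k σ (p j)) : d k σ (List.ofFn a).prod =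
      ∑ j, (∏ l, if l < j then sg (p l) else 1) •
        (List.ofFn (Function.update a j (d k σ (a j)))).prod := by
  induction r with
  | zero => simp [d_one]
  | succ r ih =>
    have h1 : ∀ b, List.ofFn (Function.update a 0 b) = b :: List.ofFn fun j => a j.succ := by
      intro b
      rw [List.ofFn_succ, Function.update_self]
      congr 2
    have h2 : ∀ (j : Fin r) b, List.ofFn (Function.update a j.succ b) =
        a 0 :: List.ofFn (Function.update (fun j => a j.succ) j b) := by
      intro j b
      rw [List.ofFn_succ, Function.update_of_ne (Fin.succ_ne_zero j).symm]
      congr 2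
      ext1 l
      by_cases h : l = j
      · subst h; simp
      · rw [Function.update_of_ne h, Function.update_of_ne (fun h' => h (Fin.succ_injective _ h'))]
    rw [List.ofFn_succ, List.prod_cons, d_mul, ih fun j => ha j.succ, Fin.sum_univ_succ,
      parity_sg (ha 0), h1, List.prod_cons]
    simp only [h2, List.prod_cons, Fin.prod_univ_succ, Fin.succ_lt_succ_iff, Fin.succ_pos, if_true,
      Fin.not_lt_zero, if_false, Finset.prod_const_one, one_smul]
    congr 1
    rw [Finset.mul_sum]
    refine Finset.sum_congr rfl fun j _ => ?_
    rw [smul_mul_assoc, mul_smul_comm, smul_smul]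

end PolyForms

/-! ### Brackets of pure tensors -/

namespace LInftyAlgebra

open PolyForms

variable {k g : Type*} [Field k] [CharZero k] [AddCommGroup g] [Module k g]
  (L : LInftyAlgebra k g) (n : ℕ)

theorem parity_sg {i : ℤ} {x : g} (hx : x ∈ L.deg i) : L.parity x = sg i • x :=
  L.parity_apply hx

theorem leftMul_tmul (a b : Sullivan k n) (x : g) : leftMul n a (x ⊗ₜ[k] b) = x ⊗ₜ (a * b) := by
  simp [leftMul]

theorem twist_apply (r : ℕ) (M : MultilinearMap k (fun _ : Fin r => g) g) (e : Fin r → ℤ)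
    (x : Fin r → g) (hx : ∀ j, x j ∈ L.deg (e j)) :
    L.twist r M x = (∏ j, sg (e j)) • M x := by
  have : L.twist r M x = M fun j => L.parity (x j) := rfl
  rw [this]
  simp only [fun j => L.parity_sg (hx j), ← Int.cast_smul_eq_zsmul k]
  rw [M.map_smul_univ, Int.cast_prod]

theorem extend_tmul (r : ℕ) (M : MultilinearMap k (fun _ : Fin r => g) g) (p : Fin r → ℕ)
    (e : Fin r → ℤ) (x : Fin r → g) (a : Fin r → Sullivan k n) (hx : ∀ j, x j ∈ L.deg (e j))
    (ha : ∀ j, a j ∈ gr k (Fin n) (p j)) :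
    L.extend n r M (fun j => x j ⊗ₜ a j) =
      pairSign (fun j => p j) e • (M x ⊗ₜ (List.ofFn a).prod) := by
  induction r with
  | zero =>
    have : x = Fin.elim0 := Subsingleton.elim _ _
    subst this
    simp only [pairSign, Finset.univ_eq_empty, Finset.prod_empty, one_smul, List.ofFn_zero,
      List.prod_nil]
    rfl
  | succ r ih =>
    have h1 : (fun j => x j ⊗ₜ[k] a j) =
        Fin.cons (x 0 ⊗ₜ a 0) fun j : Fin r => x j.succ ⊗ₜ[k] a j.succ := by
      rw [← Fin.cons_self_tail fun j => x j ⊗ₜ[k] a j]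
      rfl
    have h2 : M.curryLeft (x 0) (fun j => x j.succ) = M x := by
      rw [MultilinearMap.curryLeft_apply]
      congr 1
      exact Fin.cons_self_tail x
    have h3 := fun N => ih N (fun j => p j.succ) (fun j => e j.succ) (fun j => x j.succ)
      (fun j => a j.succ) (fun j => hx j.succ) (fun j => ha j.succ)
    have hp : PolyForms.parity k (Fin n) (a 0) = sg (p 0) • a 0 := PolyForms.parity_sg (ha 0)
    rw [h1, extend_succ_tmul, h3, h3, L.twist_apply r _ (fun j => e j.succ) _ fun j => hx j.succ,
      h2, pairSign_succ, List.ofFn_succ, List.prod_cons]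
    have half : (2 : k)⁻¹ • a 0 + (2 : k)⁻¹ • a 0 = a 0 := by
      rw [← add_smul, ← two_mul, mul_inv_cancel₀ two_ne_zero, one_smul]
    rcases Nat.even_or_odd (p 0) with h | h
    · have hs : sg (p 0) = 1 := by rw [sg_congr (b := 0) (by simpa using h), sg_zero]
      have e1 : evenPart k (Fin n) (a 0) = a 0 := by
        simp [evenPart, hp, hs, half]
      have e2 : oddPart k (Fin n) (a 0) = 0 := by
        simp [oddPart, hp, hs]
      have e3 : ∏ j : Fin r, sg (p 0 * e j.succ) = 1 := Finset.prod_eq_one fun j _ => by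
        rw [sg_congr (b := 0), sg_zero]
        simpa using Even.mul_right ((Int.even_coe_nat _).2 h) _
      rw [e1, e2, map_zero, LinearMap.zero_apply, add_zero, map_zsmul, leftMul_tmul, e3, one_mul]
    · have hs : sg (p 0) = -1 := by
        rw [sg_congr (b := 1), sg_one]
        obtain ⟨m, hm⟩ := h
        exact ⟨m, by rw [hm]; push_cast; ring⟩
      have e1 : evenPart k (Fin n) (a 0) = 0 := by
        simp [evenPart, hp, hs]
      have e2 : oddPart k (Fin n) (a 0) = a 0 := by
        simp [oddPart, hp, hs, half]
      have e3 : ∏ j : Fin r, sg (p 0 * e j.succ) = ∏ j : Fin r, sg (e j.succ) :=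
        Finset.prod_congr rfl fun j _ => by
          refine sg_congr ?_
          obtain ⟨m, hm⟩ := h
          exact ⟨m * e j.succ, by rw [hm]; push_cast; ring⟩
      rw [e1, e2, map_zero, LinearMap.zero_apply, zero_add, map_zsmul, ← TensorProduct.smul_tmul',
        map_zsmul, leftMul_tmul, e3, smul_smul, mul_comm]

end LInftyAlgebra

/-! ### Adjacent transpositions -/

section Swap

theorem swap_succ_comp {r : ℕ} {α : Type*} (i j : Fin r) (f : Fin (r + 1) → α) :
    (fun l : Fin r => (f ∘ Equiv.swap i.succ j.succ) l.succ) =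
      (fun l : Fin r => f l.succ) ∘ Equiv.swap i j := by
  ext1 l
  simp only [Function.comp_apply]
  rw [(Fin.succ_injective r).swap_apply]

theorem swap_succ_zero {r : ℕ} {α : Type*} (i j : Fin r) (f : Fin (r + 1) → α) :
    (f ∘ Equiv.swap i.succ j.succ) 0 = f 0 := by
  rw [Function.comp_apply, Equiv.swap_apply_of_ne_of_ne (Fin.succ_ne_zero i).symm
    (Fin.succ_ne_zero j).symm]

theorem swap_zero_one_comp {r : ℕ} {α : Type*} (f : Fin (r + 2) → α) (l : Fin r) :
    (f ∘ Equiv.swap 0 1) l.succ.succ = f l.succ.succ := by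
  rw [Function.comp_apply, Equiv.swap_apply_of_ne_of_ne (Fin.succ_ne_zero _)]
  rw [← Fin.succ_zero_eq_one]
  exact fun h => Fin.succ_ne_zero _ (Fin.succ_injective _ h)

/-- Induction on the position of an adjacent transposition. -/
theorem adjacent_induction {C : ∀ r : ℕ, Fin r → Fin r → Prop}
    (zero : ∀ r, C (r + 2) 0 1) (succ : ∀ r i j, C r i j → C (r + 1) i.succ j.succ) {r : ℕ}
    (i j : Fin r) (h : (j : ℕ) = i + 1) : C r i j := by
  induction r with
  | zero => exact i.elim0
  | succ r ih =>
    cases j using Fin.cases with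
    | zero => simp at h
    | succ j =>
      cases i using Fin.cases with
      | succ i => exact succ r i j (ih i j (by simpa using h))
      | zero =>
        cases r with
        | zero => exact j.elim0
        | succ r =>
          have : j = 0 := Fin.ext (by simpa using h)
          subst this
          exact zero r

theorem pairSign_swap {r : ℕ} (i j : Fin r) (h : (j : ℕ) = i + 1) : ∀ p e : Fin r → ℤ,
    pairSign (p ∘ Equiv.swap i j) (e ∘ Equiv.swap i j) * sg (p i * e j) =
      pairSign p e * sg (p j * e i) := by
  refine adjacent_induction (C := fun r i j => ∀ p e : Fin r → ℤ,
    pairSign (p ∘ Equiv.swap i j) (e ∘ Equiv.swap i j) * sg (p i * e j) =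
      pairSign p e * sg (p j * e i)) (fun r p e => ?_) (fun r i j ih p e => ?_) i j h
  · rw [pairSign_succ, pairSign_succ, pairSign_succ p, pairSign_succ fun j : Fin (r + 1) => p j.succ]
    simp only [Fin.prod_univ_succ, swap_zero_one_comp]
    simp only [Function.comp_apply, Equiv.swap_apply_left, Fin.succ_zero_eq_one,
      Equiv.swap_apply_right]
    ring
  · rw [pairSign_succ, pairSign_succ p, swap_succ_comp, swap_succ_comp, swap_succ_zero, mul_assoc,
      ih, mul_assoc]
    congr 1
    rw [← Equiv.prod_comp (Equiv.swap i j) fun l => sg (p 0 * e l.succ)]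
    exact Finset.prod_congr rfl fun l _ => by
      rw [show (e ∘ Equiv.swap i.succ j.succ) l.succ = e (Equiv.swap i j l).succ from
        congrFun (swap_succ_comp i j e) l]

theorem prod_ofFn_swap {k σ : Type*} [Field k] [Fintype σ] [DecidableEq σ] {r : ℕ} (i j : Fin r)
    (h : (j : ℕ) = i + 1) : ∀ (p : Fin r → ℕ) (a : Fin r → PolyForms k σ),
    (∀ l, a l ∈ PolyForms.gr k σ (p l)) →
    (List.ofFn (a ∘ Equiv.swap i j)).prod = sg (p i * p j) • (List.ofFn a).prod := by
  refine adjacent_induction (C := fun r i j => ∀ (p : Fin r → ℕ) (a : Fin r → PolyForms k σ),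
    (∀ l, a l ∈ PolyForms.gr k σ (p l)) →
    (List.ofFn (a ∘ Equiv.swap i j)).prod = sg (p i * p j) • (List.ofFn a).prod)
    (fun r p a ha => ?_) (fun r i j ih p a ha => ?_) i j h
  · rw [List.ofFn_succ, List.ofFn_succ, List.ofFn_succ, List.ofFn_succ (f := fun i => a i.succ)]
    simp only [List.prod_cons, swap_zero_one_comp]
    simp only [Function.comp_apply, Equiv.swap_apply_left, Fin.succ_zero_eq_one,
      Equiv.swap_apply_right]
    rw [← mul_assoc, ← mul_assoc, PolyForms.mul_comm_sg (ha 1) (ha 0), smul_mul_assoc, mul_comm]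
  · rw [List.ofFn_succ, List.ofFn_succ, List.prod_cons, List.prod_cons, swap_succ_comp,
      swap_succ_zero, ih _ _ fun l => ha l.succ, mul_smul_comm]

end Swap

namespace LInftyAlgebra

open PolyForms

variable {k g : Type*} [Field k] [AddCommGroup g] [Module k g]
  (L : LInftyAlgebra k g) (n : ℕ)

/-! ### The filtration and the grading of `g ⊗ Ω_n` -/

/-- The pure tensors of degree `q`. -/
def pureDeg (q : ℤ) : Set (g ⊗[k] Sullivan k n) :=
  {z | ∃ (i : ℤ) (p : ℕ) (x : g) (a : Sullivan k n),
    i + p = q ∧ x ∈ L.deg i ∧ a ∈ PolyForms.gr k (Fin n) p ∧ z = x ⊗ₜ a}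

/-- The elements of degree `q` of `g ⊗ Ω_n`. -/
def formDeg (q : ℤ) : Submodule k (g ⊗[k] Sullivan k n) := Submodule.span k (L.pureDeg n q)

/-- The homogeneous pure tensors `x ⊗ a` with `x` a bracketing of at least `c` elements. -/
def pureF (c : ℕ) : Set (g ⊗[k] Sullivan k n) :=
  {z | ∃ (m p : ℕ) (x : g) (a : Sullivan k n),
    c ≤ m ∧ L.IsBracketing m x ∧ a ∈ PolyForms.gr k (Fin n) p ∧ z = x ⊗ₜ a}

theorem tmul_mem_formF {c : ℕ} {x : g} (hx : x ∈ L.F c) (a : Sullivan k n) :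
    x ⊗ₜ a ∈ L.formF n c := ⟨⟨x, hx⟩ ⊗ₜ a, by simp⟩

theorem formF_eq_span (c : ℕ) : L.formF n c = Submodule.span k (L.pureF n c) := by
  apply le_antisymm
  · rintro _ ⟨z, rfl⟩
    induction z using TensorProduct.induction_on with
    | zero => simp
    | add x y hx hy => rw [map_add]; exact add_mem hx hy
    | tmul x a =>
      rw [LinearMap.rTensor_tmul, Submodule.subtype_apply]
      obtain ⟨x, hx⟩ := x
      simp only
      induction hx using Submodule.span_induction with
      | mem x h =>
        obtain ⟨m, hm, hx⟩ := h
        refine gr_induction (S := (Submodule.span k (L.pureF n c)).comap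
          (TensorProduct.mk k g (Sullivan k n) x)) (fun p a ha => ?_) a
        exact Submodule.subset_span ⟨m, p, x, a, hm, hx, ha, rfl⟩
      | zero => simp
      | add x y _ _ hx hy => rw [TensorProduct.add_tmul]; exact add_mem hx hy
      | smul r x _ hx => rw [← TensorProduct.smul_tmul']; exact Submodule.smul_mem _ _ hx
  · refine Submodule.span_le.2 ?_
    rintro _ ⟨m, p, x, a, hm, hx, -, rfl⟩
    exact L.tmul_mem_formF n (Submodule.subset_span ⟨m, hm, hx⟩) a

theorem formF_one : L.formF n 1 = ⊤ := by
  have hF : L.F 1 = ⊤ := by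
    rw [eq_top_iff]
    intro x _
    have : x ∈ ⨆ i, L.deg i := by
      rw [L.isInternal.submodule_iSup_eq_top]
      trivial
    refine (iSup_le fun i => ?_ : ⨆ i, L.deg i ≤ L.F 1) this
    exact fun y hy => Submodule.subset_span ⟨1, le_rfl, .leaf i y hy⟩
  rw [eq_top_iff]
  intro z _
  induction z using TensorProduct.induction_on with
  | zero => simp
  | add x y hx hy => exact add_mem (hx trivial) (hy trivial)
  | tmul x a => exact L.tmul_mem_formF n (by rw [hF]; trivial) a

variable [CharZero k]

theorem formBracket_tmul (r : ℕ) (p : Fin r → ℕ) (e : Fin r → ℤ) (x : Fin r → g)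
    (a : Fin r → Sullivan k n) (hx : ∀ j, x j ∈ L.deg (e j))
    (ha : ∀ j, a j ∈ gr k (Fin n) (p j)) :
    L.formBracket n r (fun j => x j ⊗ₜ a j) =
      pairSign (fun j => p j) e • (L.bracket r x ⊗ₜ (List.ofFn a).prod) :=
  L.extend_tmul n r _ p e x a hx ha

theorem formBracket_zero : L.formBracket n 0 = 0 := by
  rw [formBracket, bracket_zero, map_zero]

theorem formBracket_mem_formF (r : ℕ) (c : Fin r → ℕ) (z : Fin r → g ⊗[k] Sullivan k n)
    (hz : ∀ j, z j ∈ L.formF n (c j)) : L.formBracket n r z ∈ L.formF n (∑ j, c j) := by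
  rcases Nat.eq_zero_or_pos r with rfl | hr
  · rw [formBracket_zero]
    exact zero_mem _
  refine (L.formBracket n r).mem_of_mem_span (fun j => L.pureF n (c j)) _ (fun v hv => ?_) z
    fun j => by rw [← formF_eq_span]; exact hz j
  choose m p x a hm hx ha hv using hv
  choose e he using fun j => IsBracketing.homogeneous L (hx j)
  obtain rfl : v = fun j => x j ⊗ₜ a j := funext hv
  rw [L.formBracket_tmul n r p e x a he ha]
  refine zsmul_mem (L.tmul_mem_formF n (Submodule.subset_span ⟨∑ j, m j, ?_, ?_⟩) _) _
  · exact Finset.sum_le_sum fun j _ => hm j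
  · exact .node r m x hr hx

theorem formBracket_mem_formDeg (r : ℕ) (q : Fin r → ℤ) (z : Fin r → g ⊗[k] Sullivan k n)
    (hz : ∀ j, z j ∈ L.formDeg n (q j)) :
    L.formBracket n r z ∈ L.formDeg n (∑ j, q j + 2 - r) := by
  refine (L.formBracket n r).mem_of_mem_span (fun j => L.pureDeg n (q j)) _ (fun v hv => ?_) z hz
  choose e p x a hq hx ha hv using hv
  obtain rfl : v = fun j => x j ⊗ₜ a j := funext hv
  rw [L.formBracket_tmul n r p e x a hx ha]
  refine zsmul_mem (?_ : _ ∈ L.formDeg n _) _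
  refine Submodule.subset_span ⟨_, _, _, _, ?_, L.bracket_mem r e x hx,
    prod_ofFn_mem_gr ha, rfl⟩
  rw [← Finset.sum_congr rfl fun j _ => hq j, Finset.sum_add_distrib]
  push_cast
  ring

/-! ### Antisymmetry -/

theorem formBracket_swap {r : ℕ} (q : Fin r → ℤ) (z : Fin r → g ⊗[k] Sullivan k n)
    (hz : ∀ j, z j ∈ L.formDeg n (q j)) (i j : Fin r) (h : (j : ℕ) = i + 1) :
    L.formBracket n r (z ∘ Equiv.swap i j) = -(sg (q i * q j) • L.formBracket n r z) := by
  have key := ((L.formBracket n r).domDomCongr (Equiv.swap i j) +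
    sg (q i * q j) • L.formBracket n r).eq_zero_of_mem_span (fun j => L.pureDeg n (q j))
    (fun v hv => ?_) z hz
  · rw [← add_eq_zero_iff_eq_neg]
    exact key
  · choose e p x a hq hx ha hv using hv
    obtain rfl : v = fun j => x j ⊗ₜ a j := funext hv
    change L.formBracket n r (fun l => (x ∘ Equiv.swap i j) l ⊗ₜ (a ∘ Equiv.swap i j) l) +
      sg (q i * q j) • L.formBracket n r (fun j => x j ⊗ₜ a j) = 0
    rw [L.formBracket_tmul n r (p ∘ Equiv.swap i j) (e ∘ Equiv.swap i j) (x ∘ Equiv.swap i j)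
      (a ∘ Equiv.swap i j) (fun l => hx _) fun l => ha _, L.formBracket_tmul n r p e x a hx ha, L.bracket_swap r e x hx i j h,
      prod_ofFn_swap i j h p a ha]
    have h1 := pairSign_swap i j h (fun l => (p l : ℤ)) e
    have h2 : pairSign (fun l => ((p ∘ Equiv.swap i j) l : ℤ)) (e ∘ Equiv.swap i j) =
        pairSign (fun l => (p l : ℤ)) e * (sg (p j * e i) * sg (p i * e j)) := by
      rw [← mul_assoc, ← h1, mul_assoc, sg_mul_self, mul_one]
      rfl
    rw [h2]
    change _ • ((-(sg (e i * e j) • L.bracket r x)) ⊗ₜ (sg (p i * p j) • (List.ofFn a).prod)) + _ = 0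
    rw [TensorProduct.neg_tmul]
    have h3 : (sg (e i * e j) • L.bracket r x) ⊗ₜ[k] (sg (p i * p j) • (List.ofFn a).prod) =
        (sg (e i * e j) * sg (p i * p j)) • (L.bracket r x ⊗ₜ[k] (List.ofFn a).prod) := by
      rw [← Int.cast_smul_eq_zsmul k, ← Int.cast_smul_eq_zsmul k, TensorProduct.smul_tmul_smul,
        ← Int.cast_mul, Int.cast_smul_eq_zsmul]
    have h4 : sg (q i * q j) = sg (p j * e i) * sg (p i * e j) * (sg (e i * e j) * sg (p i * p j)) := by
      rw [← sg_add, ← sg_add, ← sg_add, ← hq, ← hq]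
      congr 1
      ring
    rw [h3, smul_neg, smul_smul, smul_smul, h4, neg_add_eq_zero]
    congr 1
    ring

theorem formBracket_update {s : ℕ} {q : ℤ} {x w : g ⊗[k] Sullivan k n} (hx : x ∈ L.formDeg n 1)
    (hw : w ∈ L.formDeg n q) (hq : sg q = 1) (j : Fin (s + 1)) :
    L.formBracket n (s + 1) (Function.update (fun _ => x) j w) =
      sg j • L.formBracket n (s + 1) (Fin.cons w fun _ => x) := by
  induction j using Fin.induction with
  | zero =>
    rw [Fin.val_zero, Nat.cast_zero, sg_zero, one_smul]
    congr 1
    ext1 l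
    cases l using Fin.cases <;> simp
  | succ j ih =>
    have h1 := L.formBracket_swap n (Function.update (fun _ => 1) j.castSucc q)
      (Function.update (fun _ => x) j.castSucc w) (fun l => by
        by_cases h : l = j.castSucc
        · subst h; simpa using hw
        · simpa [Function.update_of_ne h] using hx) j.castSucc j.succ (by simp)
    have h2 : Function.update (fun _ => x) j.castSucc w ∘ Equiv.swap j.castSucc j.succ =
        Function.update (fun _ => x) j.succ w := by
      ext1 l
      have hne : j.succ ≠ j.castSucc := fun h => by simpa using congrArg Fin.val h
      by_cases h : l = j.succ
      · subst h; simp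
      · by_cases h' : l = j.castSucc
        · subst h'
          simp [Function.update_of_ne hne, Function.update_of_ne hne.symm]
        · simp [Equiv.swap_apply_of_ne_of_ne h' h, Function.update_of_ne h,
            Function.update_of_ne h']
    have hne : j.succ ≠ j.castSucc := fun h => by simpa using congrArg Fin.val h
    rw [h2, ih, Function.update_self, Function.update_of_ne hne, mul_one, hq, one_smul] at h1
    rw [h1, Fin.val_succ, Nat.cast_succ, sg_add, sg_one, mul_neg_one, neg_smul]
    rfl

/-! ### The differential of forms -/

/-- The differential `x ⊗ a ↦ (-1)^|x| x ⊗ da` of `g ⊗ Ω_n`. -/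
def formDeRham : g ⊗[k] Sullivan k n →ₗ[k] g ⊗[k] Sullivan k n :=
  TensorProduct.map L.parity (PolyForms.d k (Fin n))

theorem formDeRham_tmul {i : ℤ} {x : g} (hx : x ∈ L.deg i) (a : Sullivan k n) :
    L.formDeRham n (x ⊗ₜ a) = (sg i • x) ⊗ₜ PolyForms.d k (Fin n) a := by
  rw [formDeRham, TensorProduct.map_tmul, L.parity_sg hx]

theorem formDeRham_mem {q : ℤ} {x : g ⊗[k] Sullivan k n} (hx : x ∈ L.formDeg n q) :
    L.formDeRham n x ∈ L.formDeg n (q + 1) := by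
  have : L.formDeg n q ≤ (L.formDeg n (q + 1)).comap (L.formDeRham n) := by
    refine Submodule.span_le.2 ?_
    rintro _ ⟨i, p, x, a, rfl, hx, ha, rfl⟩
    change L.formDeRham n (x ⊗ₜ a) ∈ L.formDeg n _
    rw [L.formDeRham_tmul n hx]
    refine Submodule.subset_span ⟨i, p + 1, _, _, ?_, zsmul_mem hx _, d_mem_gr ha, rfl⟩
    push_cast
    ring
  exact this hx

theorem pairSign_update {r : ℕ} (p e : Fin r → ℤ) (j : Fin r) :
    pairSign (Function.update p j (p j + 1)) e =
      pairSign p e * ∏ l, if j < l then sg (e l) else 1 := by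
  rw [pairSign, pairSign, ← Finset.mul_prod_erase _ _ (Finset.mem_univ j),
    ← Finset.mul_prod_erase _ (fun i => ∏ l, if i < l then sg (p i * e l) else 1)
      (Finset.mem_univ j), mul_right_comm, ← Finset.prod_mul_distrib]
  congr 1
  · refine Finset.prod_congr rfl fun l _ => ?_
    rw [Function.update_self]
    split_ifs
    · rw [add_mul, one_mul, sg_add]
    · rfl
  · refine Finset.prod_congr rfl fun i hi => ?_
    rw [Function.update_of_ne (Finset.ne_of_mem_erase hi)]

theorem formDeRham_formBracket (r : ℕ) (z : Fin r → g ⊗[k] Sullivan k n)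
    (hz : ∀ j, z j ∈ L.formDeg n 1) : L.formDeRham n (L.formBracket n r z) =
      ∑ j : Fin r, sg (r + j) • L.formBracket n r (Function.update z j (L.formDeRham n (z j))) := by
  classical
  have key := ((L.formDeRham n).compMultilinearMap (L.formBracket n r) - ∑ j : Fin r,
    sg (r + j) • (L.formBracket n r).compLinearMap fun l =>
      if l = j then L.formDeRham n else LinearMap.id).eq_zero_of_mem_span
        (fun j => L.pureDeg n 1) (fun v hv => ?_) z hz
  · rw [sub_apply, sub_eq_zero, LinearMap.compMultilinearMap_apply] at key
    rw [key, sum_apply]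
    refine Finset.sum_congr rfl fun j _ => ?_
    change sg _ • L.formBracket n r _ = _
    congr 2
    ext1 l
    by_cases h : l = j
    · subst h; simp
    · simp [h]
  · choose e p x a hq hx ha hv using hv
    obtain rfl : v = fun j => x j ⊗ₜ a j := funext hv
    rw [sub_apply, sub_eq_zero, LinearMap.compMultilinearMap_apply, sum_apply,
      L.formBracket_tmul n r p e x a hx ha, map_zsmul,
      L.formDeRham_tmul n (L.bracket_mem r e x hx), d_prod_ofFn ha, TensorProduct.tmul_sum,
      Finset.smul_sum]
    refine Finset.sum_congr rfl fun j _ => ?_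
    change _ = sg (r + j) • L.formBracket n r (fun l => (if l = j then L.formDeRham n else
      LinearMap.id) (x l ⊗ₜ a l))
    have h1 : (fun l => (if l = j then L.formDeRham n else LinearMap.id) (x l ⊗ₜ[k] a l)) =
        fun l => (if l = j then sg (e j) • x l else x l) ⊗ₜ[k] Function.update a j (d k _ (a j)) l := by
      ext1 l
      by_cases h : l = j
      · subst h
        rw [if_pos rfl, if_pos rfl, L.formDeRham_tmul n (hx l), Function.update_self]
      · rw [if_neg h, if_neg h, Function.update_of_ne h]
        rfl
    have h2 : (fun l => if l = j then sg (e j) • x l else x l) =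
        fun l => (if l = j then (sg (e j) : k) else 1) • x l := by
      ext1 l
      by_cases h : l = j
      · rw [if_pos h, if_pos h, Int.cast_smul_eq_zsmul]
      · rw [if_neg h, if_neg h, one_smul]
    have h3 : (fun l => ((Function.update p j (p j + 1) l : ℕ) : ℤ)) =
        Function.update (fun l => (p l : ℤ)) j (p j + 1) := by
      ext1 l
      by_cases h : l = j
      · subst h; simp
      · simp [Function.update_of_ne h]
    rw [h1, L.formBracket_tmul n r (Function.update p j (p j + 1)) e _ _ ?_ ?_, h2,
      MultilinearMap.map_smul_univ, Finset.prod_ite_eq' Finset.univ j, if_pos (Finset.mem_univ j), h3,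
      pairSign_update]
    · have h4 : (sg (∑ l, e l + 2 - r) : ℤ) * (∏ l, if l < j then sg (p l) else 1) =
          sg (r + j) * (∏ l, if j < l then sg (e l) else 1) * sg (e j) := by
        have e1 : sg (∑ l, e l + 2 - r) = (∏ l, sg (e l)) * sg r := by
          rw [← sg_sum, ← sg_add]
          exact sg_congr ⟨1 - r, by ring⟩
        have e2 : (∏ l, sg (e l)) * (∏ l, if l < j then sg (p l) else 1) =
            (∏ l, if l < j then (-1 : ℤ) else 1) * (∏ l, if j < l then sg (e l) else 1) *
              ∏ l, if l = j then sg (e l) else 1 := by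
          rw [← Finset.prod_mul_distrib, ← Finset.prod_mul_distrib, ← Finset.prod_mul_distrib]
          refine Finset.prod_congr rfl fun l _ => ?_
          rcases lt_trichotomy l j with h | h | h
          · rw [if_pos h, if_pos h, if_neg h.not_gt, if_neg h.ne, ← sg_add, hq, sg_one]
            rfl
          · subst h; simp
          · rw [if_neg h.not_gt, if_neg h.not_gt, if_pos h, if_neg h.ne']
            ring
        have e3 : ∏ l : Fin r, (if l < j then (-1 : ℤ) else 1) = sg j := by
          rw [Finset.prod_ite, Finset.prod_const, Finset.prod_const_one, mul_one, sg_natCast]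
          congr 1
          have : (Finset.univ.filter fun l : Fin r => l < j) = Finset.Iio j := by
            ext l; simp
          rw [this, Fin.card_Iio]
        rw [e1, mul_right_comm, e2, e3, Finset.prod_ite_eq' Finset.univ j,
          if_pos (Finset.mem_univ j), sg_add]
        ring
      simp only [← Int.cast_smul_eq_zsmul k, TensorProduct.tmul_smul, smul_smul,
        ← TensorProduct.smul_tmul', ← Int.cast_mul]
      congr 2
      linear_combination pairSign (fun j => (p j : ℤ)) e * h4
    · intro l
      by_cases h : l = j
      · subst h; rw [if_pos rfl]; exact zsmul_mem (hx l) _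
      · rw [if_neg h]; exact hx l
    · intro l
      by_cases h : l = j
      · subst h; simpa using d_mem_gr (ha l)
      · simpa [Function.update_of_ne h] using ha l

theorem formDeRham_formBracket_diag (s : ℕ) {x : g ⊗[k] Sullivan k n} (hx : x ∈ L.formDeg n 1) :
    L.formDeRham n (L.formBracket n (s + 1) fun _ => x) =
      sg (s + 1) • (s + 1) • L.formBracket n (s + 1) (Fin.cons (L.formDeRham n x) fun _ => x) := by
  rw [L.formDeRham_formBracket n _ _ fun _ => hx]
  have e : ∀ j : Fin (s + 1), sg (((s + 1 : ℕ) : ℤ) + j) • L.formBracket n (s + 1)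
      (Function.update (fun _ => x) j (L.formDeRham n x)) =
      sg (s + 1) • L.formBracket n (s + 1) (Fin.cons (L.formDeRham n x) fun _ => x) := fun j => by
    rw [L.formBracket_update n hx (L.formDeRham_mem n hx)
      (by rw [sg_congr (b := 0) (by decide), sg_zero]), smul_smul, sg_add, mul_assoc, sg_mul_self,
      mul_one]
    push_cast
    rfl
  rw [Finset.sum_congr rfl fun j _ => e j, Finset.sum_const, Finset.card_univ, Fintype.card_fin,
    smul_comm]

end LInftyAlgebra

/-! ### The Jacobi rules on `g ⊗ Ω_n` -/

section OrderedProd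

/-- The product of the `a i`, `i ∈ T`, in increasing order. -/
def orderedProd {ι Ω : Type*} [LinearOrder ι] [Ring Ω] (a : ι → Ω) (T : Finset ι) : Ω :=
  (T.sort.map a).prod

theorem prod_ofFn_orderEmbOfFin {ι Ω : Type*} [LinearOrder ι] [Ring Ω] (a : ι → Ω) (T : Finset ι) :
    (List.ofFn fun i => a (T.orderEmbOfFin rfl i)).prod = orderedProd a T := by
  rw [orderedProd, ← T.listMap_orderEmbOfFin_finRange rfl, List.map_map, List.ofFn_eq_map]
  rfl

theorem orderedProd_insert {ι Ω : Type*} [LinearOrder ι] [Ring Ω] (a : ι → Ω) {T : Finset ι}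
    {i : ι} (h : ∀ j ∈ T, i < j) : orderedProd a (insert i T) = a i * orderedProd a T := by
  rw [orderedProd, Finset.sort_insert _ (fun j hj => (h j hj).le) fun hi => lt_irrefl _ (h i hi),
    List.map_cons, List.prod_cons]
  rfl

theorem prod_orderEmbOfFin {ι M : Type*} [LinearOrder ι] [CommMonoid M] (f : ι → M)
    (T : Finset ι) : ∏ i, f (T.orderEmbOfFin rfl i) = ∏ i ∈ T, f i := by
  conv_rhs => rw [← T.map_orderEmbOfFin_univ rfl, Finset.prod_map]
  rfl

theorem pairSign_orderEmbOfFin {ι : Type*} [LinearOrder ι] (p e : ι → ℤ) (T : Finset ι) :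
    pairSign (fun i => p (T.orderEmbOfFin rfl i)) (fun i => e (T.orderEmbOfFin rfl i)) =
      ∏ i ∈ T, ∏ j ∈ T, if i < j then sg (p i * e j) else 1 := by
  rw [pairSign, ← prod_orderEmbOfFin fun i => ∏ j ∈ T, if i < j then sg (p i * e j) else 1]
  refine Finset.prod_congr rfl fun i _ => ?_
  rw [← prod_orderEmbOfFin fun j => if _ < j then sg (p _ * e j) else 1]
  refine Finset.prod_congr rfl fun j _ => ?_
  simp only [(T.orderEmbOfFin rfl).lt_iff_lt]

variable {k : Type*} [Field k] {σ ι : Type*} [Fintype σ] [DecidableEq σ] [LinearOrder ι]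

open PolyForms

theorem orderedProd_mem_gr {p : ι → ℕ} {a : ι → PolyForms k σ} (ha : ∀ i, a i ∈ gr k σ (p i))
    (T : Finset ι) : orderedProd a T ∈ gr k σ (∑ i ∈ T, p i) := by
  induction T using Finset.induction_on_min with
  | empty => simpa [orderedProd] using one_mem_gr
  | insert i T h ih =>
    rw [orderedProd_insert a h, Finset.sum_insert fun hi => lt_irrefl _ (h i hi)]
    exact mul_mem_gr (ha i) ih

theorem orderedProd_mul {p : ι → ℕ} {a : ι → PolyForms k σ} (ha : ∀ i, a i ∈ gr k σ (p i))
    (S T : Finset ι) : orderedProd a (T ∩ S) * orderedProd a (T \ S) =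
      (∏ i ∈ T ∩ S, ∏ j ∈ T \ S, if j < i then sg (p i * p j) else 1) • orderedProd a T := by
  induction T using Finset.induction_on_min with
  | empty => simp [orderedProd]
  | insert i T h ih =>
    have hi : i ∉ T := fun hi => lt_irrefl _ (h i hi)
    by_cases hS : i ∈ S
    · rw [Finset.insert_inter_of_mem hS, Finset.insert_sdiff_of_mem _ hS, orderedProd_insert a h,
        orderedProd_insert a fun j hj => h j (Finset.mem_of_mem_inter_left hj), mul_assoc, ih,
        mul_smul_comm, Finset.prod_insert fun hi' => hi (Finset.mem_of_mem_inter_left hi'),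
        Finset.prod_eq_one (s := T \ S), one_mul]
      intro j hj
      rw [if_neg (h j (Finset.mem_sdiff.1 hj).1).not_gt]
    · rw [Finset.insert_inter_of_notMem hS, Finset.insert_sdiff_of_notMem _ hS,
        orderedProd_insert a h, orderedProd_insert a fun j hj => h j (Finset.mem_sdiff.1 hj).1,
        ← mul_assoc, mul_comm_sg (orderedProd_mem_gr ha _) (ha i), smul_mul_assoc, mul_assoc, ih,
        mul_smul_comm, smul_smul, Nat.cast_sum, Finset.sum_mul, sg_sum, ← Finset.prod_mul_distrib]
      congr 1
      refine Finset.prod_congr rfl fun j hj => ?_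
      rw [Finset.prod_insert fun hi' => hi (Finset.mem_sdiff.1 hi').1,
        if_pos (h j (Finset.mem_of_mem_inter_left hj))]

theorem orderedProd_mul_compl [Fintype ι] {p : ι → ℕ} {a : ι → PolyForms k σ}
    (ha : ∀ i, a i ∈ gr k σ (p i)) (S : Finset ι) : orderedProd a S * orderedProd a Sᶜ =
      (∏ i ∈ S, ∏ j ∈ Sᶜ, if j < i then sg (p i * p j) else 1) • orderedProd a Finset.univ := by
  simpa [Finset.compl_eq_univ_sdiff] using orderedProd_mul ha S Finset.univ

end OrderedProd

/-- Compatibility of the Koszul signs of a composition of two brackets with the signs of the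
Jacobi rules. -/
theorem jacobi_sign {N : ℕ} (p e : Fin N → ℤ) (h : ∀ i, e i + p i = 1) (S : Finset (Fin N)) :
    (∏ i ∈ S, ∏ j ∈ S, if i < j then sg (p i * e j) else 1) *
      ((∏ j ∈ Sᶜ, sg ((∑ i ∈ S, p i) * e j)) *
        ∏ i ∈ Sᶜ, ∏ j ∈ Sᶜ, if i < j then sg (p i * e j) else 1) *
      (∏ i ∈ S, ∏ j ∈ Sᶜ, if j < i then sg (p i * p j) else 1) =
    pairSign p e * ∏ a ∈ S, ∏ b ∈ Sᶜ with b < a, sg (1 + e a * e b) := by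
  have h1 : ∏ j ∈ Sᶜ, sg ((∑ i ∈ S, p i) * e j) = ∏ i ∈ S, ∏ j ∈ Sᶜ, sg (p i * e j) := by
    rw [Finset.prod_comm]
    refine Finset.prod_congr rfl fun j _ => ?_
    rw [Finset.sum_mul, sg_sum]
  have h2 : pairSign p e = (∏ i ∈ S, ∏ j ∈ S, if i < j then sg (p i * e j) else 1) *
      (∏ i ∈ S, ∏ j ∈ Sᶜ, if i < j then sg (p i * e j) else 1) *
      ((∏ i ∈ S, ∏ j ∈ Sᶜ, if j < i then sg (p j * e i) else 1) *
        ∏ i ∈ Sᶜ, ∏ j ∈ Sᶜ, if i < j then sg (p i * e j) else 1) := by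
    rw [pairSign, ← Finset.prod_mul_prod_compl S, Finset.prod_comm (s := S) (t := Sᶜ)
      (f := fun i j => if j < i then sg (p j * e i) else 1), ← Finset.prod_mul_distrib,
      ← Finset.prod_mul_distrib]
    congr 1 <;> refine Finset.prod_congr rfl fun i _ => ?_ <;>
      rw [← Finset.prod_mul_prod_compl S]
  have h3 : (∏ i ∈ S, ∏ j ∈ Sᶜ, sg (p i * e j)) *
      (∏ i ∈ S, ∏ j ∈ Sᶜ, if j < i then sg (p i * p j) else 1) =
      (∏ i ∈ S, ∏ j ∈ Sᶜ, if i < j then sg (p i * e j) else 1) *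
      (∏ i ∈ S, ∏ j ∈ Sᶜ, if j < i then sg (p j * e i) else 1) *
      ∏ a ∈ S, ∏ b ∈ Sᶜ with b < a, sg (1 + e a * e b) := by
    simp only [Finset.prod_filter, ← Finset.prod_mul_distrib]
    refine Finset.prod_congr rfl fun i hi => Finset.prod_congr rfl fun j hj => ?_
    have hij : i ≠ j := fun h => (Finset.mem_compl.1 hj) (h ▸ hi)
    rcases lt_or_gt_of_ne hij with h' | h'
    · simp [h', h'.not_gt]
    · rw [if_pos h', if_neg h'.not_gt, if_pos h', if_pos h', one_mul, ← sg_add, ← sg_add]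
      have e1 : e i = 1 - p i := by rw [← h i]; ring
      have e2 : e j = 1 - p j := by rw [← h j]; ring
      rw [e1, e2]
      exact sg_congr ⟨p i - 1, by ring⟩
  rw [h1, h2]
  linear_combination (∏ i ∈ S, ∏ j ∈ S, if i < j then sg (p i * e j) else 1) *
    (∏ i ∈ Sᶜ, ∏ j ∈ Sᶜ, if i < j then sg (p i * e j) else 1) * h3

namespace LInftyAlgebra

open PolyForms

variable {k g : Type*} [Field k] [AddCommGroup g] [Module k g]
  (L : LInftyAlgebra k g) (n : ℕ)

/-- The multilinear map `z ↦ ℓ(ℓ(z_S), z_{Sᶜ})`. -/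
def nestedBracket {N : ℕ} (S : Finset (Fin N)) :
    MultilinearMap k (fun _ : Fin N => g ⊗[k] Sullivan k n) (g ⊗[k] Sullivan k n) :=
  (MultilinearMap.curryFinFinset k _ _ rfl rfl).symm
    ((L.formBracket n (Sᶜ.card + 1)).curryLeft.compMultilinearMap (L.formBracket n S.card))

theorem nestedBracket_apply {N : ℕ} (S : Finset (Fin N)) (z : Fin N → g ⊗[k] Sullivan k n) :
    L.nestedBracket n S z = L.formBracket n (Sᶜ.card + 1)
      (Fin.cons (L.formBracket n S.card fun i => z (S.orderEmbOfFin rfl i))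
        fun i => z (Sᶜ.orderEmbOfFin rfl i)) := rfl

variable [CharZero k]

theorem nestedBracket_tmul {N : ℕ} (S : Finset (Fin N)) (p : Fin N → ℕ) (e : Fin N → ℤ)
    (x : Fin N → g) (a : Fin N → Sullivan k n) (h : ∀ i, e i + p i = 1)
    (hx : ∀ j, x j ∈ L.deg (e j)) (ha : ∀ j, a j ∈ gr k (Fin n) (p j)) :
    L.nestedBracket n S (fun j => x j ⊗ₜ a j) =
      (pairSign (fun j => p j) e * ∏ a ∈ S, ∏ b ∈ Sᶜ with b < a, sg (1 + e a * e b)) •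
      (L.bracket (Sᶜ.card + 1)
        (Fin.cons (L.bracket S.card fun a => x (S.orderEmbOfFin rfl a))
          fun b => x (Sᶜ.orderEmbOfFin rfl b)) ⊗ₜ orderedProd a Finset.univ) := by
  set u := L.bracket S.card fun a => x (S.orderEmbOfFin rfl a) with hu
  have hu' := L.bracket_mem S.card (fun i => e (S.orderEmbOfFin rfl i)) _ fun i => hx _
  rw [← hu] at hu'
  have h1 := L.formBracket_tmul n S.card (fun i => p (S.orderEmbOfFin rfl i)) _ _ _
    (fun i => hx (S.orderEmbOfFin rfl i)) fun i => ha (S.orderEmbOfFin rfl i)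
  rw [prod_ofFn_orderEmbOfFin, ← hu] at h1
  have h2 := L.formBracket_tmul n (Sᶜ.card + 1)
    (Fin.cons (∑ i ∈ S, p i) fun i => p (Sᶜ.orderEmbOfFin rfl i))
    (Fin.cons (∑ i, e (S.orderEmbOfFin rfl i) + 2 - S.card) fun i => e (Sᶜ.orderEmbOfFin rfl i))
    (Fin.cons u fun i => x (Sᶜ.orderEmbOfFin rfl i))
    (Fin.cons (orderedProd a S) fun i => a (Sᶜ.orderEmbOfFin rfl i))
    (fun j => by cases j using Fin.cases with
      | zero => exact hu'
      | succ j => exact hx _)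
    (fun j => by cases j using Fin.cases with
      | zero => exact orderedProd_mem_gr ha S
      | succ j => exact ha _)
  have h3 : (fun j => (Fin.cons u fun i => x (Sᶜ.orderEmbOfFin rfl i) :
      Fin (Sᶜ.card + 1) → g) j ⊗ₜ[k] (Fin.cons (orderedProd a S) fun i =>
        a (Sᶜ.orderEmbOfFin rfl i) : Fin (Sᶜ.card + 1) → Sullivan k n) j) =
      Fin.cons (u ⊗ₜ orderedProd a S)
        fun i => x (Sᶜ.orderEmbOfFin rfl i) ⊗ₜ a (Sᶜ.orderEmbOfFin rfl i) := by
    ext1 j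
    cases j using Fin.cases <;> rfl
  rw [h3, List.ofFn_succ, List.prod_cons, pairSign_succ] at h2
  simp only [Fin.cons_zero, Fin.cons_succ] at h2
  rw [prod_ofFn_orderEmbOfFin, orderedProd_mul_compl ha, prod_orderEmbOfFin fun j =>
    sg ((∑ i ∈ S, p i : ℕ) * e j), pairSign_orderEmbOfFin (fun i => (p i : ℤ)) e] at h2
  rw [nestedBracket_apply, h1, pairSign_orderEmbOfFin (fun i => (p i : ℤ)) e,
    ← jacobi_sign _ _ h]
  have h4 : ∀ (c : ℤ) v (w : Fin Sᶜ.card → g ⊗[k] Sullivan k n),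
      L.formBracket n (Sᶜ.card + 1) (Fin.cons (c • v) w) =
        c • L.formBracket n (Sᶜ.card + 1) (Fin.cons v w) := fun c v w => by
    rw [← MultilinearMap.curryLeft_apply, map_zsmul]
    rfl
  rw [h4, h2]
  simp only [← Int.cast_smul_eq_zsmul k, TensorProduct.tmul_smul, smul_smul, ← Int.cast_mul]
  congr 2
  push_cast
  ring

theorem formBracket_jacobi (N : ℕ) {x : g ⊗[k] Sullivan k n} (hx : x ∈ L.formDeg n 1) :
    ∑ s ∈ Finset.range N, sg (s + 1) • N.choose (s + 1) •
      L.formBracket n (N - (s + 1) + 1)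
        (Fin.cons (L.formBracket n (s + 1) fun _ => x) fun _ => x) = 0 := by
  have key := (∑ S : Finset (Fin N) with S.Nonempty, (-1 : ℤ) ^ S.card •
    L.nestedBracket n S).eq_zero_of_mem_span (fun _ => L.pureDeg n 1) (fun v hv => ?_)
    (fun _ => x) fun _ => hx
  · let f : ℕ → g ⊗[k] Sullivan k n := fun s => if s = 0 then 0 else sg s •
      L.formBracket n (N - s + 1) (Fin.cons (L.formBracket n s fun _ => x) fun _ => x)
    have h1 : ∀ S : Finset (Fin N), S.Nonempty →
        ((-1 : ℤ) ^ S.card • L.nestedBracket n S) (fun _ => x) = f S.card := by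
      intro S hS
      have h2 : ∀ t, t = N - S.card → L.formBracket n (t + 1)
          (Fin.cons (L.formBracket n S.card fun _ => x) fun _ => x) =
          L.formBracket n (N - S.card + 1)
          (Fin.cons (L.formBracket n S.card fun _ => x) fun _ => x) := by
        rintro t rfl; rfl
      simp only [f, if_neg (Finset.card_pos.2 hS).ne', sg_natCast]
      rw [← h2 Sᶜ.card (by rw [Finset.card_compl, Fintype.card_fin])]
      rfl
    rw [sum_apply, Finset.sum_congr rfl fun S hS => h1 S (Finset.mem_filter.1 hS).2,
      Finset.sum_filter_of_ne] at key
    · have h3 := Finset.sum_powerset_apply_card f (x := (Finset.univ : Finset (Fin N)))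
      rw [Finset.powerset_univ, key, Finset.card_univ, Fintype.card_fin,
        Finset.sum_range_succ'] at h3
      rw [← add_zero (∑ s ∈ Finset.range N, _)]
      convert h3.symm using 2
      · refine Finset.sum_congr rfl fun s _ => ?_
        simp only [f, if_neg (Nat.succ_ne_zero s)]
        rw [smul_comm]
        push_cast
        rfl
      · simp [f]
    · intro S _ hS
      rw [← Finset.card_pos, Nat.pos_iff_ne_zero]
      intro h0
      exact hS (by simp [f, h0])
  · choose e p y a hq hy ha hv using hv
    obtain rfl : v = fun j => y j ⊗ₜ a j := funext hv
    rw [sum_apply]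
    have h1 : ∀ S : Finset (Fin N), ((-1 : ℤ) ^ S.card • L.nestedBracket n S)
        (fun j => y j ⊗ₜ a j) = pairSign (fun j => (p j : ℤ)) e • ((((-1 : ℤ) ^ S.card *
        ∏ a ∈ S, ∏ b ∈ Sᶜ with b < a, ((1 + e a * e b).negOnePow : ℤ)) •
      L.bracket (Sᶜ.card + 1) (Fin.cons (L.bracket S.card fun a => y (S.orderEmbOfFin rfl a))
          fun b => y (Sᶜ.orderEmbOfFin rfl b))) ⊗ₜ[k] orderedProd a Finset.univ) := fun S => by
      change (-1 : ℤ) ^ S.card • L.nestedBracket n S (fun j => y j ⊗ₜ a j) = _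
      rw [L.nestedBracket_tmul n S p e y a hq hy ha, smul_smul]
      simp only [← Int.cast_smul_eq_zsmul k, ← TensorProduct.smul_tmul', smul_smul,
        ← Int.cast_mul]
      rw [mul_left_comm]
      rfl
    rw [Finset.sum_congr rfl fun S _ => h1 S, ← Finset.smul_sum, ← TensorProduct.sum_tmul,
      L.jacobi N e y hy, TensorProduct.zero_tmul, smul_zero]

end LInftyAlgebra

/-! ### The Bianchi identity -/

namespace LInftyAlgebra

open PolyForms

variable {k g : Type*} [Field k] [AddCommGroup g] [Module k g]
  (L : LInftyAlgebra k g) (n : ℕ)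

theorem formD_apply [CharZero k] (x : g ⊗[k] Sullivan k n) :
    L.formD n x = L.formBracket n 1 (fun _ => x) + L.formDeRham n x := by
  have : (MultilinearMap.ofSubsingleton k _ _ (0 : Fin 1)).symm (L.formBracket n 1) =
      TensorProduct.map
      ((MultilinearMap.ofSubsingleton k g g (0 : Fin 1)).symm (L.bracket 1)) LinearMap.id := by
    refine TensorProduct.ext' fun x a => ?_
    change L.extend n 1 (L.bracket 1) (fun _ => x ⊗ₜ a) = L.bracket 1 (fun _ => x) ⊗ₜ a
    have h1 : (fun _ : Fin 1 => x ⊗ₜ[k] a) = Fin.cons (x ⊗ₜ a) Fin.elim0 := by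
      ext1 j
      cases j using Fin.cases with
      | zero => rfl
      | succ j => exact j.elim0
    have h2 : ∀ N : MultilinearMap k (fun _ : Fin 0 => g) g,
        L.extend n 0 N Fin.elim0 = N Fin.elim0 ⊗ₜ 1 := fun N => rfl
    have h3 : ∀ N : MultilinearMap k (fun _ : Fin 0 => g) g,
        L.twist 0 N Fin.elim0 = N Fin.elim0 := fun N => congrArg N (Subsingleton.elim _ _)
    have h4 : (L.bracket 1).curryLeft x Fin.elim0 = L.bracket 1 fun _ => x := by
      rw [MultilinearMap.curryLeft_apply]
      congr 1
      ext1 j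
      cases j using Fin.cases with
      | zero => rfl
      | succ j => exact j.elim0
    have h5 : evenPart k (Fin n) a + oddPart k (Fin n) a = a := by
      simp only [evenPart, oddPart, LinearMap.smul_apply, LinearMap.add_apply, LinearMap.sub_apply,
        LinearMap.id_apply]
      rw [← smul_add, add_add_sub_cancel, ← two_smul k a, smul_smul,
        inv_mul_cancel₀ two_ne_zero, one_smul]
    rw [h1, extend_succ_tmul, h2, h2, h3, h4, leftMul_tmul, leftMul_tmul, mul_one, mul_one,
      ← TensorProduct.tmul_add, h5]
  rw [formD, LinearMap.add_apply, ← this]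
  rfl

theorem formDeRham_mem_formF {c : ℕ} {x : g ⊗[k] Sullivan k n} (hx : x ∈ L.formF n c) :
    L.formDeRham n x ∈ L.formF n c := by
  obtain ⟨z, rfl⟩ := hx
  induction z using TensorProduct.induction_on with
  | zero => simp
  | tmul x a => exact L.tmul_mem_formF n (L.parity_mem_F x.2) _
  | add u v hu hv => rw [map_add, map_add]; exact add_mem hu hv

/-- The linear map `w ↦ ℓ_{s+1}(w, x, …, x)`. -/
def insertBracket (x : g ⊗[k] Sullivan k n) (s : ℕ) :
    g ⊗[k] Sullivan k n →ₗ[k] g ⊗[k] Sullivan k n where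
  toFun w := (L.formBracket n (s + 1)).curryLeft w fun _ => x
  map_add' u v := by rw [map_add]; rfl
  map_smul' c u := by rw [map_smul]; rfl

theorem insertBracket_apply (x w : g ⊗[k] Sullivan k n) (s : ℕ) :
    L.insertBracket n x s w = L.formBracket n (s + 1) (Fin.cons w fun _ => x) := rfl

theorem formBracket_one_cons (x w : g ⊗[k] Sullivan k n) :
    L.insertBracket n x 0 w = L.formBracket n 1 fun _ => w := by
  rw [insertBracket_apply]
  congr 1
  ext1 j
  cases j using Fin.cases with
  | zero => rfl
  | succ j => exact j.elim0

/-- The summand `dx` or `ℓ_s(x, …, x) / s!` of the curvature. -/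
def curvatureTerm (x : g ⊗[k] Sullivan k n) (s : ℕ) : g ⊗[k] Sullivan k n :=
  (s.factorial : k)⁻¹ • if s = 1 then L.formD n x else L.formBracket n s fun _ => x

theorem formCurvature_eq_sum (x : g ⊗[k] Sullivan k n) (N : ℕ) :
    L.formCurvature n (N + 1) x = ∑ s ∈ Finset.range (N + 1), L.curvatureTerm n x (s + 1) := by
  rw [formCurvature, Finset.sum_range_succ', add_comm]
  congr 1
  · rw [show Finset.Icc 2 (N + 1) = Finset.Ico (0 + 2) (N + 2) from rfl,
      ← Finset.sum_Ico_add' (fun r => (r.factorial : k)⁻¹ • L.formBracket n r fun _ => x),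
      ← Finset.range_eq_Ico]
    exact Finset.sum_congr rfl fun s _ => by rw [curvatureTerm, if_neg (by omega)]
  · simp [curvatureTerm]

variable [CharZero k]

theorem formD_mem_formF {c : ℕ} {x : g ⊗[k] Sullivan k n} (hx : x ∈ L.formF n c) :
    L.formD n x ∈ L.formF n c := by
  rw [formD_apply]
  refine add_mem ?_ (L.formDeRham_mem_formF n hx)
  simpa using L.formBracket_mem_formF n 1 (fun _ => c) (fun _ => x) fun _ => hx

theorem insertBracket_mem_formF {x w : g ⊗[k] Sullivan k n} {c : ℕ} (hw : w ∈ L.formF n c)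
    (s : ℕ) : L.insertBracket n x s w ∈ L.formF n (c + s) := by
  have := L.formBracket_mem_formF n (s + 1) (Fin.cons c fun _ => 1) (Fin.cons w fun _ => x)
    (fun j => by
      cases j using Fin.cases with
      | zero => exact hw
      | succ j => simp [formF_one])
  rw [Fin.sum_univ_succ] at this
  simpa [insertBracket_apply] using this

theorem curvatureTerm_mem_formF (x : g ⊗[k] Sullivan k n) (s : ℕ) :
    L.curvatureTerm n x (s + 1) ∈ L.formF n (s + 1) := by
  refine Submodule.smul_mem _ _ ?_
  split_ifs with h
  · rw [h, formF_one]
    trivial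
  · simpa using L.formBracket_mem_formF n (s + 1) (fun _ => 1) (fun _ => x) fun _ => by
      simp [formF_one]

theorem formD_formBracket (N : ℕ) {x : g ⊗[k] Sullivan k n} (hx : x ∈ L.formDeg n 1) :
    L.formD n (L.curvatureTerm n x (N + 2)) = -∑ s ∈ Finset.range (N + 1),
      sg (s + 1) • ((s + 1).factorial : k)⁻¹ •
        L.insertBracket n x (s + 1) (L.curvatureTerm n x (N - s + 1)) := by
  have h1 := L.formBracket_jacobi n (N + 2) hx
  simp only [← L.insertBracket_apply n] at h1
  rw [Finset.sum_range_succ, Finset.sum_range_succ', Nat.sub_self, formBracket_one_cons,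
    Nat.choose_self, one_smul] at h1
  have h2 := L.formDeRham_formBracket_diag n (N + 1) hx
  rw [← insertBracket_apply] at h2
  have h3 : ∑ a ∈ Finset.range (N + 1), sg (a + 1) • (N + 2).choose (a + 1) •
      L.insertBracket n x (N - a + 1)
        (if a + 1 = 1 then L.formD n x else L.formBracket n (a + 1) fun _ => x) =
      -(sg (N + 2) • L.formD n (L.formBracket n (N + 2) fun _ => x)) := by
    rw [Finset.sum_range_succ']
    have e1 : ∑ a ∈ Finset.range N, sg ((a + 1 : ℕ) + 1) • (N + 2).choose (a + 1 + 1) •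
        L.insertBracket n x (N - (a + 1) + 1)
        (if a + 1 + 1 = 1 then L.formD n x else L.formBracket n (a + 1 + 1) fun _ => x) =
        ∑ a ∈ Finset.range N, sg ((a + 1 : ℕ) + 1) • (N + 2).choose (a + 1 + 1) •
        L.insertBracket n x (N + 2 - (a + 1 + 1)) (L.formBracket n (a + 1 + 1) fun _ => x) :=
      Finset.sum_congr rfl fun a ha => by
        rw [if_neg (by omega)]
        have := Finset.mem_range.1 ha
        rw [show N - (a + 1) + 1 = N + 2 - (a + 1 + 1) by omega]
    rw [e1, if_pos rfl, formD_apply, formD_apply, h2, map_add, eq_neg_iff_add_eq_zero, ← h1]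
    have e2 : sg (N + 2) • sg ((N + 1 : ℕ) + 1) • (N + 1 + 1) •
        L.insertBracket n x (N + 1) (L.formDeRham n x) =
        (N + 2) • L.insertBracket n x (N + 1) (L.formDeRham n x) := by
      rw [show (((N + 1 : ℕ) : ℤ) + 1) = N + 2 by push_cast; ring, sg_smul_sg_smul]
    rw [smul_add, smul_add, smul_add, e2]
    have e3 : sg ((0 : ℕ) + 1) = -1 := by simp [sg_one]
    have e4 : sg ((N + 1 : ℕ) + 1) = sg (N + 2) := by congr 1
    have e5 : N + 2 - (0 + 1) = N + 1 := by omega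
    rw [e3, e4, e5, Nat.sub_zero, zero_add, Nat.choose_one_right, neg_smul, neg_smul, one_smul,
      one_smul]
    abel
  have h4 : ∀ s ∈ Finset.range (N + 1), sg (s + 1) • ((s + 1).factorial : k)⁻¹ •
      L.insertBracket n x (s + 1) (L.curvatureTerm n x (N - s + 1)) =
      ((N + 2).factorial : k)⁻¹ • sg (N + 2) • sg ((N - s : ℕ) + 1) •
        (N + 2).choose (N - s + 1) • L.insertBracket n x (s + 1)
        (if N - s + 1 = 1 then L.formD n x else L.formBracket n (N - s + 1) fun _ => x) := by
    intro s hs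
    have hs' : s ≤ N := Nat.lt_succ_iff.1 (Finset.mem_range.1 hs)
    rw [curvatureTerm, map_smul, smul_smul (sg (N + 2)), ← sg_add]
    have e1 : sg (N + 2 + ((N - s : ℕ) + 1)) = sg (s + 1) := by
      refine sg_congr ⟨N + 1 - s, ?_⟩
      push_cast [hs']
      ring
    rw [e1, smul_comm _ (sg _), ← Nat.cast_smul_eq_nsmul k, smul_smul, smul_smul]
    congr 2
    rw [Nat.cast_choose k (by omega), show N + 2 - (N - s + 1) = s + 1 by omega]
    have := Nat.cast_ne_zero (R := k).2 (Nat.factorial_ne_zero (N + 2))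
    field_simp
  rw [Finset.sum_congr rfl h4, ← Finset.smul_sum, ← Finset.smul_sum]
  rw [← Finset.sum_range_reflect] at h3
  have h5 : ∀ s ∈ Finset.range (N + 1), sg ((N - s : ℕ) + 1) •
        (N + 2).choose (N - s + 1) • L.insertBracket n x (s + 1)
        (if N - s + 1 = 1 then L.formD n x else L.formBracket n (N - s + 1) fun _ => x) =
      sg ((N + 1 - 1 - s : ℕ) + 1) •
        (N + 2).choose (N + 1 - 1 - s + 1) • L.insertBracket n x (N - (N + 1 - 1 - s) + 1)
        (if N + 1 - 1 - s + 1 = 1 then L.formD n x else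
          L.formBracket n (N + 1 - 1 - s + 1) fun _ => x) := by
    intro s hs
    have hs' : s ≤ N := Nat.lt_succ_iff.1 (Finset.mem_range.1 hs)
    rw [Nat.add_sub_cancel, Nat.sub_sub_self hs']
  rw [Finset.sum_congr rfl h5, h3, smul_neg, smul_neg, neg_neg, sg_smul_sg_smul, curvatureTerm,
    if_neg (by omega), map_smul]

/-- If the curvature of `x` lies in `F_c`, then the differential of its nonlinear part lies in
`F_{c+1}`, up to terms of high filtration. -/
theorem formD_sum_mem_formF (N c : ℕ) {x : g ⊗[k] Sullivan k n} (hx : x ∈ L.formDeg n 1)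
    (hc : c ≤ N) (h : L.formCurvature n (N + 1) x ∈ L.formF n c) :
    L.formD n (∑ s ∈ Finset.range N, L.curvatureTerm n x (s + 2)) ∈ L.formF n (c + 1) := by
  rw [map_sum, Finset.sum_congr rfl fun s _ => L.formD_formBracket n s hx,
    Finset.sum_neg_distrib, Finset.sum_range_diag_flip N fun s a => sg (s + 1) •
      ((s + 1).factorial : k)⁻¹ • L.insertBracket n x (s + 1) (L.curvatureTerm n x (a + 1))]
  refine neg_mem (sum_mem fun s hs => ?_)
  rw [← Finset.smul_sum, ← Finset.smul_sum, ← map_sum]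
  refine zsmul_mem (Submodule.smul_mem _ _ ?_) _
  have e : ∑ a ∈ Finset.range (N - s), L.curvatureTerm n x (a + 1) =
      L.formCurvature n (N + 1) x -
        ∑ a ∈ Finset.Ico (N - s) (N + 1), L.curvatureTerm n x (a + 1) := by
    rw [formCurvature_eq_sum, Finset.sum_Ico_eq_sub _ (by omega)]
    abel
  rw [e, map_sub]
  refine sub_mem (L.formF_antitone n (by omega) (L.insertBracket_mem_formF n h (s + 1))) ?_
  rw [map_sum]
  refine sum_mem fun a ha => ?_
  have := (Finset.mem_Ico.1 ha).1
  exact L.formF_antitone n (by omega)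
    (L.insertBracket_mem_formF n (L.curvatureTerm_mem_formF n x a) (s + 1))

end LInftyAlgebra

/-! ### Sums over trees with equal leaves -/

namespace Transfer

theorem sum_card_block {ι A : Type*} [DecidableEq ι] [AddCommMonoid A] (S : Finset ι) (r : ℕ)
    (G : (Fin r → ℕ) → A) : ∑ f : S → Fin r, G (fun j => (block f j).card) =
      ∑ c ∈ Finset.piAntidiag Finset.univ S.card, Nat.multinomial Finset.univ c • G c := by
  let φ : MvPolynomial (Fin r) ℕ →ₗ[ℕ] A :=
    (MvPolynomial.basisMonomials (Fin r) ℕ).constr ℕ fun a => G a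
  have hφ : ∀ c : Fin r → ℕ, φ (∏ j, MvPolynomial.X j ^ c j) = G c := fun c => by
    have : ∏ j, MvPolynomial.X j ^ c j =
        MvPolynomial.basisMonomials (Fin r) ℕ (Finsupp.equivFunOnFinite.symm c) := by
      rw [MvPolynomial.coe_basisMonomials]
      change _ = MvPolynomial.monomial _ 1
      rw [MvPolynomial.monomial_eq, map_one, one_mul,
        Finsupp.prod_fintype _ _ fun _ => pow_zero _]
      rfl
    rw [this, Module.Basis.constr_basis]
    rfl
  have h := Finset.prod_univ_sum (fun _ : S => (Finset.univ : Finset (Fin r)))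
    fun _ j => (MvPolynomial.X j : MvPolynomial (Fin r) ℕ)
  rw [Finset.prod_const, Finset.card_univ, Fintype.card_coe, Finset.sum_pow_eq_sum_piAntidiag,
    Fintype.piFinset_univ] at h
  have h' := congrArg φ h
  rw [map_sum, map_sum] at h'
  rw [Finset.sum_congr rfl fun f _ => ?_, ← h', Finset.sum_congr rfl fun c _ => ?_]
  · rw [← nsmul_eq_mul, map_nsmul, hφ]
  · rw [← hφ]
    refine congrArg _ ?_
    rw [← Finset.prod_fiberwise_of_maps_to (g := f) fun s _ => Finset.mem_univ (f s)]
    refine Finset.prod_congr rfl fun j _ => ?_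
    rw [Finset.prod_congr rfl fun s hs => by rw [(Finset.mem_filter.1 hs).2], Finset.prod_const,
      block, Finset.card_map]

variable {k V W : Type*} [Field k] [AddCommGroup V] [Module k V] [AddCommGroup W] [Module k W]
  (ℓ : ∀ r : ℕ, MultilinearMap k (fun _ : Fin r => V) V)

theorem vertexSum_eq_sum_piAntidiag {ι : Type*} [LinearOrder ι] (u : ℕ → V) (hu : u 0 = 0)
    (S : Finset ι) (Φ : ∀ T : Finset ι, T ⊂ S → V) (hΦ : ∀ T hT, Φ T hT = u T.card) :
    vertexSum ℓ (fun _ => 1) S Φ = ∑ r ∈ Finset.range (S.card - 1), (((r + 2).factorial : k)⁻¹) •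
      ∑ c ∈ Finset.piAntidiag Finset.univ S.card,
        Nat.multinomial Finset.univ c • ℓ (r + 2) fun j => u (c j) := by
  classical
  refine Finset.sum_congr rfl fun r _ => congrArg _ ?_
  have h0 : ∀ (f : S → Fin (r + 2)), (ℓ (r + 2) fun j => u (block f j).card) ≠ 0 →
      Function.Surjective f := fun f hf j => by
    by_contra hj
    refine hf ((ℓ (r + 2)).map_coord_zero j ?_)
    rw [Finset.card_eq_zero.2, hu]
    simpa [block] using fun a ha => fun h => hj ⟨⟨a, ha⟩, h⟩
  rw [← sum_card_block S (r + 2) fun c => ℓ (r + 2) fun j => u (c j),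
    ← Finset.sum_filter_of_ne fun f _ => h0 f,
    Finset.sum_subtype (p := fun f : S → Fin (r + 2) => Function.Surjective f) _ fun f => by simp]
  refine Finset.sum_congr rfl fun f _ => ?_
  have h1 : koszulSign (fun _ => 1) f.1 = 1 := by simp [koszulSign]
  have h2 : (shiftSign fun j => outDeg (fun _ => 1) (block f.1 j)) = 1 := by
    simp [shiftSign, outDeg]
  rw [h1, h2, mul_one, one_smul]
  exact congrArg _ (funext fun j => hΦ _ _)

theorem vertexSum_eq_zero {ι : Type*} [LinearOrder ι] (d : ι → ℤ)
    (S : Finset ι) (Φ : ∀ T : Finset ι, T ⊂ S → V) (hS : S.card ≤ 1) :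
    vertexSum ℓ d S Φ = 0 := by
  rw [vertexSum, Nat.sub_eq_zero_of_le hS, Finset.sum_range_zero]

variable (i : W →ₗ[k] V) (h : V →ₗ[k] V) (p : V →ₗ[k] W) 

theorem inclTrees_eq {ι : Type*} [LinearOrder ι] (d : ι → ℤ) (y : ι → W) (S : Finset ι) :
    inclTrees ℓ i h d y S = if S.card = 1 then i (∑ s ∈ S, y s) else
      -h (vertexSum ℓ d S fun T _ => inclTrees ℓ i h d y T) := by
  rw [inclTrees, Finset.strongInduction_eq]
  rfl

/-- The sum over all rooted trees with `m` leaves, all of them labelled by `y` of degree `1`. -/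
def tree (y : W) (m : ℕ) : V := inclComponent ℓ i h m (fun _ => 1) fun _ => y

theorem tree_zero (y : W) : tree ℓ i h y 0 = 0 := by
  rw [tree, inclComponent, inclTrees_eq, if_neg (by simp), vertexSum_eq_zero _ _ _ _ (by simp),
    map_zero, neg_zero]

theorem tree_one (y : W) : tree ℓ i h y 1 = i y := by
  rw [tree, inclComponent, inclTrees_eq, if_pos (by simp)]
  simp

theorem inclTrees_const (y : W) (m : ℕ) : ∀ {M : ℕ} (S : Finset (Fin M)), S.card = m →
    inclTrees ℓ i h (fun _ => 1) (fun _ => y) S = tree ℓ i h y m := by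
  induction m using Nat.strong_induction_on with
  | _ m ih =>
  intro M S hS
  have hm : (Finset.univ : Finset (Fin m)).card = m := by simp
  rw [tree, inclComponent, inclTrees_eq, inclTrees_eq, hS, hm]
  split_ifs with h1
  · simp [hS, hm]
  · rw [vertexSum_eq_sum_piAntidiag ℓ (tree ℓ i h y) (tree_zero ℓ i h y),
      vertexSum_eq_sum_piAntidiag ℓ (tree ℓ i h y) (tree_zero ℓ i h y), hS, hm]
    · exact fun T hT => ih _ ((Finset.card_lt_card hT).trans_eq hm) T rfl
    · exact fun T hT => ih _ ((Finset.card_lt_card hT).trans_eq hS) T rfl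

variable [CharZero k]

/-- `1/m!` times the sum over the trees with `m` leaves labelled by `y`. -/
def treeCoeff (y : W) (m : ℕ) : V := (m.factorial : k)⁻¹ • tree ℓ i h y m

/-- The sum of `treeCoeff` with the homotopy at the root omitted. -/
def rootCoeff (y : W) (m : ℕ) : V := ∑ r ∈ Finset.range (m - 1), (((r + 2).factorial : k)⁻¹) •
  ∑ c ∈ Finset.piAntidiag Finset.univ m, ℓ (r + 2) fun j => treeCoeff ℓ i h y (c j)

theorem treeCoeff_zero (y : W) : treeCoeff ℓ i h y 0 = 0 := by
  rw [treeCoeff, tree_zero, smul_zero]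

theorem treeCoeff_one (y : W) : treeCoeff ℓ i h y 1 = i y := by
  rw [treeCoeff, tree_one, Nat.factorial_one, Nat.cast_one, inv_one, one_smul]

theorem vertexSum_const (y : W) (m : ℕ) : (m.factorial : k)⁻¹ • vertexSum ℓ (fun _ => 1)
    (Finset.univ : Finset (Fin m)) (fun T _ => inclTrees ℓ i h (fun _ => 1) (fun _ => y) T) =
      rootCoeff ℓ i h y m := by
  rw [vertexSum_eq_sum_piAntidiag ℓ (tree ℓ i h y) (tree_zero ℓ i h y) _ _
    fun T _ => inclTrees_const ℓ i h y _ T rfl, Finset.smul_sum, Finset.card_univ, Fintype.card_fin]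
  refine Finset.sum_congr rfl fun r _ => ?_
  rw [smul_comm, Finset.smul_sum]
  congr 1
  refine Finset.sum_congr rfl fun c hc => ?_
  have h1 : (ℓ (r + 2) fun j => tree ℓ i h y (c j)) =
      (∏ j, ((c j).factorial : k)) • ℓ (r + 2) fun j => treeCoeff ℓ i h y (c j) := by
    rw [← MultilinearMap.map_smul_univ]
    congr 1
    ext1 j
    rw [treeCoeff, smul_smul, mul_inv_cancel₀ (Nat.cast_ne_zero.2 (Nat.factorial_ne_zero _)),
      one_smul]
  have h2 := Nat.multinomial_spec Finset.univ c
  rw [(Finset.mem_piAntidiag.1 hc).1] at h2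
  rw [h1, ← Nat.cast_smul_eq_nsmul k, smul_smul, smul_smul, ← Nat.cast_prod, mul_assoc,
    ← Nat.cast_mul, mul_comm (Nat.multinomial _ _), h2,
    inv_mul_cancel₀ (Nat.cast_ne_zero.2 (Nat.factorial_ne_zero _)), one_smul]

theorem treeCoeff_eq (y : W) {m : ℕ} (hm : m ≠ 1) :
    treeCoeff ℓ i h y m = -h (rootCoeff ℓ i h y m) := by
  rw [treeCoeff, tree, inclComponent, inclTrees_eq, if_neg (by simpa using hm), smul_neg,
    ← map_smul, vertexSum_const]

theorem bracket_const (dV : V →ₗ[k] V) (y : W) {m : ℕ} (hm : m ≠ 1) :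
    (m.factorial : k)⁻¹ • bracket dV ℓ i p h m (fun _ => 1) (fun _ => y) =
      p (rootCoeff ℓ i h y m) := by
  rw [bracket, if_neg hm, ← map_smul, vertexSum_const]

end Transfer

/-! ### The contraction of `g ⊗ Ω_n` onto `g ⊗ C_n` -/

namespace LInftyAlgebra

variable {k g : Type*} [Field k] [AddCommGroup g] [Module k g]
  (L : LInftyAlgebra k g) (n : ℕ)

/-- Linear maps out of `g ⊗ V` agree if they agree on the tensors with homogeneous first factor. -/
theorem tensor_ext {V M : Type*} [AddCommGroup V] [Module k V] [AddCommGroup M] [Module k M]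
    {f f' : g ⊗[k] V →ₗ[k] M}
    (h : ∀ (i : ℤ), ∀ x ∈ L.deg i, ∀ a, f (x ⊗ₜ a) = f' (x ⊗ₜ a)) : f = f' := by
  refine TensorProduct.ext' fun x a => ?_
  have hx : x ∈ ⨆ i, L.deg i := by
    rw [L.isInternal.submodule_iSup_eq_top]
    trivial
  refine Submodule.iSup_induction _ (motive := fun x => f (x ⊗ₜ a) = f' (x ⊗ₜ a)) hx
    (fun i x hx => h i x hx a) ?_ fun u v hu hv => ?_
  · rw [TensorProduct.zero_tmul, map_zero, map_zero]
  · rw [TensorProduct.add_tmul, map_add, map_add, hu, hv]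

theorem bracket_one_mem {i : ℤ} {x : g} (hx : x ∈ L.deg i) :
    L.bracket 1 (fun _ => x) ∈ L.deg (i + 1) := by
  have := L.bracket_mem 1 (fun _ => i) (fun _ => x) fun _ => hx
  rwa [Fin.sum_const, one_smul, Nat.cast_one, show i + 2 - 1 = i + 1 by ring] at this

variable [CharZero k]

theorem tensorHomotopy_tmul {i : ℤ} {x : g} (hx : x ∈ L.deg i) (a : Sullivan k n) :
    L.tensorHomotopy n (x ⊗ₜ a) = sg i • x ⊗ₜ[k] Sullivan.homotopy k n a := by
  rw [tensorHomotopy, TensorProduct.map_tmul, L.parity_sg hx, ← TensorProduct.smul_tmul']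

theorem formD_tmul {i : ℤ} {x : g} (hx : x ∈ L.deg i) (a : Sullivan k n) :
    L.formD n (x ⊗ₜ a) = L.bracket 1 (fun _ => x) ⊗ₜ[k] a +
      sg i • x ⊗ₜ[k] PolyForms.d k (Fin n) a := by
  rw [formD, LinearMap.add_apply, TensorProduct.map_tmul, TensorProduct.map_tmul, L.parity_sg hx,
    ← TensorProduct.smul_tmul']
  rfl

theorem formD_tensorHomotopy_add (z : g ⊗[k] Sullivan k n) :
    L.formD n (L.tensorHomotopy n z) + L.tensorHomotopy n (L.formD n z) =
      z - tensorIncl n (tensorProj n z) := by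
  have : L.formD n ∘ₗ L.tensorHomotopy n + L.tensorHomotopy n ∘ₗ L.formD n =
      LinearMap.id - tensorIncl n ∘ₗ tensorProj n := by
    refine L.tensor_ext fun i x hx a => ?_
    simp only [LinearMap.add_apply, LinearMap.comp_apply, LinearMap.sub_apply, LinearMap.id_apply]
    rw [L.tensorHomotopy_tmul n hx, map_zsmul, L.formD_tmul n hx, L.formD_tmul n hx, map_add,
      map_zsmul, L.tensorHomotopy_tmul n hx, L.tensorHomotopy_tmul n (L.bracket_one_mem hx),
      smul_add, sg_smul_sg_smul, sg_smul_sg_smul, sg_add, sg_one, mul_neg_one, neg_smul,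
      tensorProj, tensorIncl, LinearMap.lTensor_tmul, LinearMap.lTensor_tmul,
      ← TensorProduct.tmul_sub, ← Sullivan.d_homotopy_add, TensorProduct.tmul_add]
    abel
  exact LinearMap.congr_fun this z

theorem tensorHomotopy_tensorHomotopy (z : g ⊗[k] Sullivan k n) :
    L.tensorHomotopy n (L.tensorHomotopy n z) = 0 := by
  have : L.tensorHomotopy n ∘ₗ L.tensorHomotopy n = 0 := by
    refine L.tensor_ext fun i x hx a => ?_
    rw [LinearMap.comp_apply, L.tensorHomotopy_tmul n hx, map_zsmul, L.tensorHomotopy_tmul n hx,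
      Sullivan.homotopy_homotopy, TensorProduct.tmul_zero, smul_zero, smul_zero]
    rfl
  exact LinearMap.congr_fun this z

theorem tensorHomotopy_tensorIncl (y : g ⊗[k] Sullivan.cellular k n) :
    L.tensorHomotopy n (tensorIncl n y) = 0 := by
  induction y using TensorProduct.induction_on with
  | zero => rw [map_zero, map_zero]
  | tmul x a =>
    rw [tensorIncl, LinearMap.lTensor_tmul, tensorHomotopy, TensorProduct.map_tmul,
      Sullivan.homotopy_incl, TensorProduct.tmul_zero]
  | add u v hu hv => rw [map_add, map_add, hu, hv, add_zero]

theorem incl_proj_formD_incl (y : g ⊗[k] Sullivan.cellular k n) :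
    tensorIncl n (tensorProj n (L.formD n (tensorIncl n y))) = L.formD n (tensorIncl n y) := by
  have : tensorIncl (k := k) (g := g) n ∘ₗ tensorProj n ∘ₗ L.formD n ∘ₗ tensorIncl n =
      L.formD n ∘ₗ tensorIncl n := by
    refine L.tensor_ext (V := Sullivan.cellular k n) (M := g ⊗[k] Sullivan k n) fun i x hx a => ?_
    simp only [LinearMap.comp_apply, tensorIncl, tensorProj, LinearMap.lTensor_tmul]
    rw [L.formD_tmul n hx, map_add, map_add, map_zsmul, map_zsmul]
    simp only [LinearMap.lTensor_tmul]
    rw [Sullivan.incl_proj_incl, Sullivan.incl_proj_d_incl]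
  exact LinearMap.congr_fun this y

theorem tensorHomotopy_mem_formDeg {q : ℤ} {z : g ⊗[k] Sullivan k n}
    (hz : z ∈ L.formDeg n (q + 1)) : L.tensorHomotopy n z ∈ L.formDeg n q := by
  induction hz using Submodule.span_induction with
  | mem z h =>
    obtain ⟨i, p, x, a, hq, hx, ha, rfl⟩ := h
    rw [L.tensorHomotopy_tmul n hx]
    refine zsmul_mem (?_ : _ ∈ L.formDeg n q) _
    cases p with
    | zero =>
      rw [Sullivan.homotopy_of_mem_gr_zero ha, TensorProduct.tmul_zero]
      exact zero_mem _
    | succ p =>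
      exact Submodule.subset_span ⟨i, p, x, _, by push_cast at hq; omega, hx,
        Sullivan.homotopy_mem_gr ha, rfl⟩
  | zero => rw [map_zero]; exact zero_mem _
  | add u v _ _ hu hv => rw [map_add]; exact add_mem hu hv
  | smul c u _ hu => rw [map_smul]; exact Submodule.smul_mem _ _ hu


theorem tensorIncl_mem_formDeg {y : g ⊗[k] Sullivan.cellular k n} (hy : y ∈ L.cellDegOne n) :
    tensorIncl n y ∈ L.formDeg n 1 := by
  induction hy using Submodule.span_induction with
  | mem z h =>
    obtain ⟨i, p, x, a, hq, hx, ha, rfl⟩ := h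
    exact Submodule.subset_span ⟨i, p, x, _, hq, hx, ha, rfl⟩
  | zero => rw [map_zero]; exact zero_mem _
  | add u v _ _ hu hv => rw [map_add]; exact add_mem hu hv
  | smul c u _ hu => rw [map_smul]; exact Submodule.smul_mem _ _ hu

theorem tensorIncl_mem_formF {c : ℕ} {y : g ⊗[k] Sullivan.cellular k n} (hy : y ∈ L.cellF n c) :
    tensorIncl n y ∈ L.formF n c := by
  obtain ⟨z, rfl⟩ := hy
  exact ⟨LinearMap.lTensor _ (Sullivan.incl k n) z, by
    rw [tensorIncl, ← LinearMap.comp_apply, ← LinearMap.comp_apply, LinearMap.rTensor_comp_lTensor,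
      LinearMap.lTensor_comp_rTensor]⟩

theorem tensorProj_mem_cellF {c : ℕ} {z : g ⊗[k] Sullivan k n} (hz : z ∈ L.formF n c) :
    tensorProj n z ∈ L.cellF n c := by
  obtain ⟨z, rfl⟩ := hz
  exact ⟨LinearMap.lTensor _ (Sullivan.proj k n) z, by
    rw [tensorProj, ← LinearMap.comp_apply, ← LinearMap.comp_apply, LinearMap.rTensor_comp_lTensor,
      LinearMap.lTensor_comp_rTensor]⟩

/-! ### The Maurer-Cartan equation of the transferred elements -/

/-- `i_m(y, …, y) / m!`. -/
def inclCoeff (y : g ⊗[k] Sullivan.cellular k n) (m : ℕ) : g ⊗[k] Sullivan k n :=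
  Transfer.treeCoeff (L.formBracket n) (tensorIncl n) (L.tensorHomotopy n) y m

/-- The sum of the terms of `∑_{r ≥ 2} ℓ_r(a, …, a) / r!` of weight `m` in `y`, where
`a = ∑_m i_m(y, …, y) / m!`. -/
def nodeCoeff (y : g ⊗[k] Sullivan.cellular k n) (m : ℕ) : g ⊗[k] Sullivan k n :=
  Transfer.rootCoeff (L.formBracket n) (tensorIncl n) (L.tensorHomotopy n) y m

theorem inclCoeff_zero (y : g ⊗[k] Sullivan.cellular k n) : L.inclCoeff n y 0 = 0 :=
  Transfer.treeCoeff_zero _ _ _ y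

theorem inclCoeff_one (y : g ⊗[k] Sullivan.cellular k n) : L.inclCoeff n y 1 = tensorIncl n y :=
  Transfer.treeCoeff_one _ _ _ y

theorem inclCoeff_eq (y : g ⊗[k] Sullivan.cellular k n) {m : ℕ} (hm : m ≠ 1) :
    L.inclCoeff n y m = -L.tensorHomotopy n (L.nodeCoeff n y m) :=
  Transfer.treeCoeff_eq _ _ _ y hm

theorem nodeCoeff_of_le_one (y : g ⊗[k] Sullivan.cellular k n) {m : ℕ} (hm : m ≤ 1) :
    L.nodeCoeff n y m = 0 := by
  rw [nodeCoeff, Transfer.rootCoeff, Nat.sub_eq_zero_of_le hm, Finset.sum_range_zero]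

theorem formBracket_inclCoeff_eq_zero (y : g ⊗[k] Sullivan.cellular k n) {r : ℕ} {c : Fin r → ℕ}
    (j : Fin r) (hj : c j = 0) : (L.formBracket n r fun j => L.inclCoeff n y (c j)) = 0 :=
  (L.formBracket n r).map_coord_zero j (by rw [hj, inclCoeff_zero])

theorem nodeCoeff_mem {P : Submodule k (g ⊗[k] Sullivan k n)} (y : g ⊗[k] Sullivan.cellular k n)
    (m : ℕ) (h : ∀ (r : ℕ) (c : Fin r → ℕ), ∑ j, c j = m → (∀ j, c j < m) →
      (L.formBracket n r fun j => L.inclCoeff n y (c j)) ∈ P) : L.nodeCoeff n y m ∈ P := by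
  rw [nodeCoeff, Transfer.rootCoeff]
  refine sum_mem fun r _ => Submodule.smul_mem _ _ (sum_mem fun c hc => ?_)
  have hc' := (Finset.mem_piAntidiag.1 hc).1
  by_cases h0 : ∃ j, c j = 0
  · obtain ⟨j, hj⟩ := h0
    exact (L.formBracket_inclCoeff_eq_zero n y j hj).symm ▸ zero_mem _
  · push Not at h0
    refine h _ c hc' fun j => ?_
    obtain ⟨j', hj'⟩ := exists_ne j
    rw [← hc', ← Finset.add_sum_erase _ _ (Finset.mem_univ j)]
    refine Nat.lt_add_of_pos_right (lt_of_lt_of_le (Nat.pos_of_ne_zero (h0 j')) ?_)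
    exact Finset.single_le_sum (f := c) (fun _ _ => Nat.zero_le _)
      (Finset.mem_erase.2 ⟨hj', Finset.mem_univ _⟩)

theorem inclCoeff_mem_formF (y : g ⊗[k] Sullivan.cellular k n) (m : ℕ) :
    L.inclCoeff n y m ∈ L.formF n m := by
  induction m using Nat.strong_induction_on with
  | _ m ih =>
  by_cases hm : m = 1
  · rw [hm, formF_one]
    trivial
  · rw [inclCoeff_eq L n y hm]
    refine neg_mem (L.tensorHomotopy_mem_formF n m (L.nodeCoeff_mem n y m fun r c hc hlt => ?_))
    exact hc ▸ L.formBracket_mem_formF n r c _ fun j => ih _ (hlt j)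

theorem nodeCoeff_mem_formF (y : g ⊗[k] Sullivan.cellular k n) (m : ℕ) :
    L.nodeCoeff n y m ∈ L.formF n m :=
  L.nodeCoeff_mem n y m fun r c hc _ =>
    hc ▸ L.formBracket_mem_formF n r c _ fun _ => L.inclCoeff_mem_formF n y _

theorem inclCoeff_mem_formDeg {y : g ⊗[k] Sullivan.cellular k n} (hy : y ∈ L.cellDegOne n)
    (m : ℕ) : L.inclCoeff n y m ∈ L.formDeg n 1 := by
  induction m using Nat.strong_induction_on with
  | _ m ih =>
  by_cases hm : m = 1
  · rw [hm, inclCoeff_one]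
    exact L.tensorIncl_mem_formDeg n hy
  · rw [inclCoeff_eq L n y hm]
    refine neg_mem (L.tensorHomotopy_mem_formDeg n (L.nodeCoeff_mem n y m fun r c hc hlt => ?_))
    simpa [one_add_one_eq_two] using
      L.formBracket_mem_formDeg n r (fun _ => 1) _ fun j => ih _ (hlt j)

theorem tensorHomotopy_inclCoeff (y : g ⊗[k] Sullivan.cellular k n) (m : ℕ) :
    L.tensorHomotopy n (L.inclCoeff n y m) = 0 := by
  by_cases hm : m = 1
  · rw [hm, inclCoeff_one, tensorHomotopy_tensorIncl]
  · rw [inclCoeff_eq L n y hm, map_neg, tensorHomotopy_tensorHomotopy, neg_zero]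

/-- The partial sum `∑_{m < c} i_m(y, …, y) / m!`. -/
def partialIncl (y : g ⊗[k] Sullivan.cellular k n) (c : ℕ) : g ⊗[k] Sullivan k n :=
  ∑ m ∈ Finset.range c, L.inclCoeff n y m

theorem MCIncl_apply (y : g ⊗[k] Sullivan.cellular k n) (c : ℕ) :
    L.MCIncl n y c = Submodule.Quotient.mk (L.partialIncl n y c) := by
  refine congrArg _ ?_
  rw [partialIncl, Finset.range_eq_Ico]
  cases c with
  | zero => rfl
  | succ c =>
    rw [Finset.sum_eq_sum_Ico_succ_bot c.succ_pos, inclCoeff_zero, zero_add]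
    rfl

/-- The terms of `ℓ_{s+2}(a, …, a) / (s+2)!` of weight `m` in `y`. -/
def weightTerm (y : g ⊗[k] Sullivan.cellular k n) (s m : ℕ) : g ⊗[k] Sullivan k n :=
  (((s + 2).factorial : k)⁻¹) • ∑ c ∈ Finset.piAntidiag Finset.univ m,
    L.formBracket n (s + 2) fun j => L.inclCoeff n y (c j)

theorem sum_weightTerm (y : g ⊗[k] Sullivan.cellular k n) {N m : ℕ} (hm : m ≤ N) :
    ∑ s ∈ Finset.range N, L.weightTerm n y s m = L.nodeCoeff n y m := by
  refine (Finset.sum_subset (Finset.range_mono (by omega : m - 1 ≤ N)) fun s _ hs => ?_).symm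
  rw [weightTerm, Finset.sum_eq_zero, smul_zero]
  intro c hc
  by_contra h
  have h0 : ∀ j, 1 ≤ c j := fun j => Nat.one_le_iff_ne_zero.2 fun hj =>
    h (L.formBracket_inclCoeff_eq_zero n y j hj)
  have := Finset.sum_le_sum fun j (_ : j ∈ Finset.univ) => h0 j
  rw [(Finset.mem_piAntidiag.1 hc).1] at this
  simp at this hs
  omega

theorem curvatureTerm_sub_mem_formF (y : g ⊗[k] Sullivan.cellular k n) (c s : ℕ) :
    L.curvatureTerm n (L.partialIncl n y c) (s + 2) -
      ∑ m ∈ Finset.range c, L.weightTerm n y s m ∈ L.formF n c := by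
  classical
  rw [curvatureTerm, if_neg (by omega)]
  simp only [weightTerm, partialIncl]
  rw [← Finset.smul_sum, ← smul_sub]
  refine Submodule.smul_mem _ _ ?_
  rw [MultilinearMap.map_sum_finset, ← Finset.sum_filter_add_sum_filter_not _
    fun f : Fin (s + 2) → ℕ => ∑ j, f j < c, ← Finset.sum_fiberwise_of_maps_to
    (t := Finset.range c) (g := fun f : Fin (s + 2) → ℕ => ∑ j, f j) (by simp)]
  rw [Finset.sum_congr rfl fun m hm => Finset.sum_congr (s₂ := Finset.piAntidiag Finset.univ m)
    ?_ fun _ _ => rfl, add_sub_cancel_left]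
  · refine sum_mem fun f hf => L.formF_antitone n (not_lt.1 (Finset.mem_filter.1 hf).2) ?_
    exact L.formBracket_mem_formF n _ f _ fun _ => L.inclCoeff_mem_formF n y _
  · ext f
    have hm := Finset.mem_range.1 hm
    simp only [Finset.mem_filter, Fintype.mem_piFinset, Finset.mem_range, Finset.mem_piAntidiag,
      Finset.mem_univ, implies_true, and_true]
    constructor
    · exact fun h => h.2
    · refine fun h => ⟨⟨fun j => ?_, h.trans_lt hm⟩, h⟩
      exact (Finset.single_le_sum (f := f) (fun _ _ => Nat.zero_le _)
        (Finset.mem_univ j)).trans_lt (h.trans_lt hm)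

theorem sum_curvatureTerm_sub_mem_formF (y : g ⊗[k] Sullivan.cellular k n) {c N : ℕ}
    (hN : c ≤ N) : ∑ s ∈ Finset.range N, L.curvatureTerm n (L.partialIncl n y c) (s + 2) -
      ∑ m ∈ Finset.range c, L.nodeCoeff n y m ∈ L.formF n c := by
  rw [Finset.sum_congr rfl fun m hm => (L.sum_weightTerm n y
    ((Finset.mem_range.1 hm).le.trans hN)).symm, Finset.sum_comm, ← Finset.sum_sub_distrib]
  exact sum_mem fun s _ => L.curvatureTerm_sub_mem_formF n y c s

theorem partialIncl_eq (y : g ⊗[k] Sullivan.cellular k n) {c : ℕ} (hc : 2 ≤ c) :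
    L.partialIncl n y c =
      tensorIncl n y - L.tensorHomotopy n (∑ m ∈ Finset.range c, L.nodeCoeff n y m) := by
  obtain ⟨c, rfl⟩ := Nat.exists_eq_add_of_le' hc
  rw [partialIncl, Finset.sum_range_succ', Finset.sum_range_succ', inclCoeff_zero, inclCoeff_one,
    Finset.sum_range_succ', Finset.sum_range_succ', L.nodeCoeff_of_le_one n y (m := 0) (by simp),
    L.nodeCoeff_of_le_one n y (m := 0 + 1) (by simp), map_add, map_add, map_zero, map_sum,
    Finset.sum_congr rfl fun m _ => L.inclCoeff_eq n y (by omega : m + 1 + 1 ≠ 1),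
    Finset.sum_neg_distrib]
  abel

theorem cellBracket_const (y : g ⊗[k] Sullivan.cellular k n) {m : ℕ} (hm : m ≠ 1) :
    (m.factorial : k)⁻¹ • L.cellBracket n m (fun _ => 1) (fun _ => y) =
      tensorProj n (L.nodeCoeff n y m) :=
  Transfer.bracket_const _ _ _ _ _ y hm

theorem cellBracket_one (y : g ⊗[k] Sullivan.cellular k n) :
    L.cellBracket n 1 (fun _ => 1) (fun _ => y) = tensorProj n (L.formD n (tensorIncl n y)) := by
  simp [cellBracket, Transfer.bracket]

theorem sum_cellBracket_mem {y : g ⊗[k] Sullivan.cellular k n} (hy : y ∈ L.MCCells n) {c : ℕ}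
    (hc : 2 ≤ c) : tensorProj n (L.formD n (tensorIncl n y)) +
      tensorProj n (∑ m ∈ Finset.range c, L.nodeCoeff n y m) ∈ L.cellF n c := by
  obtain ⟨N₀, hN⟩ := hy.2 c
  have h := hN _ (le_max_left N₀ c)
  have hN' := le_max_right N₀ c
  set N := max N₀ c
  have e : ∑ m ∈ Finset.Icc 1 N,
      ((m.factorial : k)⁻¹) • L.cellBracket n m (fun _ => 1) (fun _ => y) =
      tensorProj n (L.formD n (tensorIncl n y)) +
        tensorProj n (∑ m ∈ Finset.range (N + 1), L.nodeCoeff n y m) := by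
    rw [show Finset.Icc 1 N = Finset.Ico 1 (N + 1) from rfl,
      Finset.sum_eq_sum_Ico_succ_bot (by omega : 1 < N + 1), cellBracket_one, Nat.factorial_one, Nat.cast_one,
      inv_one, one_smul, Finset.range_eq_Ico,
      Finset.sum_eq_sum_Ico_succ_bot (by omega : 0 < N + 1) fun m => L.nodeCoeff n y m,
      Finset.sum_eq_sum_Ico_succ_bot (by omega : 0 + 1 < N + 1) fun m => L.nodeCoeff n y m, L.nodeCoeff_of_le_one n y (m := 0) (by simp),
      L.nodeCoeff_of_le_one n y (m := 0 + 1) (by simp), zero_add, zero_add, map_sum]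
    refine congrArg _ (Finset.sum_congr rfl fun m hm => L.cellBracket_const n y ?_)
    have := (Finset.mem_Ico.1 hm).1
    omega
  rw [e, ← Finset.sum_range_add_sum_Ico _ (by omega : c ≤ N + 1), map_add, ← add_assoc] at h
  refine (Submodule.add_mem_iff_left _ ?_).1 h
  refine L.tensorProj_mem_cellF n (sum_mem fun m hm => ?_)
  exact L.formF_antitone n (Finset.mem_Ico.1 hm).1 (L.nodeCoeff_mem_formF n y m)

theorem formCurvature_sub_mem_formF {y : g ⊗[k] Sullivan.cellular k n} (hy : y ∈ L.MCCells n)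
    {c N : ℕ} (hc : 2 ≤ c) (hN : c ≤ N) : L.formCurvature n (N + 1) (L.partialIncl n y c) -
      L.tensorHomotopy n (L.formD n
        (∑ s ∈ Finset.range N, L.curvatureTerm n (L.partialIncl n y c) (s + 2))) ∈
      L.formF n c := by
  have h1 := L.tensorIncl_mem_formF n (L.sum_cellBracket_mem n hy hc)
  have h2 := L.sum_curvatureTerm_sub_mem_formF n y hN
  have h3 := L.tensorHomotopy_mem_formF n c (L.formD_mem_formF n h2)
  have h4 := L.formD_tensorHomotopy_add n (∑ m ∈ Finset.range c, L.nodeCoeff n y m)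
  have h5 : L.curvatureTerm n (L.partialIncl n y c) (0 + 1) =
      L.formD n (L.partialIncl n y c) := by simp [curvatureTerm]
  have h6 := congrArg (L.formD n) (L.partialIncl_eq n y hc)
  rw [map_sub] at h6
  rw [map_add, incl_proj_formD_incl] at h1
  rw [formCurvature_eq_sum, Finset.sum_range_succ', h5, h6]
  rw [Submodule.mem_comap, map_sub, map_sub] at h3
  convert sub_mem (add_mem h1 h2) h3 using 1
  rw [eq_sub_iff_add_eq.2 h4]
  abel

theorem formCurvature_partialIncl_mem {y : g ⊗[k] Sullivan.cellular k n} (hy : y ∈ L.MCCells n)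
    {c N : ℕ} (hN : c ≤ N) : L.formCurvature n (N + 1) (L.partialIncl n y c) ∈ L.formF n c := by
  rcases le_or_gt c 1 with hc | hc
  · refine L.formF_antitone n hc ?_
    rw [formF_one]
    trivial
  · suffices ∀ e ≤ c, L.formCurvature n (N + 1) (L.partialIncl n y c) ∈ L.formF n e from
      this c le_rfl
    have hdeg : L.partialIncl n y c ∈ L.formDeg n 1 :=
      sum_mem fun m _ => L.inclCoeff_mem_formDeg n hy.1 m
    intro e
    induction e with
    | zero =>
      refine fun _ => L.formF_antitone n (Nat.zero_le 1) ?_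
      rw [formF_one]
      trivial
    | succ e ih =>
      intro he
      refine (Submodule.sub_mem_iff_left _ ?_).1
        (L.formF_antitone n he (L.formCurvature_sub_mem_formF n hy hc hN))
      exact L.tensorHomotopy_mem_formF n _
        (L.formD_sum_mem_formF n N e hdeg (by omega) (ih (by omega)))

theorem MCIncl_mem_gamma {y : g ⊗[k] Sullivan.cellular k n} (hy : y ∈ L.MCCells n) :
    L.MCIncl n y ∈ L.gamma n := by
  refine ⟨⟨fun b c h => ?_, fun c => ?_⟩, fun c => ?_⟩
  · rw [MCIncl_apply, MCIncl_apply]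
    refine (Submodule.Quotient.eq _).2 ?_
    rw [partialIncl, ← Finset.sum_range_add_sum_Ico _ h, partialIncl, LinearMap.id_apply,
      add_sub_cancel_left]
    exact sum_mem fun m hm =>
      L.formF_antitone n (Finset.mem_Ico.1 hm).1 (L.inclCoeff_mem_formF n y m)
  · refine ⟨L.partialIncl n y c, sum_mem fun m _ => L.inclCoeff_mem_formDeg n hy.1 m,
      (L.MCIncl_apply n y c).symm, c + 1, fun N hN => ?_⟩
    obtain ⟨N, rfl⟩ := Nat.exists_eq_add_of_le' (le_of_add_le_right hN)
    exact L.formCurvature_partialIncl_mem n hy (Nat.le_of_succ_le_succ hN)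
  · rw [MCIncl_apply, quotHomotopy]
    refine (congrArg Submodule.Quotient.mk ?_).trans (Submodule.Quotient.mk_zero _)
    rw [partialIncl, map_sum]
    exact Finset.sum_eq_zero fun m _ => L.tensorHomotopy_inclCoeff n y m

end LInftyAlgebra

end

theorem lemma4p5 {k g : Type*} [Field k] [CharZero k] [AddCommGroup g] [Module k g]
    (L : LInftyAlgebra k g) (hL : L.IsComplete) (n : ℕ) :
    L.MCIncl n '' L.MCCells n ⊆ L.gamma n := by
  rintro _ ⟨y, hy, rfl⟩
  exact L.MCIncl_mem_gamma n hy
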